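/- Let $r\ge 0$ and let $\mathbf u=(u_1,\dots,u_r)$ be a tuple of positive integers, $s=u_1+\dots+u_r$. Let $\mathfrak o$ be a discrete valuation ring with maximal ideal $\mathfrak p=(t)$ and finite residue field $\mathfrak o/\mathfrak p=\mathbb F_q$, let $\mu_1>\dots>\mu_r>0$ be integers, let $\lambda$ be the partition in which $\mu_i$ occurs exactly $u_i$ times, and let $$B=M_{\mathfrak o,\lambda}=\bigoplus_{i=1}^r(\mathfrak o/\mathfrak p^{\mu_i})^{u_i}$$ with its standard generators $e_{ij}$ ($1\le i\le r$, $1\le j\le u_i$). Let $B[\mathfrak p]=\{x\in B:\mathfrak p x=0\}$ and let $$\beta:\operatorname{Aut}(B)\to\operatorname{GL}(B/\mathfrak pB)\times\operatorname{GL}(B[\mathfrak p]),\qquad \beta(h)(x+\mathfrak pB,y)=(hx+\mathfrak pB,hy).$$ Identify $\operatorname{GL}(B/\mathfrak pB)\times\operatorname{GL}(B[\mathfrak p])$ with $\operatorname{GL}_{s,s}(q)=\operatorname{GL}_s(\mathbb F_q)\times\operatorname{GL}_s(\mathbb F_q)$ by means of the bases $(e_{ij}+\mathfrak pB)$ and $(t^{\mu_i-1}e_{ij})$,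 and write $Y_{ij},Z_{ij}$ for the $u_i\times u_j$ blocks of $Y,Z\in\operatorname{GL}_s(\mathbb F_q)$. Then $\operatorname{im}\beta$ is the subgroup $$H^{\mathbf u}(q)=\{(Y,Z)\in\operatorname{GL}_{s,s}(q):\ Y_{ij}=0 \text{ for } i<j,\ Z_{ij}=0\text{ for } i>j,\ Y_{ii}=Z_{ii}\text{ for all } i\},$$ which depends only on $\mathbf u$ and $q$. Moreover, $H^{\mathbf u}(q)$, where $q$ runs through all prime powers, is a uniform family of subgroups of $\operatorname{GL}_{s,s}(q)$: for every $(s,s)$-type $\mathcal T$ there is a polynomial $p_{\mathcal T}\in\mathbb Q[x]$ such that $|C\cap H^{\mathbf u}(q)|=p_{\mathcal T}(q)$ for every prime power $q$ and every conjugacy class $C$ of $\operatorname{GL}_{s,s}(q)$ of type $\mathcal T$. Here, for a tuple $\mathbf n=(n_1,\dots,n_k)$, an $\mathbf n$-type is an isomorphism class of triples $(Q,\mathbf d,\boldsymbol\lambda)$ consisting of a finite set $Q$, positive integers $d_j$ ($j\in Q$) and partitions $\lambda^{ij}$ ($1\le i\le k$, $j\in Q$) such that $\sum_{j}d_j|\lambda^{ij}|=n_i$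 for all $i$ and, for each $j$, some $\lambda^{ij}$ is non-empty (an isomorphism is a bijection of the sets $Q$ that preserves all $d_j$ and $\lambda^{ij}$). An element $(g_1,\dots,g_k)$ of $\prod_i\operatorname{GL}_{n_i}(K)$, $K$ a field, and its conjugacy class, have type $[Q,\mathbf d,\boldsymbol\lambda]$ if there are distinct monic irreducible polynomials $f_j\in K[X]$ of degree $d_j$ ($j\in Q$) such that for each $i$ the $K[X]$-module $K^{n_i}$, with $X$ acting as $g_i$, is isomorphic to $\bigoplus_{j\in Q}\bigoplus_{m}K[X]/(f_j^{\lambda^{ij}_m})$. -/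

import Mathlib

open Polynomial IsLocalRing

universe v w

/-! ### Partitions, pretypes and types -/

/-- A partition: a finite (possibly empty) weakly decreasing sequence of positive integers. -/
@[ext]
structure IntPartition where
  parts : List ℕ
  sorted : parts.Pairwise (fun a b => b ≤ a)
  pos : ∀ a ∈ parts, 0 < a

/-- `|λ| = λ₁ + ⋯ + λₛ`. -/
def IntPartition.size (l : IntPartition) : ℕ := l.parts.sum

/-- The `K[X]`-module `M_λ(f) = K[X]/(f^λ₁) ⊕ ⋯ ⊕ K[X]/(f^λₛ)`. -/
abbrev PolyPartitionModule (K : Type w) [Field K] (l : IntPartition) (f : K[X]) : Type w :=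
  ∀ k : Fin l.parts.length, K[X] ⧸ Ideal.span {f ^ l.parts.get k}

/-- An `n`-pretype `(Q, d, λ)`, where `n` is a tuple of integers indexed by `κ`. -/
structure Pretype {κ : Type} (n : κ → ℕ) where
  Q : Type
  [fintypeQ : Fintype Q]
  deg : Q → ℕ
  deg_pos : ∀ j, 0 < deg j
  part : κ → Q → IntPartition
  sum_eq : ∀ i, ∑ j, deg j * (part i j).size = n i
  exists_ne : ∀ j, ∃ i, (part i j).parts ≠ []

attribute [instance] Pretype.fintypeQ

/-- Isomorphism of pretypes. -/
def Pretype.Isom {κ : Type} {n : κ → ℕ} (P P' : Pretype n) : Prop :=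
  ∃ f : P.Q ≃ P'.Q, (∀ j, P'.deg (f j) = P.deg j) ∧ ∀ i j, P'.part i (f j) = P.part i j

instance Pretype.setoid {κ : Type} (n : κ → ℕ) : Setoid (Pretype n) where
  r := Pretype.Isom
  iseqv :=
    { refl := fun P => ⟨Equiv.refl _, fun _ => rfl, fun _ _ => rfl⟩
      symm := by
        rintro P P' ⟨f, h1, h2⟩
        refine ⟨f.symm, fun j => ?_, fun i j => ?_⟩
        · rw [← h1, f.apply_symm_apply]
        · rw [← h2, f.apply_symm_apply]
      trans := by
        rintro P P' P'' ⟨f, h1, h2⟩ ⟨f', h1', h2'⟩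
        refine ⟨f.trans f', fun j => ?_, fun i j => ?_⟩
        · rw [Equiv.trans_apply, h1', h1]
        · rw [Equiv.trans_apply, h2', h2] }

/-- An `n`-type is an isomorphism class of `n`-pretypes. -/
abbrev NType {κ : Type} (n : κ → ℕ) : Type 1 := Quotient (Pretype.setoid n)

/-- The group `GL_n(K) = ∏ i, GL_{n_i}(K)`, with `n_i` the size of the finite index set `m i`. -/
abbrev GLTuple {κ : Type} (m : κ → Type) [∀ i, Fintype (m i)] [∀ i, DecidableEq (m i)]
    (K : Type w) [Field K] : Type w :=
  ∀ i, GL (m i) K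

/-- The tuple `g` realises the pretype `P`: there are distinct monic irreducible polynomials
`F j` of degrees `d j`, for `j ∈ Q`, such that for every `i` the `K[X]`-module defined by `g i`
(with `X` acting as `g i`) is isomorphic to `⨁ j, M_{λ^{ij}}(F j)`. -/
def Pretype.IsPretypeOf {κ : Type} {m : κ → Type} [∀ i, Fintype (m i)] [∀ i, DecidableEq (m i)]
    (P : Pretype (fun i => Fintype.card (m i))) {K : Type w} [Field K] (g : GLTuple m K) : Prop :=
  ∃ F : P.Q → K[X], Function.Injective F ∧
    (∀ j, (F j).Monic ∧ Irreducible (F j) ∧ (F j).natDegree = P.deg j) ∧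
    ∀ i, Nonempty
      (Module.AEval' (Matrix.toLin' (g i : Matrix (m i) (m i) K)) ≃ₗ[K[X]]
        (∀ j : P.Q, PolyPartitionModule K (P.part i j) (F j)))

/-- The element `g` of `GL_n(K)` is of type `T`. -/
def HasType {κ : Type} {m : κ → Type} [∀ i, Fintype (m i)] [∀ i, DecidableEq (m i)]
    {K : Type w} [Field K] (g : GLTuple m K) (T : NType (fun i => Fintype.card (m i))) : Prop :=
  ∃ P : Pretype (fun i => Fintype.card (m i)), Quotient.mk _ P = T ∧ P.IsPretypeOf g

/-- The conjugacy class `C` of `GL_n(K)` is of type `T`. -/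
def ClassHasType {κ : Type} {m : κ → Type} [∀ i, Fintype (m i)] [∀ i, DecidableEq (m i)]
    {K : Type w} [Field K] (C : ConjClasses (GLTuple m K))
    (T : NType (fun i => Fintype.card (m i))) : Prop :=
  ∃ g ∈ C.carrier, HasType g T

/-- A uniform family of subgroups `H(q) ≤ GL_n(q)`, where `q` runs through all prime powers and
`𝔽_q` through all fields with `q` elements: for every `n`-type `T` there is a polynomial whose
value at `q` is `|C ∩ H(q)|` for every conjugacy class `C` of `GL_n(q)` of type `T`. -/
def IsUniformFamily {κ : Type} (m : κ → Type) [∀ i, Fintype (m i)] [∀ i, DecidableEq (m i)]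
    (H : ∀ (F : Type w) [Field F] [Finite F], Subgroup (GLTuple m F)) : Prop :=
  ∀ T : NType (fun i => Fintype.card (m i)), ∃ p : ℚ[X],
    ∀ (F : Type w) [Field F] [Finite F] (C : ConjClasses (GLTuple m F)), ClassHasType C T →
      ((C.carrier ∩ (H F : Set (GLTuple m F))).ncard : ℚ) = p.eval (Nat.card F : ℚ)

/-! ### The map `β` -/

section Beta

variable (o : Type v) [CommRing o] [IsLocalRing o] (B : Type v) [AddCommGroup B] [Module o B]

/-- `B / 𝔭B`. -/
def ModPB : Type v := B ⧸ (maximalIdeal o • (⊤ : Submodule o B))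

noncomputable instance : AddCommGroup (ModPB o B) :=
  inferInstanceAs (AddCommGroup (B ⧸ (maximalIdeal o • (⊤ : Submodule o B))))

noncomputable instance : Module o (ModPB o B) :=
  inferInstanceAs (Module o (B ⧸ (maximalIdeal o • (⊤ : Submodule o B))))

noncomputable instance : Module (ResidueField o) (ModPB o B) :=
  inferInstanceAs (Module (o ⧸ maximalIdeal o) (B ⧸ (maximalIdeal o • (⊤ : Submodule o B))))

/-- `B[𝔭]`, the submodule of elements of `B` that are killed by `𝔭`. -/
def TorsPB : Type v := Submodule.torsionBySet o B (maximalIdeal o : Set o)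

noncomputable instance : AddCommGroup (TorsPB o B) :=
  inferInstanceAs (AddCommGroup (Submodule.torsionBySet o B (maximalIdeal o : Set o)))

noncomputable instance : Module o (TorsPB o B) :=
  inferInstanceAs (Module o (Submodule.torsionBySet o B (maximalIdeal o : Set o)))

noncomputable instance : Module (ResidueField o) (TorsPB o B) :=
  inferInstanceAs (Module (o ⧸ maximalIdeal o)
    (Submodule.torsionBySet o B (maximalIdeal o : Set o)))

variable {B}

/-- The projection `x ↦ x + 𝔭B`. -/
noncomputable def ModPB.mk : B →ₗ[o] ModPB o B :=
  (maximalIdeal o • (⊤ : Submodule o B)).mkQ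

theorem ModPB.mk_surjective : Function.Surjective (ModPB.mk o (B := B)) :=
  Submodule.mkQ_surjective _

/-- The inclusion of `B[𝔭]` in `B`. -/
noncomputable def TorsPB.incl : TorsPB o B →ₗ[o] B :=
  (Submodule.torsionBySet o B (maximalIdeal o : Set o)).subtype

theorem TorsPB.incl_injective : Function.Injective (TorsPB.incl o (B := B)) :=
  Submodule.subtype_injective _

instance : IsScalarTower o (ResidueField o) (ModPB o B) :=
  IsScalarTower.of_algebraMap_smul fun a x => by
    obtain ⟨x, rfl⟩ := ModPB.mk_surjective o x
    rfl

instance : IsScalarTower o (ResidueField o) (TorsPB o B) :=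
  IsScalarTower.of_algebraMap_smul fun _ _ => rfl

/-- The endomorphism `x + 𝔭B ↦ h x + 𝔭B` of `B / 𝔭B` induced by `h`. -/
noncomputable def modPMap (h : B →ₗ[o] B) : ModPB o B →ₗ[ResidueField o] ModPB o B :=
  let f : ModPB o B →ₗ[o] ModPB o B :=
    Submodule.mapQ (maximalIdeal o • (⊤ : Submodule o B)) (maximalIdeal o • (⊤ : Submodule o B)) h
      (by
        rw [← Submodule.map_le_iff_le_comap, Submodule.map_smul'']
        exact smul_mono_right _ le_top)
  { toFun := f
    map_add' := map_add f
    map_smul' := fun c x => by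
      obtain ⟨c, rfl⟩ := residue_surjective c
      exact map_smul f c x }

/-- The restriction `y ↦ h y` of `h` to `B[𝔭]`. -/
noncomputable def torsPMap (h : B →ₗ[o] B) : TorsPB o B →ₗ[ResidueField o] TorsPB o B :=
  let f : TorsPB o B →ₗ[o] TorsPB o B :=
    h.restrict (p := Submodule.torsionBySet o B (maximalIdeal o : Set o))
      (q := Submodule.torsionBySet o B (maximalIdeal o : Set o)) (fun y hy => by
        rw [Submodule.mem_torsionBySet_iff] at hy ⊢
        intro a
        rw [← map_smul, hy a, map_zero])
  { toFun := f
    map_add' := map_add f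
    map_smul' := fun c x => by
      obtain ⟨c, rfl⟩ := residue_surjective c
      exact map_smul f c x }

@[simp] theorem modPMap_mk (h : B →ₗ[o] B) (x : B) :
    modPMap o h (ModPB.mk o x) = ModPB.mk o (h x) := rfl

@[simp] theorem incl_torsPMap (h : B →ₗ[o] B) (y : TorsPB o B) :
    TorsPB.incl o (torsPMap o h y) = h (TorsPB.incl o y) := rfl

/-- `modPMap` as a homomorphism of monoids. -/
noncomputable def modPHom : (B →ₗ[o] B) →* (ModPB o B →ₗ[ResidueField o] ModPB o B) where
  toFun := modPMap o
  map_one' := by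
    refine LinearMap.ext fun x => ?_
    obtain ⟨x, rfl⟩ := ModPB.mk_surjective o x
    rfl
  map_mul' h h' := by
    refine LinearMap.ext fun x => ?_
    obtain ⟨x, rfl⟩ := ModPB.mk_surjective o x
    rfl

/-- `torsPMap` as a homomorphism of monoids. -/
noncomputable def torsPHom : (B →ₗ[o] B) →* (TorsPB o B →ₗ[ResidueField o] TorsPB o B) where
  toFun := torsPMap o
  map_one' := LinearMap.ext fun _ => rfl
  map_mul' _ _ := LinearMap.ext fun _ => rfl

/-- The natural map `β : Aut(B) → GL(B/𝔭B) × GL(B[𝔭])`. -/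
noncomputable def beta : LinearMap.GeneralLinearGroup o B →*
    LinearMap.GeneralLinearGroup (ResidueField o) (ModPB o B) ×
      LinearMap.GeneralLinearGroup (ResidueField o) (TorsPB o B) :=
  (Units.map (modPHom o)).prod (Units.map (torsPHom o))

end Beta

/-! ### The module `B = M_{𝔬,λ}` and its bases -/

/-- The index set of size `s = u₁ + ⋯ + u_r`, divided into blocks of sizes `u₁, …, u_r`. -/
abbrev BlockIdx {r : ℕ} (u : Fin r → ℕ) : Type := Σ i : Fin r, Fin (u i)

section Bases

variable {r : ℕ} (μ u : Fin r → ℕ) (o : Type v) [CommRing o] [IsDomain o]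
  [IsDiscreteValuationRing o]

/-- `M_{𝔬,λ} = ⨁_{i,j} 𝔬/𝔭^{μ_i}`, `1 ≤ j ≤ u_i`, where `λ` is the partition in which the part
`μ_i` occurs `u_i` times. -/
abbrev DVRModule : Type v := ∀ x : BlockIdx u, o ⧸ (maximalIdeal o ^ μ x.1)

/-- The generators `e_{ij}` of `M_{𝔬,λ}`. -/
noncomputable def genE (x : BlockIdx u) : DVRModule μ u o := Pi.single x 1

variable {μ o}

theorem pow_mem_iff_dvd {t : o} (ht : Irreducible t) (n : ℕ) (a : o) :
    a ∈ maximalIdeal o ^ n ↔ t ^ n ∣ a := by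
  rw [ht.maximalIdeal_eq, Ideal.span_singleton_pow, Ideal.mem_span_singleton]

theorem sum_smul_genE (a : BlockIdx u → o) :
    ∑ x, a x • genE μ u o x = fun x => Ideal.Quotient.mk _ (a x) := by
  funext y
  rw [Finset.sum_apply, Finset.sum_eq_single y]
  · simp [genE, Algebra.smul_def]
  · intro x _ hx
    simp [genE, Pi.single_eq_of_ne hx.symm]
  · simp

theorem exists_sum_smul_genE (b : DVRModule μ u o) :
    ∃ a : BlockIdx u → o, b = ∑ x, a x • genE μ u o x := by
  choose a ha using fun x => Ideal.Quotient.mk_surjective (b x)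
  exact ⟨a, by rw [sum_smul_genE]; funext x; exact (ha x).symm⟩

theorem mk_pow_eq_zero_iff {t : o} (ht : Irreducible t) (n : ℕ) (a : o) :
    (Ideal.Quotient.mk (maximalIdeal o ^ n) a) = 0 ↔ t ^ n ∣ a := by
  rw [Ideal.Quotient.eq_zero_iff_mem, pow_mem_iff_dvd ht]

theorem residue_eq_zero_iff_dvd {t : o} (ht : Irreducible t) (a : o) :
    residue o a = 0 ↔ t ∣ a := by
  rw [residue_eq_zero_iff, ht.maximalIdeal_eq, Ideal.mem_span_singleton]

theorem ModPB.mk_eq_zero_iff {B : Type v} [AddCommGroup B] [Module o B] {t : o}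
    (ht : Irreducible t) (b : B) : ModPB.mk o b = 0 ↔ ∃ c, b = t • c := by
  refine (Submodule.Quotient.mk_eq_zero (maximalIdeal o • (⊤ : Submodule o B))).trans ?_
  rw [ht.maximalIdeal_eq, Submodule.ideal_span_singleton_smul, Submodule.mem_smul_pointwise_iff_exists]
  simp [eq_comm]

theorem mem_torsPB_iff {B : Type v} [AddCommGroup B] [Module o B] {t : o}
    (ht : Irreducible t) (b : B) :
    b ∈ Submodule.torsionBySet o B (maximalIdeal o : Set o) ↔ t • b = 0 := by
  rw [ht.maximalIdeal_eq, Submodule.torsionBySet_span_singleton_eq, Submodule.mem_torsionBy_iff]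

/-- The elements `f_{ij} = t^{μ_i - 1} e_{ij}` of `B[𝔭]`. -/
noncomputable def genF (hμ : ∀ i, 0 < μ i) {t : o} (ht : Irreducible t) (x : BlockIdx u) :
    TorsPB o (DVRModule μ u o) :=
  ⟨t ^ (μ x.1 - 1) • genE μ u o x, by
    rw [mem_torsPB_iff ht, smul_smul, ← pow_succ', Nat.sub_add_cancel (hμ x.1)]
    funext y
    by_cases h : y = x
    · subst h
      simp only [genE, Pi.smul_apply, Pi.single_eq_same, Pi.zero_apply, Algebra.smul_def, mul_one]
      exact (mk_pow_eq_zero_iff ht _ _).2 dvd_rfl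
    · simp [genE, Pi.single_eq_of_ne h]⟩

/-- The elements `e_{ij} + 𝔭B` form a basis of `B / 𝔭B`. -/
noncomputable def basisE (hμ : ∀ i, 0 < μ i) :
    Module.Basis (BlockIdx u) (ResidueField o) (ModPB o (DVRModule μ u o)) :=
  Module.Basis.mk (v := fun x => ModPB.mk o (genE μ u o x))
    (by
      obtain ⟨t, ht⟩ := IsDiscreteValuationRing.exists_irreducible o
      rw [Fintype.linearIndependent_iff]
      intro c hc x
      choose a ha using fun x => residue_surjective (c x)
      have h1 : ModPB.mk o (∑ x, a x • genE μ u o x) = 0 := by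
        rw [map_sum, ← hc]
        refine Finset.sum_congr rfl fun x _ => ?_
        rw [← ha x, map_smul, ← algebraMap_smul (ResidueField o) (a x)]
        rfl
      rw [ModPB.mk_eq_zero_iff ht, sum_smul_genE] at h1
      obtain ⟨b, hb⟩ := h1
      have h2 := congrFun hb x
      obtain ⟨b', hb'⟩ := Ideal.Quotient.mk_surjective (b x)
      rw [Pi.smul_apply, ← hb', Algebra.smul_def, Ideal.Quotient.algebraMap_eq, ← map_mul,
        ← sub_eq_zero, ← map_sub, mk_pow_eq_zero_iff ht] at h2
      rw [← ha x, residue_eq_zero_iff_dvd ht]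
      have h3 := (dvd_pow_self t (hμ x.1).ne').trans h2
      exact (dvd_sub_left (dvd_mul_right t b')).1 h3)
    (by
      rintro y -
      obtain ⟨b, rfl⟩ := ModPB.mk_surjective o y
      obtain ⟨a, rfl⟩ := exists_sum_smul_genE u b
      rw [map_sum]
      refine Submodule.sum_mem _ fun x _ => ?_
      rw [map_smul, ← algebraMap_smul (ResidueField o) (a x)]
      exact Submodule.smul_mem _ _ (Submodule.subset_span ⟨x, rfl⟩))

/-- The elements `f_{ij} = t^{μ_i - 1} e_{ij}` form a basis of `B[𝔭]`. -/
noncomputable def basisF (hμ : ∀ i, 0 < μ i) {t : o} (ht : Irreducible t) :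
    Module.Basis (BlockIdx u) (ResidueField o) (TorsPB o (DVRModule μ u o)) :=
  Module.Basis.mk (v := genF u hμ ht)
    (by
      rw [Fintype.linearIndependent_iff]
      intro c hc x
      choose a ha using fun x => residue_surjective (c x)
      have h1 : ∑ x, (a x * t ^ (μ x.1 - 1)) • genE μ u o x = 0 := by
        have h2 := congrArg (TorsPB.incl o) hc
        rw [map_sum, map_zero] at h2
        refine Eq.trans (Finset.sum_congr rfl fun x _ => ?_) h2
        rw [← ha x, mul_smul]
        rfl
      rw [sum_smul_genE] at h1
      have h2 := (mk_pow_eq_zero_iff ht _ _).1 (congrFun h1 x)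
      rw [← ha x, residue_eq_zero_iff_dvd ht]
      rw [← mul_pow_sub_one (hμ x.1).ne'] at h2
      exact (mul_dvd_mul_iff_right (pow_ne_zero _ ht.ne_zero)).1 h2)
    (by
      rintro ⟨b, hb⟩ -
      rw [mem_torsPB_iff ht] at hb
      obtain ⟨a, rfl⟩ := exists_sum_smul_genE u b
      have h1 : ∀ x, ∃ c, a x = t ^ (μ x.1 - 1) * c := by
        intro x
        rw [sum_smul_genE] at hb
        have h2 := congrFun hb x
        rw [Pi.smul_apply, Algebra.smul_def, Ideal.Quotient.algebraMap_eq, ← map_mul] at h2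
        have h3 := (mk_pow_eq_zero_iff ht _ _).1 h2
        rw [← mul_pow_sub_one (hμ x.1).ne'] at h3
        exact (mul_dvd_mul_iff_left ht.ne_zero).1 h3
      choose c hc using h1
      have h2 : (⟨∑ x, a x • genE μ u o x, (mem_torsPB_iff ht _).2 hb⟩ :
          TorsPB o (DVRModule μ u o)) = ∑ x, residue o (c x) • genF u hμ ht x := by
        apply TorsPB.incl_injective o
        rw [map_sum]
        refine Finset.sum_congr rfl fun x _ => ?_
        rw [hc x, mul_comm, mul_smul]
        rfl
      rw [h2]
      exact Submodule.sum_mem _ fun x _ =>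
        Submodule.smul_mem _ _ (Submodule.subset_span ⟨x, rfl⟩))

@[simp] theorem basisE_apply (hμ : ∀ i, 0 < μ i) (x : BlockIdx u) :
    basisE (o := o) u hμ x = ModPB.mk o (genE μ u o x) := by
  simp [basisE]

@[simp] theorem incl_basisF_apply (hμ : ∀ i, 0 < μ i) {t : o} (ht : Irreducible t)
    (x : BlockIdx u) :
    TorsPB.incl o (basisF u hμ ht x) = t ^ (μ x.1 - 1) • genE μ u o x := by
  rw [basisF, Module.Basis.mk_apply]
  rfl

/-- The isomorphism `GL(V) ≃ GL_s(K)` given by a basis of `V`. -/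
noncomputable def glOfBasis {ι : Type} [Fintype ι] [DecidableEq ι] {K V : Type v} [Field K]
    [AddCommGroup V] [Module K V] (b : Module.Basis ι K V) :
    LinearMap.GeneralLinearGroup K V ≃* GL ι K :=
  Units.mapEquiv (LinearMap.toMatrixAlgEquiv b).toMulEquiv

/-- The identification of `GL(B/𝔭B) × GL(B[𝔭])` with `GL_{s,s}(𝔬/𝔭)` given by the bases
`e_{ij} + 𝔭B` and `f_{ij}`: a pair goes to the pair `(Y, Z)` of its matrices. -/
noncomputable def toGLPair (hμ : ∀ i, 0 < μ i) {t : o} (ht : Irreducible t) :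
    LinearMap.GeneralLinearGroup (ResidueField o) (ModPB o (DVRModule μ u o)) ×
      LinearMap.GeneralLinearGroup (ResidueField o) (TorsPB o (DVRModule μ u o)) →*
    GLTuple (fun _ : Fin 2 => BlockIdx u) (ResidueField o) where
  toFun g := ![glOfBasis (basisE u hμ) g.1, glOfBasis (basisF u hμ ht) g.2]
  map_one' := by
    funext i
    fin_cases i
    · exact map_one (glOfBasis (basisE u hμ))
    · exact map_one (glOfBasis (basisF u hμ ht))
  map_mul' g h := by
    funext i
    fin_cases i
    · exact map_mul (glOfBasis (basisE u hμ)) g.1 h.1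
    · exact map_mul (glOfBasis (basisF u hμ ht)) g.2 h.2

/-- The image of `β`, for `B = M_{𝔬,λ}`, as a subgroup of `GL_{s,s}(𝔬/𝔭)`. -/
noncomputable def betaImage (hμ : ∀ i, 0 < μ i) {t : o} (ht : Irreducible t) :
    Subgroup (GLTuple (fun _ : Fin 2 => BlockIdx u) (ResidueField o)) :=
  (beta o (B := DVRModule μ u o)).range.map (toGLPair u hμ ht)

end Bases

/-! ### The block-triangular subgroup `H^u(q)` -/

section Block

variable {r : ℕ} (u : Fin r → ℕ) (K : Type w) [Field K]

/-- The block `M_{ij}`, a `u_i × u_j` matrix. -/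
def blockOf {u : Fin r → ℕ} {K : Type w} (M : Matrix (BlockIdx u) (BlockIdx u) K) (i j : Fin r) :
    Matrix (Fin (u i)) (Fin (u j)) K :=
  Matrix.of fun a b => M ⟨i, a⟩ ⟨j, b⟩

/-- The conditions that describe the pairs `(Y, Z)` in the image of `β`. -/
def IsBlockPair {u : Fin r → ℕ} {K : Type w} [Field K]
    (Y Z : Matrix (BlockIdx u) (BlockIdx u) K) : Prop :=
  (∀ i j, i < j → blockOf Y i j = 0) ∧ (∀ i j, j < i → blockOf Z i j = 0) ∧
    ∀ i, blockOf Y i i = blockOf Z i i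

variable {u K}

theorem blockOf_one (i : Fin r) : blockOf (1 : Matrix (BlockIdx u) (BlockIdx u) K) i i = 1 := by
  ext a b
  simp [blockOf, Matrix.one_apply]

theorem blockOf_mul (M N : Matrix (BlockIdx u) (BlockIdx u) K) (i j : Fin r) :
    blockOf (M * N) i j = ∑ k, blockOf M i k * blockOf N k j := by
  ext a b
  simp [blockOf, Matrix.mul_apply, Fintype.sum_sigma, Matrix.sum_apply]

theorem lower_iff (M : Matrix (BlockIdx u) (BlockIdx u) K) :
    (∀ i j, i < j → blockOf M i j = 0) ↔
      M.BlockTriangular (fun x : BlockIdx u => OrderDual.toDual x.1) := by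
  constructor
  · rintro h ⟨i, a⟩ ⟨j, b⟩ hij
    exact congrFun (congrFun (h i j hij) a) b
  · intro h i j hij
    ext a b
    exact h (i := ⟨i, a⟩) (j := ⟨j, b⟩) hij

theorem upper_iff (M : Matrix (BlockIdx u) (BlockIdx u) K) :
    (∀ i j, j < i → blockOf M i j = 0) ↔ M.BlockTriangular (fun x : BlockIdx u => x.1) := by
  constructor
  · rintro h ⟨i, a⟩ ⟨j, b⟩ hij
    exact congrFun (congrFun (h i j hij) a) b
  · intro h i j hij
    ext a b
    exact h (i := ⟨i, a⟩) (j := ⟨j, b⟩) hij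

theorem blockOf_mul_diag_lower {M N : Matrix (BlockIdx u) (BlockIdx u) K}
    (hM : ∀ i j, i < j → blockOf M i j = 0) (hN : ∀ i j, i < j → blockOf N i j = 0)
    (i : Fin r) : blockOf (M * N) i i = blockOf M i i * blockOf N i i := by
  rw [blockOf_mul, Finset.sum_eq_single i]
  · intro k _ hk
    rcases lt_or_gt_of_ne hk with h | h
    · rw [hN k i h, Matrix.mul_zero]
    · rw [hM i k h, Matrix.zero_mul]
  · simp

theorem blockOf_mul_diag_upper {M N : Matrix (BlockIdx u) (BlockIdx u) K}
    (hM : ∀ i j, j < i → blockOf M i j = 0) (hN : ∀ i j, j < i → blockOf N i j = 0)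
    (i : Fin r) : blockOf (M * N) i i = blockOf M i i * blockOf N i i := by
  rw [blockOf_mul, Finset.sum_eq_single i]
  · intro k _ hk
    rcases lt_or_gt_of_ne hk with h | h
    · rw [hM i k h, Matrix.zero_mul]
    · rw [hN k i h, Matrix.mul_zero]
  · simp

variable (u K)

/-- The subgroup `H^u(q)` of `GL_{s,s}(q)`: the pairs `(Y, Z)` such that `Y` is block lower
triangular, `Z` is block upper triangular, and `Y`, `Z` have the same diagonal blocks. -/
def blockSubgroup : Subgroup (GLTuple (fun _ : Fin 2 => BlockIdx u) K) where
  carrier := {g | IsBlockPair (g 0 : Matrix (BlockIdx u) (BlockIdx u) K)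
    (g 1 : Matrix (BlockIdx u) (BlockIdx u) K)}
  one_mem' := by
    refine ⟨?_, ?_, fun i => rfl⟩
    · exact (lower_iff _).2 Matrix.blockTriangular_one
    · exact (upper_iff _).2 Matrix.blockTriangular_one
  mul_mem' := by
    rintro g h ⟨g1, g2, g3⟩ ⟨h1, h2, h3⟩
    refine ⟨?_, ?_, fun i => ?_⟩
    · exact (lower_iff _).2 (((lower_iff _).1 g1).mul ((lower_iff _).1 h1))
    · exact (upper_iff _).2 (((upper_iff _).1 g2).mul ((upper_iff _).1 h2))
    · simp only [Pi.mul_apply, Units.val_mul]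
      rw [blockOf_mul_diag_lower g1 h1, blockOf_mul_diag_upper g2 h2, g3, h3]
  inv_mem' := by
    rintro g ⟨g1, g2, g3⟩
    have l1 : ∀ i j, i < j →
        blockOf ((g⁻¹) 0 : Matrix (BlockIdx u) (BlockIdx u) K) i j = 0 := by
      rw [lower_iff, Pi.inv_apply, Matrix.coe_units_inv]
      let _ := (g 0).invertible
      exact Matrix.blockTriangular_inv_of_blockTriangular ((lower_iff _).1 g1)
    have l2 : ∀ i j, j < i →
        blockOf ((g⁻¹) 1 : Matrix (BlockIdx u) (BlockIdx u) K) i j = 0 := by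
      rw [upper_iff, Pi.inv_apply, Matrix.coe_units_inv]
      let _ := (g 1).invertible
      exact Matrix.blockTriangular_inv_of_blockTriangular ((upper_iff _).1 g2)
    refine ⟨l1, l2, fun i => ?_⟩
    have e1 := blockOf_mul_diag_lower l1 g1 i
    have e2 := blockOf_mul_diag_upper g2 l2 i
    rw [Pi.inv_apply, Units.inv_mul, blockOf_one] at e1
    rw [Pi.inv_apply, Units.mul_inv, blockOf_one] at e2
    rw [← g3 i] at e2
    exact left_inv_eq_right_inv e1.symm e2.symm

end Block

/-! Image of β. An endomorphism of `B` is given by lifted coefficients a_xy in 𝔬, subject only to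
t^(μ_x) ∣ t^(μ_y) a_xy. Cancelling one factor t gives b_xy with t^(μ_y - 1) a_xy = t^(μ_x - 1) b_xy;
the residues of a and b are the matrices on B/𝔭B and on B[𝔭]. Comparing exponents of t, the residue
of a vanishes where μ_x > μ_y, that of b where μ_x < μ_y, and both agree where μ_x = μ_y. Conversely
every block pair lifts to such a and b, and Nakayama's lemma makes the resulting endomorphism
invertible (`betaImage_eq_blockSubgroup`).

Uniformity. A class of a given type consists of the pairs of matrices whose K[X]-modules have
prescribed isomorphism types, encoded as multisets of pairs (j, m) standing for summands
K[X]/(F_j^(m+1)). Splitting off the first diagonal block A turns Y into a lower triangular matrix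
with diagonal A, Y' and Z into an upper triangular one with diagonal A, Z'. The number of
off-diagonal blocks that produce a given total type depends only on the types of the diagonal
blocks: it is a Hall number times numbers of automorphisms and a power of q, divided by a number of
automorphisms (`card_blockEnd_mul_autNum`, a form of Riedtmann's formula). This gives a recursion
over the number of blocks (`pairCount_succ`).

It remains to see that Hall numbers and numbers of automorphisms are rational functions of q that
depend only on the degrees of the F_j. For a cyclic submodule Rx the type of M/Rx is determined by
the orders of the components of x (`hasTy_quotient_span_iff`), so the count is an explicit
expression in powers of q (`card_hasOrd_hasTy_quotient`). Associativity of the Hall algebra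
(`hallNum_assoc`) gives a triangular system of equations with nonzero diagonal coefficients
(`typeInv_le_of_cycNum_ne_zero`, `cycNum_cons_pos`) that reduces all Hall numbers to the cyclic
ones. Automorphisms are counted by removing one cyclic summand at a time (`autNum_cons`).

Finally, a rational function with integer values at infinitely many positive integers is a
polynomial; if only finitely many q occur, interpolation suffices
(`IsRationalIn.exists_polynomial`). -/

set_option linter.unusedSectionVars false

/-! ### Cyclic modules of prime power order -/

section Cyclic

variable {R : Type w} [CommRing R] [IsDomain R] [IsPrincipalIdealRing R] {p : R}

theorem smul_mk_eq_zero_iff (a r y : R) :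
    r • (Ideal.Quotient.mk (Ideal.span {a}) y) = 0 ↔ a ∣ r * y := by
  rw [Algebra.smul_def, Ideal.Quotient.algebraMap_eq, ← map_mul, Ideal.Quotient.eq_zero_iff_mem,
    Ideal.mem_span_singleton]

theorem card_quotient_span_pow (hp : Prime p) (m : ℕ) :
    Nat.card (R ⧸ Ideal.span {p ^ m}) = Nat.card (R ⧸ Ideal.span {p}) ^ m := by
  have : (Ideal.span {p}).IsPrime := (Ideal.span_singleton_prime hp.ne_zero).2 hp
  have h := cardQuot_pow_of_prime (P := Ideal.span {p}) (i := m)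
    (by rw [Ne, Ideal.span_singleton_eq_bot]; exact hp.ne_zero)
  rw [Ideal.span_singleton_pow] at h
  exact h

/-- The annihilator of `y` is principal and contains p^m, so its generator divides p^m and is
associated to a power of p. -/
theorem exists_smul_eq_zero_iff_pow_dvd (hp : Prime p) {m : ℕ} (y : R ⧸ Ideal.span {p ^ m}) :
    ∃ a ≤ m, ∀ r : R, r • y = 0 ↔ p ^ a ∣ r := by
  obtain ⟨g, hg⟩ := IsPrincipalIdealRing.principal (LinearMap.ker (LinearMap.toSpanSingleton R _ y))
  have hm : ∀ r : R, r • y = 0 ↔ g ∣ r := fun r => by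
    have h : r ∈ LinearMap.ker (LinearMap.toSpanSingleton R _ y) ↔ r ∈ Submodule.span R {g} := by
      rw [hg]
    exact h.trans Ideal.mem_span_singleton
  have h1 : g ∣ p ^ m := by
    rw [← hm]
    obtain ⟨y, rfl⟩ := Ideal.Quotient.mk_surjective y
    rw [smul_mk_eq_zero_iff]
    exact dvd_mul_right _ _
  obtain ⟨a, ha, h2⟩ := (dvd_prime_pow hp m).1 h1
  exact ⟨a, ha, fun r => by rw [hm, h2.dvd_iff_dvd_left]⟩

/-- The least `a` such that `p ^ a` kills `y`. -/
noncomputable def ordExp {M : Type*} [AddCommGroup M] [Module R M] (p : R) (y : M) : ℕ :=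
  sInf {a | p ^ a • y = 0}

theorem smul_eq_zero_iff_pow_ordExp_dvd (hp : Prime p) {m : ℕ} (y : R ⧸ Ideal.span {p ^ m})
    (r : R) : r • y = 0 ↔ p ^ ordExp p y ∣ r := by
  obtain ⟨a, -, h⟩ := exists_smul_eq_zero_iff_pow_dvd hp y
  have : ordExp p y = a := by
    have : {b | p ^ b • y = 0} = Set.Ici a := by
      ext b
      rw [Set.mem_ofPred_eq, h, pow_dvd_pow_iff hp.ne_zero hp.not_isUnit, Set.mem_Ici]
    rw [ordExp, this, csInf_Ici]
  rw [this, h]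

theorem pow_smul_eq_zero_iff_ordExp_le (hp : Prime p) {m : ℕ} (y : R ⧸ Ideal.span {p ^ m})
    (b : ℕ) : p ^ b • y = 0 ↔ ordExp p y ≤ b := by
  rw [smul_eq_zero_iff_pow_ordExp_dvd hp, pow_dvd_pow_iff hp.ne_zero hp.not_isUnit]

theorem ordExp_le (hp : Prime p) {m : ℕ} (y : R ⧸ Ideal.span {p ^ m}) : ordExp p y ≤ m := by
  rw [← pow_smul_eq_zero_iff_ordExp_le hp]
  obtain ⟨y, rfl⟩ := Ideal.Quotient.mk_surjective y
  rw [smul_mk_eq_zero_iff]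
  exact dvd_mul_right _ _

/-- In R/(p^m) divisibility and torsion are interchangeable. The truncated subtraction is right also
for k ≥ m, where both sides say y = 0. -/
theorem exists_pow_smul_eq_iff (hp : Prime p) {m : ℕ} (k : ℕ) (y : R ⧸ Ideal.span {p ^ m}) :
    (∃ z, p ^ k • z = y) ↔ p ^ (m - k) • y = 0 := by
  constructor
  · rintro ⟨z, rfl⟩
    rw [smul_smul, ← pow_add, pow_smul_eq_zero_iff_ordExp_le hp]
    exact (ordExp_le hp z).trans (by omega)
  · intro h
    obtain ⟨y, rfl⟩ := Ideal.Quotient.mk_surjective y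
    rcases le_total k m with hk | hk
    · rw [smul_mk_eq_zero_iff, ← Nat.sub_add_cancel hk, pow_add, Nat.add_sub_cancel] at h
      obtain ⟨c, rfl⟩ := (mul_dvd_mul_iff_left (pow_ne_zero _ hp.ne_zero)).1 h
      exact ⟨Ideal.Quotient.mk _ c, by
        rw [Algebra.smul_def, Ideal.Quotient.algebraMap_eq, ← map_mul]⟩
    · rw [Nat.sub_eq_zero_of_le hk, pow_zero, one_smul] at h
      exact ⟨0, by rw [h, smul_zero]⟩

/-- This is the annihilator of the class of `y` modulo p^k: by the previous lemma r·y is divisible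
by p^k exactly when p^(m-k) kills it, which lowers the order exponent of `y` by m - k, truncated at
0. -/
theorem exists_pow_smul_eq_smul_iff (hp : Prime p) {m : ℕ} (k : ℕ) (y : R ⧸ Ideal.span {p ^ m})
    (r : R) : (∃ z, p ^ k • z = r • y) ↔ p ^ (ordExp p y - (m - k)) ∣ r := by
  rw [exists_pow_smul_eq_iff hp, smul_smul, smul_eq_zero_iff_pow_ordExp_dvd hp]
  rcases le_total (ordExp p y) (m - k) with h | h
  · rw [Nat.sub_eq_zero_of_le h, pow_zero]
    exact ⟨fun _ => one_dvd _, fun _ => (pow_dvd_pow p h).mul_right r⟩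
  · conv_lhs => rw [← Nat.sub_add_cancel h, add_comm, pow_add]
    exact mul_dvd_mul_iff_left (pow_ne_zero _ hp.ne_zero)

/-- With l = min k m, the torsion is the cyclic submodule generated by p^(m-l), whose annihilator is
(p^l); hence it is a copy of R/(p^l). -/
theorem card_pow_smul_eq_zero (hp : Prime p) (m k : ℕ) :
    Nat.card {y : R ⧸ Ideal.span {p ^ m} // p ^ k • y = 0} =
      Nat.card (R ⧸ Ideal.span {p}) ^ min k m := by
  set l := min k m with hl
  have hlm : l ≤ m := min_le_right _ _
  let f := LinearMap.toSpanSingleton R (R ⧸ Ideal.span {p ^ m}) (Ideal.Quotient.mk _ (p ^ (m - l)))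
  have hker : LinearMap.ker f = Ideal.span {p ^ l} := by
    ext r
    change r • (Ideal.Quotient.mk _ (p ^ (m - l))) = 0 ↔ _
    rw [smul_mk_eq_zero_iff, Ideal.mem_span_singleton]
    conv_lhs => rw [← Nat.sub_add_cancel hlm, add_comm, pow_add, Nat.add_sub_cancel_left]
    exact mul_dvd_mul_iff_right (pow_ne_zero _ hp.ne_zero)
  have hr : ∀ y, y ∈ LinearMap.range f ↔ p ^ k • y = 0 := by
    intro y
    have h1 : p ^ k • y = 0 ↔ p ^ l • y = 0 := by
      rw [pow_smul_eq_zero_iff_ordExp_le hp, pow_smul_eq_zero_iff_ordExp_le hp, hl, le_min_iff]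
      exact ⟨fun h => ⟨h, ordExp_le hp y⟩, fun h => h.1⟩
    have h2 := exists_pow_smul_eq_iff hp (m := m) (m - l) y
    rw [Nat.sub_sub_self hlm] at h2
    rw [h1, ← h2]
    constructor
    · rintro ⟨r, rfl⟩
      refine ⟨Ideal.Quotient.mk _ r, ?_⟩
      change _ = r • (Ideal.Quotient.mk _ (p ^ (m - l)))
      rw [Algebra.smul_def, Algebra.smul_def, mul_comm]
      rfl
    · rintro ⟨z, rfl⟩
      obtain ⟨r, rfl⟩ := Ideal.Quotient.mk_surjective z
      refine ⟨r, ?_⟩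
      change r • (Ideal.Quotient.mk _ (p ^ (m - l))) = _
      rw [Algebra.smul_def, Algebra.smul_def, mul_comm]
      rfl
  rw [← card_quotient_span_pow hp, ← hker, Nat.card_congr f.quotKerEquivRange.toEquiv]
  exact Nat.card_congr (Equiv.subtypeEquivRight fun y => (hr y).symm)

theorem smul_bijective_of_isCoprime {a b : R} (h : IsCoprime a b) :
    Function.Bijective fun y : R ⧸ Ideal.span {b} => a • y := by
  obtain ⟨s, t, hst⟩ := h
  have key : ∀ y : R ⧸ Ideal.span {b}, (s * a) • y = y := by
    intro y
    obtain ⟨y, rfl⟩ := Ideal.Quotient.mk_surjective y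
    rw [← sub_eq_zero, Algebra.smul_def, Ideal.Quotient.algebraMap_eq, ← map_mul, ← map_sub,
      Ideal.Quotient.eq_zero_iff_mem, Ideal.mem_span_singleton]
    exact ⟨-t * y, by linear_combination y * hst⟩
  refine ⟨fun y z h => ?_, fun y => ⟨s • y, ?_⟩⟩
  · rw [← key y, ← key z, mul_smul, mul_smul]
    exact congrArg (s • ·) h
  · change a • s • y = y
    rw [smul_smul, mul_comm, key]

/-- Elements of exact order exponent a are the p^a-torsion minus the p^(a-1)-torsion. The count is
stated in ℤ so that the subtraction survives later substitution of powers of q; a = 0 leaves only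
the zero element. -/
theorem card_ordExp_eq (hp : Prime p) [Finite (R ⧸ Ideal.span {p})] {m a : ℕ} (ha : a ≤ m) :
    (Nat.card {y : R ⧸ Ideal.span {p ^ m} // ordExp p y = a} : ℤ) =
      if a = 0 then 1 else (Nat.card (R ⧸ Ideal.span {p}) : ℤ) ^ a -
        (Nat.card (R ⧸ Ideal.span {p}) : ℤ) ^ (a - 1) := by
  have hfin : Finite (R ⧸ Ideal.span {p ^ m}) := by
    apply Nat.finite_of_card_ne_zero
    rw [card_quotient_span_pow hp]
    exact pow_ne_zero _ Nat.card_pos.ne'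
  have key : ∀ b ≤ m, Nat.card {y : R ⧸ Ideal.span {p ^ m} // ordExp p y ≤ b} =
      Nat.card (R ⧸ Ideal.span {p}) ^ b := by
    intro b hb
    rw [← min_eq_left hb, ← card_pow_smul_eq_zero hp m b, min_eq_left hb]
    exact Nat.card_congr (Equiv.subtypeEquivRight fun y =>
      (pow_smul_eq_zero_iff_ordExp_le hp y b).symm)
  rcases a with _ | a
  · have := key 0 (Nat.zero_le _)
    simpa using this
  · have h1 := key (a + 1) ha
    have h2 := key a (by omega)
    have h3 : Nat.card {y : R ⧸ Ideal.span {p ^ m} // ordExp p y ≤ a + 1} =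
        Nat.card {y : R ⧸ Ideal.span {p ^ m} // ordExp p y ≤ a} +
        Nat.card {y : R ⧸ Ideal.span {p ^ m} // ordExp p y = a + 1} := by
      have hc : ∀ P : R ⧸ Ideal.span {p ^ m} → Prop, Nat.card {y // P y} = Set.ncard {y | P y} :=
        fun P => Nat.card_coe_set_eq {y | P y}
      rw [hc, hc, hc, ← Set.ncard_union_eq]
      · congr 1
        ext y
        simp only [Set.mem_ofPred_eq, Set.mem_union]
        omega
      · rw [Set.disjoint_left]
        intro y hy hy'
        simp only [Set.mem_ofPred_eq] at hy hy'
        omega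
    rw [h1, h2] at h3
    rw [if_neg (Nat.succ_ne_zero a), Nat.add_sub_cancel]
    have h4 := congrArg (Nat.cast (R := ℤ)) h3
    push_cast at h4
    linarith

end Cyclic

/-! ### Types of finite modules -/

section Types

/-- A family of pairwise coprime primes with residue fields of `q ^ d j` elements. -/
structure IsPrimeSystem {Q : Type} {R : Type w} [CommRing R] (p : Q → R) (d : Q → ℕ) (q : ℕ) :
    Prop where
  one_lt : 1 < q
  deg_pos : ∀ j, 0 < d j
  prime : ∀ j, Prime (p j)
  coprime : ∀ i j, i ≠ j → IsCoprime (p i) (p j)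
  card_quot : ∀ j, Nat.card (R ⧸ Ideal.span {p j}) = q ^ d j

/-- The module `⨁ i, R/(p_j^(m+1))`, where `(j, m) = c i`. -/
abbrev CycPi {Q : Type} {R : Type w} [CommRing R] (p : Q → R) {ι : Type} (c : ι → Q × ℕ) : Type w :=
  ∀ i, R ⧸ Ideal.span {p (c i).1 ^ ((c i).2 + 1)}

/-- The module `M` is isomorphic to the direct sum of the modules `R/(p_j^(m+1))`, where `(j, m)`
runs through the multiset `ν`. -/
def HasTy {Q : Type} {R : Type w} [CommRing R] (p : Q → R) (M : Type w) [AddCommGroup M]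
    [Module R M] (ν : Multiset (Q × ℕ)) : Prop :=
  ∃ (ι : Type) (_ : Fintype ι) (c : ι → Q × ℕ), Finset.univ.val.map c = ν ∧
    Nonempty (M ≃ₗ[R] CycPi p c)

/-- The exponents `∑ min(k, m + 1)` that describe the `p_j^k`-torsion of a module of type `ν`. -/
def typeInv {Q : Type} [DecidableEq Q] (ν : Multiset (Q × ℕ)) (j : Q) (k : ℕ) : ℕ :=
  (ν.map fun x => if x.1 = j then min k (x.2 + 1) else 0).sum

/-- The length over the residue field of size `q` of a module of type `ν`. -/
def typeWt {Q : Type} (d : Q → ℕ) (ν : Multiset (Q × ℕ)) : ℕ :=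
  (ν.map fun x => d x.1 * (x.2 + 1)).sum

theorem typeInv_cons {Q : Type} [DecidableEq Q] (a : Q × ℕ) (ν : Multiset (Q × ℕ)) (j : Q)
    (k : ℕ) : typeInv (a ::ₘ ν) j k = (if a.1 = j then min k (a.2 + 1) else 0) + typeInv ν j k := by
  simp [typeInv]

theorem typeWt_cons {Q : Type} (d : Q → ℕ) (a : Q × ℕ) (ν : Multiset (Q × ℕ)) :
    typeWt d (a ::ₘ ν) = d a.1 * (a.2 + 1) + typeWt d ν := by
  simp [typeWt]

/-- The first difference in k counts the summands at j of exponent greater than k, since min(k, m+1)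
grows exactly when k ≤ m. -/
theorem typeInv_succ {Q : Type} [DecidableEq Q] (ν : Multiset (Q × ℕ)) (j : Q) (k : ℕ) :
    typeInv ν j (k + 1) = typeInv ν j k + (ν.countP fun x => x.1 = j ∧ k ≤ x.2) := by
  induction ν using Multiset.induction with
  | empty => simp [typeInv]
  | cons a ν ih =>
    rw [typeInv_cons, typeInv_cons, ih, Multiset.countP_cons]
    by_cases hj : a.1 = j <;> by_cases hk : k ≤ a.2 <;> simp only [hj, hk, if_true, if_false,
      true_and, false_and, and_self] <;> omega

/-- First differences count the summands of large exponent, and second differences isolate the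
multiplicity of each pair (j, k). Thus torsion exponents determine a type; this is the source of all
uniqueness statements below. -/
theorem typeInv_injective {Q : Type} [DecidableEq Q] {ν ν' : Multiset (Q × ℕ)}
    (h : ∀ j k, typeInv ν j k = typeInv ν' j k) : ν = ν' := by
  have h1 : ∀ j k, (ν.countP fun x => x.1 = j ∧ k ≤ x.2) =
      ν'.countP fun x => x.1 = j ∧ k ≤ x.2 := fun j k => by
    have h2 := typeInv_succ ν j k
    have h3 := typeInv_succ ν' j k
    have h4 := h j k
    have h5 := h j (k + 1)
    omega
  have h2 : ∀ (ξ : Multiset (Q × ℕ)) j k, (ξ.countP fun x => x.1 = j ∧ k ≤ x.2) =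
      ξ.count (j, k) + ξ.countP fun x => x.1 = j ∧ k + 1 ≤ x.2 := by
    intro ξ j k
    induction ξ using Multiset.induction with
    | empty => simp
    | cons a ξ ih =>
      rw [Multiset.countP_cons, Multiset.countP_cons, Multiset.count_cons, ih]
      obtain ⟨i, l⟩ := a
      simp only [Prod.mk.injEq]
      split_ifs <;> first | omega | (exfalso; grind)
  ext ⟨j, k⟩
  have h3 := h2 ν j k
  have h4 := h2 ν' j k
  have h5 := h1 j k
  have h6 := h1 j (k + 1)
  omega

variable {Q : Type} {R : Type w} [CommRing R] [IsDomain R] [IsPrincipalIdealRing R]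
  {p : Q → R} {d : Q → ℕ} {q : ℕ}
  {M M' N : Type w} [AddCommGroup M] [Module R M] [AddCommGroup M'] [Module R M']
  [AddCommGroup N] [Module R N]

theorem HasTy.of_equiv {ν : Multiset (Q × ℕ)} (h : HasTy p M ν) (e : M ≃ₗ[R] M') :
    HasTy p M' ν := by
  obtain ⟨ι, hι, c, hc, ⟨f⟩⟩ := h
  exact ⟨ι, hι, c, hc, ⟨e.symm.trans f⟩⟩

theorem hasTy_congr {ν : Multiset (Q × ℕ)} (e : M ≃ₗ[R] M') : HasTy p M ν ↔ HasTy p M' ν :=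
  ⟨fun h => h.of_equiv e, fun h => h.of_equiv e.symm⟩

/-- Families with the same multiset of values have fibres of equal size, and bijections of the
fibres glue. -/
theorem exists_equiv_comp_eq {α ι κ : Type} [Fintype ι] [Fintype κ] {c : ι → α}
    {c' : κ → α} (h : Finset.univ.val.map c = Finset.univ.val.map c') :
    ∃ e : ι ≃ κ, ∀ i, c' (e i) = c i := by
  classical
  have h1 : ∀ a, Fintype.card {i // c i = a} = Fintype.card {i // c' i = a} := by
    intro a
    have h2 := congrArg (Multiset.count a) h
    rw [Multiset.count_map, Multiset.count_map] at h2
    rw [Fintype.card_subtype, Fintype.card_subtype]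
    simp only [Finset.card, Finset.filter_val]
    simpa only [eq_comm] using h2
  let e : ι ≃ κ := (Equiv.sigmaFiberEquiv c).symm.trans
    ((Equiv.sigmaCongrRight fun a => Fintype.equivOfCardEq (h1 a)).trans (Equiv.sigmaFiberEquiv c'))
  exact ⟨e, fun i => ((Fintype.equivOfCardEq (h1 (c i))) ⟨i, rfl⟩).2⟩

theorem HasTy.nonempty_equiv {ν : Multiset (Q × ℕ)} (h : HasTy p M ν) (h' : HasTy p M' ν) :
    Nonempty (M ≃ₗ[R] M') := by
  obtain ⟨ι, hι, c, hc, ⟨f⟩⟩ := h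
  obtain ⟨κ, hκ, c', hc', ⟨f'⟩⟩ := h'
  obtain ⟨e, he⟩ := exists_equiv_comp_eq (hc.trans hc'.symm)
  obtain rfl : c = c' ∘ e := funext fun i => (he i).symm
  exact ⟨f.trans ((LinearEquiv.piCongrLeft R (fun i => R ⧸ Ideal.span {p (c' i).1 ^ ((c' i).2 + 1)})
    e).trans f'.symm)⟩

theorem hasTy_cycPi {ι : Type} [Fintype ι] (c : ι → Q × ℕ) :
    HasTy p (CycPi p c) (Finset.univ.val.map c) :=
  ⟨ι, _, c, rfl, ⟨LinearEquiv.refl _ _⟩⟩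

theorem HasTy.prod {ν ν' : Multiset (Q × ℕ)} (h : HasTy p M ν) (h' : HasTy p M' ν') :
    HasTy p (M × M') (ν + ν') := by
  obtain ⟨ι, hι, c, rfl, ⟨f⟩⟩ := h
  obtain ⟨κ, hκ, c', rfl, ⟨f'⟩⟩ := h'
  refine ⟨ι ⊕ κ, inferInstance, Sum.elim c c', ?_, ⟨(f.prodCongr f').trans
    (LinearEquiv.sumPiEquivProdPi R ι κ
      (fun i => R ⧸ Ideal.span {p (Sum.elim c c' i).1 ^ ((Sum.elim c c' i).2 + 1)})).symm⟩⟩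
  rw [← Finset.univ_disjSum_univ, Finset.val_disjSum, Multiset.disjSum, Multiset.map_add,
    Multiset.map_map, Multiset.map_map]
  rfl

theorem hasTy_cyc (a : Q × ℕ) : HasTy p (R ⧸ Ideal.span {p a.1 ^ (a.2 + 1)}) {a} :=
  ⟨Unit, inferInstance, fun _ => a, by simp,
    ⟨(LinearEquiv.funUnique Unit R (R ⧸ Ideal.span {p a.1 ^ (a.2 + 1)})).symm⟩⟩

theorem hasTy_of_subsingleton [Subsingleton M] : HasTy p M (0 : Multiset (Q × ℕ)) :=
  ⟨Empty, inferInstance, Empty.elim, by simp,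
    ⟨{ toFun := fun _ => 0, invFun := fun _ => 0, map_add' := by simp, map_smul' := by simp,
       left_inv := fun _ => Subsingleton.elim _ _, right_inv := fun _ => Subsingleton.elim _ _ }⟩⟩

theorem card_pi_smul_eq_zero {ι : Type} [Fintype ι] (N : ι → Type w) [∀ i, AddCommGroup (N i)]
    [∀ i, Module R (N i)] (r : R) :
    Nat.card {y : ∀ i, N i // r • y = 0} = ∏ i, Nat.card {y : N i // r • y = 0} := by
  rw [← Nat.card_pi]
  exact Nat.card_congr
    { toFun := fun y i => ⟨y.1 i, congrFun y.2 i⟩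
      invFun := fun y => ⟨fun i => (y i).1, funext fun i => (y i).2⟩
      left_inv := fun _ => rfl
      right_inv := fun _ => rfl }

theorem card_smul_eq_zero_congr (e : M ≃ₗ[R] M') (r : R) :
    Nat.card {y : M // r • y = 0} = Nat.card {y : M' // r • y = 0} :=
  Nat.card_congr (e.toEquiv.subtypeEquiv fun y => by
    change _ ↔ r • e y = 0
    rw [← map_smul, map_eq_zero_iff e e.injective])

theorem IsPrimeSystem.finite_cyc (hp : IsPrimeSystem p d q) (a : Q × ℕ) :
    Finite (R ⧸ Ideal.span {p a.1 ^ (a.2 + 1)}) := by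
  apply Nat.finite_of_card_ne_zero
  rw [card_quotient_span_pow (hp.prime _), hp.card_quot]
  exact pow_ne_zero _ (pow_ne_zero _ (by have := hp.one_lt; omega))

theorem HasTy.finite (hp : IsPrimeSystem p d q) {ν : Multiset (Q × ℕ)} (h : HasTy p M ν) :
    Finite M := by
  obtain ⟨ι, hι, c, rfl, ⟨f⟩⟩ := h
  have := fun i => hp.finite_cyc (c i)
  exact Finite.of_equiv _ f.symm.toEquiv

theorem HasTy.card_eq (hp : IsPrimeSystem p d q) {ν : Multiset (Q × ℕ)} (h : HasTy p M ν) :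
    Nat.card M = q ^ typeWt d ν := by
  obtain ⟨ι, hι, c, rfl, ⟨f⟩⟩ := h
  rw [Nat.card_congr f.toEquiv, Nat.card_pi, typeWt, Multiset.map_map]
  change _ = q ^ ∑ i, d (c i).1 * ((c i).2 + 1)
  rw [← Finset.prod_pow_eq_pow_sum]
  refine Finset.prod_congr rfl fun i _ => ?_
  rw [card_quotient_span_pow (hp.prime _), hp.card_quot, pow_mul]

theorem HasTy.card_tors [DecidableEq Q] (hp : IsPrimeSystem p d q) {ν : Multiset (Q × ℕ)}
    (h : HasTy p M ν) (j : Q) (k : ℕ) :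
    Nat.card {y : M // p j ^ k • y = 0} = q ^ (d j * typeInv ν j k) := by
  obtain ⟨ι, hι, c, rfl, ⟨f⟩⟩ := h
  rw [card_smul_eq_zero_congr f, card_pi_smul_eq_zero, typeInv, Multiset.map_map]
  change _ = q ^ (d j * ∑ i, if (c i).1 = j then min k ((c i).2 + 1) else 0)
  rw [Finset.mul_sum, ← Finset.prod_pow_eq_pow_sum]
  refine Finset.prod_congr rfl fun i _ => ?_
  split_ifs with hj
  · rw [← hj, card_pow_smul_eq_zero (hp.prime _), hp.card_quot, pow_mul]
  · have h1 := smul_bijective_of_isCoprime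
      ((hp.coprime j (c i).1 (Ne.symm hj)).pow (m := k) (n := (c i).2 + 1))
    rw [mul_zero, pow_zero, Nat.card_eq_one_iff_unique]
    refine ⟨⟨fun y z => Subtype.ext (h1.1 ?_)⟩, ⟨⟨0, smul_zero _⟩⟩⟩
    exact y.2.trans z.2.symm

theorem IsPrimeSystem.pow_injective (hp : IsPrimeSystem p d q) {a b : ℕ} (h : q ^ a = q ^ b) :
    a = b :=
  Nat.pow_right_injective hp.one_lt h

/-- The numbers of p_j^k-torsion elements depend only on the module, and they determine `typeInv`
because q > 1 and the degrees are positive. -/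
theorem HasTy.eq (hp : IsPrimeSystem p d q) {ν ν' : Multiset (Q × ℕ)}
    (h : HasTy p M ν) (h' : HasTy p M ν') : ν = ν' := by
  classical
  exact typeInv_injective fun j k =>
    Nat.eq_of_mul_eq_mul_left (hp.deg_pos j)
      (hp.pow_injective ((h.card_tors hp j k).symm.trans (h'.card_tors hp j k)))

/-- Some power of the product of the `p j` kills `M`. -/
def IsSupported [Fintype Q] (R : Type w) [CommRing R] (p : Q → R) (M : Type w) [AddCommGroup M]
    [Module R M] : Prop :=
  Finite M ∧ ∃ n : ℕ, ∀ x : M, (∏ j, p j) ^ n • x = 0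

theorem IsSupported.submodule [Fintype Q] (h : IsSupported R p M) (S : Submodule R M) :
    IsSupported R p S := by
  obtain ⟨_, n, hn⟩ := h
  exact ⟨inferInstance, n, fun x => Subtype.ext (hn x)⟩

theorem IsSupported.quotient [Fintype Q] (h : IsSupported R p M) (S : Submodule R M) :
    IsSupported R p (M ⧸ S) := by
  obtain ⟨_, n, hn⟩ := h
  refine ⟨Finite.of_surjective _ S.mkQ_surjective, n, fun x => ?_⟩
  obtain ⟨x, rfl⟩ := S.mkQ_surjective x
  rw [← map_smul, hn, map_zero]

theorem HasTy.isSupported [Fintype Q] (hp : IsPrimeSystem p d q) {ν : Multiset (Q × ℕ)}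
    (h : HasTy p M ν) : IsSupported R p M := by
  refine ⟨h.finite hp, ?_⟩
  obtain ⟨ι, hι, c, rfl, ⟨f⟩⟩ := h
  refine ⟨∑ i, ((c i).2 + 1), fun x => f.injective (funext fun i => ?_)⟩
  rw [map_smul, map_zero, Pi.smul_apply]
  obtain ⟨y, hy⟩ := Ideal.Quotient.mk_surjective (f x i)
  rw [← hy, Pi.zero_apply, smul_mk_eq_zero_iff]
  refine Dvd.dvd.mul_right ?_ _
  refine (pow_dvd_pow_of_dvd (Finset.dvd_prod_of_mem p (Finset.mem_univ (c i).1)) _).trans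
    (pow_dvd_pow _ ?_)
  exact Finset.single_le_sum (f := fun i => (c i).2 + 1) (fun _ _ => Nat.zero_le _)
    (Finset.mem_univ i)

/-- Adapts a decomposition as the structure theorem supplies it: factors with exponent 0 are trivial
and are dropped, the primes are replaced by the associated `p j`, and exponents are lowered by one
because (j, m) encodes p_j^(m+1). -/
theorem exists_hasTy_of_equiv_pi {ι : Type w} [Fintype ι] (π : ι → R) (e : ι → ℕ)
    (f : M ≃ₗ[R] ∀ i, R ⧸ Submodule.span R {π i ^ e i})
    (h : ∀ i, e i ≠ 0 → ∃ j, Associated (π i) (p j)) : ∃ ν, HasTy p M ν := by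
  classical
  choose g hg using h
  let κ := {i // e i ≠ 0}
  let c : κ → Q × ℕ := fun i => (g i.1 i.2, e i.1 - 1)
  have h4 : ∀ i : κ, Submodule.span R {π i.1 ^ e i.1} = Ideal.span {p (c i).1 ^ ((c i).2 + 1)} := by
    intro i
    rw [Ideal.submodule_span_eq, Ideal.span_singleton_eq_span_singleton]
    have : (c i).2 + 1 = e i.1 := Nat.succ_pred_eq_of_ne_zero i.2
    rw [this]
    exact (hg i.1 i.2).pow_pow
  have h5 : ∀ i, e i = 0 → Subsingleton (R ⧸ Submodule.span R {π i ^ e i}) := by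
    intro i hi
    rw [hi, pow_zero, Submodule.Quotient.subsingleton_iff]
    exact Ideal.span_singleton_one
  let F : (∀ i, R ⧸ Submodule.span R {π i ^ e i}) →ₗ[R]
      ∀ i : κ, R ⧸ Submodule.span R {π i.1 ^ e i.1} :=
    LinearMap.pi fun i => LinearMap.proj i.1
  have hF : Function.Bijective F := by
    refine ⟨fun x y h => funext fun i => ?_, fun y => ⟨fun i => if hi : e i ≠ 0 then
      y ⟨i, hi⟩ else 0, funext fun i => dif_pos i.2⟩⟩
    by_cases hi : e i = 0
    · have := h5 i hi
      exact Subsingleton.elim _ _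
    · exact congrFun h ⟨i, hi⟩
  -- The structure theorem indexes by a type in `Type w`, while `HasTy` wants an index in `Type`; a
  -- `Fin` type bridges the two.
  let ε : κ ≃ Fin (Fintype.card κ) := Fintype.equivFin κ
  let f3 : (∀ i : κ, R ⧸ Submodule.span R {π i.1 ^ e i.1}) ≃ₗ[R]
      ∀ i : κ, R ⧸ Ideal.span {p (c i).1 ^ ((c i).2 + 1)} :=
    LinearEquiv.piCongrRight fun i => Submodule.quotEquivOfEq _ _ (h4 i)
  let f4 : (∀ i : κ, R ⧸ Ideal.span {p (c i).1 ^ ((c i).2 + 1)}) ≃ₗ[R] CycPi p (c ∘ ε.symm) :=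
    (LinearEquiv.piCongrLeft R (fun i => R ⧸ Ideal.span {p (c i).1 ^ ((c i).2 + 1)}) ε.symm).symm
  exact ⟨_, Fin (Fintype.card κ), inferInstance, c ∘ ε.symm, rfl,
    ⟨f.trans ((LinearEquiv.ofBijective F hF).trans (f3.trans f4))⟩⟩

theorem IsSupported.exists_hasTy [Fintype Q] (hp : IsPrimeSystem p d q) (h : IsSupported R p M) :
    ∃ ν, HasTy p M ν := by
  obtain ⟨hfin, n, hn⟩ := h
  have hP : (∏ j, p j) ^ n ≠ 0 := pow_ne_zero _ (Finset.prod_ne_zero_iff.2 fun j _ =>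
    (hp.prime j).ne_zero)
  have htors : Module.IsTorsion R M := fun {x} =>
    ⟨⟨_, mem_nonZeroDivisors_of_ne_zero hP⟩, hn x⟩
  obtain ⟨ι, hι, π, hπ, e, ⟨f⟩⟩ := Module.equiv_directSum_of_isTorsion htors
  classical
  let f1 : M ≃ₗ[R] ∀ i, R ⧸ Submodule.span R {π i ^ e i} :=
    f.trans (DirectSum.linearEquivFunOnFintype R ι _)
  refine exists_hasTy_of_equiv_pi π e f1 fun i hi => ?_
  -- Applied to the generator of the i-th summand, the killing power shows that π_i^(e_i) divides (∏
  -- p_j)^n, so π_i is associated to some p_j whenever e_i ≠ 0.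
  have h2 := congrFun (congrArg f1
    (hn (f1.symm (Pi.single i (Submodule.Quotient.mk 1))))) i
  rw [map_smul, f1.apply_symm_apply, map_zero, Pi.smul_apply, Pi.single_eq_same,
    Pi.zero_apply, ← Submodule.Quotient.mk_smul, Submodule.Quotient.mk_eq_zero,
    Submodule.mem_span_singleton] at h2
  obtain ⟨s, hs⟩ := h2
  have h3 : π i ∣ (∏ j, p j) ^ n := by
    refine (dvd_pow_self (π i) hi).trans ⟨s, ?_⟩
    rw [smul_eq_mul, smul_eq_mul, mul_one] at hs
    rw [← hs, mul_comm]
  obtain ⟨j, -, hj⟩ := (hπ i).prime.exists_mem_finset_dvd ((hπ i).prime.dvd_of_dvd_pow h3)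
  exact ⟨j, (hπ i).associated_of_dvd (hp.prime j).irreducible hj⟩

end Types

/-! ### Quotients by cyclic submodules -/

section CyclicQuotient

variable {R : Type w} [CommRing R] {M : Type w} [AddCommGroup M] [Module R M]

theorem card_ker_eq_card_quotient_range [Finite M] (f : M →ₗ[R] M) :
    Nat.card (LinearMap.ker f) = Nat.card (M ⧸ LinearMap.range f) := by
  have h1 := Submodule.card_eq_card_quotient_mul_card (LinearMap.ker f)
  have h2 := Submodule.card_eq_card_quotient_mul_card (LinearMap.range f)
  rw [Nat.card_congr f.quotKerEquivRange.toEquiv] at h1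
  rw [h1, mul_comm] at h2
  exact Nat.eq_of_mul_eq_mul_left Nat.card_pos h2

theorem card_tors_eq_card_quotient_range [Finite M] (r : R) :
    Nat.card {y : M // r • y = 0} = Nat.card (M ⧸ LinearMap.range (LinearMap.lsmul R M r)) :=
  card_ker_eq_card_quotient_range (LinearMap.lsmul R M r)

/-- For a finite module, the s-torsion has as many elements as the cokernel of s. So with N = Rx the
claim compares |M/(N + sM)| with |M/sM|; their ratio is the size of the image of N in M/sM, a cyclic
module with annihilator I. -/
theorem card_tors_quotient_span [Finite M] (x : M) (s : R) (I : Ideal R)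
    (hI : ∀ r, r ∈ I ↔ ∃ z : M, s • z = r • x) :
    Nat.card {y : M ⧸ Submodule.span R {x} // s • y = 0} * Nat.card (R ⧸ I) =
      Nat.card {y : M // s • y = 0} := by
  set N := Submodule.span R {x}
  have : Finite (M ⧸ N) := Finite.of_surjective _ N.mkQ_surjective
  set P := LinearMap.range (LinearMap.lsmul R M s)
  have : Finite (M ⧸ P) := Finite.of_surjective _ P.mkQ_surjective
  have h1 : LinearMap.range (LinearMap.lsmul R (M ⧸ N) s) = P.map N.mkQ := by
    ext y
    simp only [LinearMap.mem_range, Submodule.mem_map, P]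
    constructor
    · rintro ⟨z, rfl⟩
      obtain ⟨z, rfl⟩ := N.mkQ_surjective z
      exact ⟨s • z, ⟨z, rfl⟩, map_smul _ _ _⟩
    · rintro ⟨_, ⟨z, rfl⟩, rfl⟩
      exact ⟨N.mkQ z, (map_smul N.mkQ s z).symm⟩
  have h2 : Nat.card (N.map P.mkQ) = Nat.card (R ⧸ I) := by
    have h3 : N.map P.mkQ = LinearMap.range (LinearMap.toSpanSingleton R _ (P.mkQ x)) := by
      rw [LinearMap.range_toSpanSingleton, Submodule.map_span, Set.image_singleton]
    have h4 : LinearMap.ker (LinearMap.toSpanSingleton R _ (P.mkQ x)) = I := by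
      ext r
      rw [hI, LinearMap.mem_ker, LinearMap.toSpanSingleton_apply, ← map_smul,
        Submodule.mkQ_apply, Submodule.Quotient.mk_eq_zero]
      rfl
    rw [h3, ← h4]
    exact Nat.card_congr (LinearMap.quotKerEquivRange _).toEquiv.symm
  rw [card_tors_eq_card_quotient_range, card_tors_eq_card_quotient_range, h1,
    Submodule.card_eq_card_quotient_mul_card (N.map P.mkQ), h2,
    Nat.card_congr (Submodule.quotientQuotientEquivQuotientSup N P).toEquiv,
    Nat.card_congr (Submodule.quotientQuotientEquivQuotientSup P N).toEquiv, sup_comm, mul_comm]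

variable [IsDomain R] [IsPrincipalIdealRing R] {Q : Type} {p : Q → R} {d : Q → ℕ} {q : ℕ}
  {ι : Type} [Fintype ι] {c : ι → Q × ℕ}

theorem pow_sup_dvd_iff (a r : R) (s : Finset ι) (e : ι → ℕ) :
    a ^ s.sup e ∣ r ↔ ∀ i ∈ s, a ^ e i ∣ r := by
  classical
  induction s using Finset.induction with
  | empty => simp
  | insert i s hi ih =>
    rw [Finset.sup_insert, Finset.forall_mem_insert, ← ih]
    rcases le_total (e i) (s.sup e) with h | h
    · rw [sup_eq_right.2 h]
      exact ⟨fun h' => ⟨(pow_dvd_pow a h).trans h', h'⟩, fun h' => h'.2⟩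
    · rw [sup_eq_left.2 h]
      exact ⟨fun h' => ⟨h', (pow_dvd_pow a h).trans h'⟩, fun h' => h'.1⟩

variable [DecidableEq Q]

/-- The exponent of the annihilator of the image of `x` in `M/p_j^k M`, where `a` is the vector of
the orders of the components of `x`. -/
def ordSup (c : ι → Q × ℕ) (a : ι → ℕ) (j : Q) (k : ℕ) : ℕ :=
  Finset.univ.sup fun i => if (c i).1 = j then a i - ((c i).2 + 1 - k) else 0

/-- The orders of the components of an element of `⨁ i, R/(p_j^(m+1))`. -/
noncomputable def ordVec (p : Q → R) (x : CycPi p c) (i : ι) : ℕ := ordExp (p (c i).1) (x i)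

/-- Divisibility by p_j^k is tested component by component. At another prime p_j^k acts bijectively,
so those components impose no condition and contribute 0 to the supremum. -/
theorem mem_span_pow_ordSup_iff (hp : IsPrimeSystem p d q) (x : CycPi p c) (j : Q) (k : ℕ) (r : R) :
    r ∈ Ideal.span {p j ^ ordSup c (ordVec p x) j k} ↔ ∃ z : CycPi p c, p j ^ k • z = r • x := by
  rw [Ideal.mem_span_singleton, ordSup, pow_sup_dvd_iff]
  have : (∃ z : CycPi p c, p j ^ k • z = r • x) ↔ ∀ i, ∃ z, p j ^ k • z = r • x i :=
    ⟨fun ⟨z, hz⟩ i => ⟨z i, congrFun hz i⟩, fun h => by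
      choose z hz using h
      exact ⟨z, funext hz⟩⟩
  rw [this]
  refine ⟨fun h i => ?_, fun h i _ => ?_⟩
  · by_cases hj : (c i).1 = j
    · have h1 := h i (Finset.mem_univ i)
      rw [if_pos hj] at h1
      rw [← hj] at h1 ⊢
      exact (exists_pow_smul_eq_smul_iff (hp.prime _) k (x i) r).2 h1
    · exact (smul_bijective_of_isCoprime
        ((hp.coprime j (c i).1 (Ne.symm hj)).pow (m := k) (n := (c i).2 + 1))).2 _
  · split_ifs with hj
    · have h1 := h i
      rw [← hj] at h1 ⊢
      exact (exists_pow_smul_eq_smul_iff (hp.prime _) k (x i) r).1 h1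
    · rw [pow_zero]
      exact one_dvd _

/-- The quotient has some type, and `card_tors_quotient_span` computes its torsion exponents from
those of the module and the order vector of x. Hence the type of the quotient is a combinatorial
function of the order vector, independent of the ring. -/
theorem hasTy_quotient_span_iff [Fintype Q] (hp : IsPrimeSystem p d q) (x : CycPi p c)
    (σ : Multiset (Q × ℕ)) :
    HasTy p (CycPi p c ⧸ Submodule.span R {x}) σ ↔
      ∀ j k, typeInv σ j k + ordSup c (ordVec p x) j k =
        typeInv (Finset.univ.val.map c) j k := by
  have hc := hasTy_cycPi (p := p) c
  have hfin := hc.finite hp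
  obtain ⟨σ', hσ'⟩ := ((hc.isSupported hp).quotient (Submodule.span R {x})).exists_hasTy hp
  have h1 : ∀ j k, typeInv σ' j k + ordSup c (ordVec p x) j k =
      typeInv (Finset.univ.val.map c) j k := fun j k => by
    have h2 := card_tors_quotient_span x (p j ^ k) _ (mem_span_pow_ordSup_iff hp x j k)
    rw [hσ'.card_tors hp, hc.card_tors hp, card_quotient_span_pow (hp.prime j), hp.card_quot,
      ← pow_mul, ← pow_add, ← mul_add] at h2
    exact Nat.eq_of_mul_eq_mul_left (hp.deg_pos j) (hp.pow_injective h2)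
  constructor
  · intro h
    rwa [h.eq hp hσ']
  · intro h
    obtain rfl : σ = σ' := typeInv_injective fun j k => by
      have := h j k
      have := h1 j k
      omega
    exact hσ'

/-- The element `x` has the annihilator `(p_j^(m+1))`, where `b = (j, m)`. -/
def HasOrd (p : Q → R) (b : Q × ℕ) {M : Type w} [AddCommGroup M] [Module R M] (x : M) : Prop :=
  ∀ r : R, r • x = 0 ↔ p b.1 ^ (b.2 + 1) ∣ r

/-- The annihilator of x is the intersection of those of its components. Coprimality forces the
components at primes other than that of b to vanish; the largest remaining order is the order of x.
-/
theorem hasOrd_iff (hp : IsPrimeSystem p d q) (b : Q × ℕ) (x : CycPi p c) :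
    HasOrd p b x ↔ (∀ i, (c i).1 ≠ b.1 → ordVec p x i = 0) ∧
      Finset.univ.sup (ordVec p x) = b.2 + 1 := by
  have key : ∀ r : R, r • x = 0 ↔ ∀ i, p (c i).1 ^ ordVec p x i ∣ r := fun r => by
    rw [funext_iff]
    exact forall_congr' fun i => smul_eq_zero_iff_pow_ordExp_dvd (hp.prime _) (x i) r
  have h1 : (∀ i, (c i).1 ≠ b.1 → ordVec p x i = 0) → ∀ r : R, r • x = 0 ↔
      p b.1 ^ Finset.univ.sup (ordVec p x) ∣ r := by
    intro h r
    rw [key, pow_sup_dvd_iff]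
    refine forall_congr' fun i => ?_
    by_cases hi : (c i).1 = b.1
    · simp [hi]
    · simp [h i hi]
  constructor
  · intro h
    have h2 : ∀ i, (c i).1 ≠ b.1 → ordVec p x i = 0 := by
      intro i hi
      have h3 := (key _).1 ((h _).2 dvd_rfl) i
      have h4 : IsUnit (p (c i).1 ^ ordVec p x i) :=
        ((hp.coprime _ _ hi).pow (m := ordVec p x i) (n := b.2 + 1)).isUnit_of_dvd' dvd_rfl h3
      by_contra h5
      exact (hp.prime _).not_isUnit ((isUnit_pow_iff h5).1 h4)
    refine ⟨h2, ?_⟩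
    have h3 := h1 h2
    have h4 := fun k l => pow_dvd_pow_iff (m := k) (n := l) (hp.prime b.1).ne_zero
      (hp.prime b.1).not_isUnit
    apply le_antisymm
    · rw [← h4, ← h3, h]
    · rw [← h4, ← h, h3]
  · rintro ⟨h2, h3⟩ r
    rw [h1 h2, h3]

theorem card_ordVec_eq (hp : IsPrimeSystem p d q) {a : ι → ℕ} (ha : ∀ i, a i ≤ (c i).2 + 1) :
    (Nat.card {x : CycPi p c // ordVec p x = a} : ℤ) =
      ∏ i, if a i = 0 then 1 else (q : ℤ) ^ (d (c i).1 * a i) - q ^ (d (c i).1 * (a i - 1)) := by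
  have h1 : Nat.card {x : CycPi p c // ordVec p x = a} =
      ∏ i, Nat.card {y : R ⧸ Ideal.span {p (c i).1 ^ ((c i).2 + 1)} //
        ordExp (p (c i).1) y = a i} := by
    rw [← Nat.card_pi]
    exact Nat.card_congr
      { toFun := fun y i => ⟨y.1 i, congrFun y.2 i⟩
        invFun := fun y => ⟨fun i => (y i).1, funext fun i => (y i).2⟩
        left_inv := fun _ => rfl
        right_inv := fun _ => rfl }
  rw [h1, Nat.cast_prod]
  refine Finset.prod_congr rfl fun i _ => ?_
  have : Finite (R ⧸ Ideal.span {p (c i).1}) := by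
    apply Nat.finite_of_card_ne_zero
    rw [hp.card_quot]
    exact pow_ne_zero _ (by have := hp.one_lt; omega)
  rw [card_ordExp_eq (hp.prime _) (ha i), hp.card_quot]
  push_cast
  rw [← pow_mul, ← pow_mul]

/-- The order vectors of the elements that have order `b` and a quotient of type `σ`. -/
def IsOrdVec (c : ι → Q × ℕ) (b : Q × ℕ) (σ : Multiset (Q × ℕ)) (a : ι → ℕ) : Prop :=
  ((∀ i, (c i).1 ≠ b.1 → a i = 0) ∧ Finset.univ.sup a = b.2 + 1) ∧
    ∀ j k, typeInv σ j k + ordSup c a j k = typeInv (Finset.univ.val.map c) j k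

open Classical in
-- Both conditions on x depend only on its order vector, so x is sorted by that vector. The index
-- set of the sum involves neither the ring nor q, which makes the count an explicit integral
-- combination of powers of q.
theorem card_hasOrd_hasTy_quotient [Fintype Q] (hp : IsPrimeSystem p d q) (b : Q × ℕ)
    (σ : Multiset (Q × ℕ)) :
    (Nat.card {x : CycPi p c // HasOrd p b x ∧ HasTy p (CycPi p c ⧸ Submodule.span R {x}) σ} : ℤ) =
      ∑ a ∈ (Fintype.piFinset fun i => Finset.range ((c i).2 + 2)) with IsOrdVec c b σ a,
        ∏ i, if a i = 0 then 1 else (q : ℤ) ^ (d (c i).1 * a i) - q ^ (d (c i).1 * (a i - 1)) := by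
  have hfin : Finite (CycPi p c) := (hasTy_cycPi (p := p) c).finite hp
  have := Fintype.ofFinite (CycPi p c)
  set A := (Fintype.piFinset fun i => Finset.range ((c i).2 + 2)).filter (IsOrdVec c b σ)
  have h1 : ∀ x : CycPi p c, (HasOrd p b x ∧ HasTy p (CycPi p c ⧸ Submodule.span R {x}) σ) ↔
      ordVec p x ∈ A := by
    intro x
    rw [hasOrd_iff hp, hasTy_quotient_span_iff hp]
    simp only [A, Finset.mem_filter, Fintype.mem_piFinset, Finset.mem_range]
    refine ⟨fun h => ⟨fun i => Nat.lt_succ_of_le (ordExp_le (hp.prime _) (x i)), h⟩, fun h => h.2⟩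
  rw [Nat.card_congr (Equiv.subtypeEquivRight h1), Nat.card_eq_fintype_card,
    Fintype.card_subtype, Finset.card_eq_sum_card_fiberwise (f := ordVec p) (t := A)
      (s := Finset.univ.filter fun x => ordVec p x ∈ A)
      (fun x hx => (Finset.mem_filter.1 hx).2), Nat.cast_sum]
  refine Finset.sum_congr rfl fun a ha => ?_
  rw [← card_ordVec_eq hp, Nat.card_eq_fintype_card, Fintype.card_subtype, Finset.filter_filter]
  · congr 2
    ext x
    simp only [Finset.mem_filter, Finset.mem_univ, true_and]
    exact ⟨fun h => h.2, fun h => ⟨h ▸ ha, h⟩⟩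
  · intro i
    have := (Fintype.mem_piFinset.1 (Finset.mem_filter.1 ha).1) i
    exact Nat.le_of_lt_succ (Finset.mem_range.1 this)

end CyclicQuotient

/-! ### Hall numbers -/

section Counting

theorem sum_eq_sum_card_mul {α β : Type*} [Fintype α] (S : Finset β) (T : α → β → Prop)
    (hT : ∀ a, ∃ b ∈ S, T a b) (hu : ∀ a b b', T a b → T a b' → b = b') (f : α → ℕ) (g : β → ℕ)
    (h : ∀ a b, T a b → f a = g b) : ∑ a, f a = ∑ b ∈ S, Nat.card {a // T a b} * g b := by
  classical
  choose t ht hT using hT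
  rw [← Finset.sum_fiberwise_of_maps_to (s := Finset.univ) (t := S) (g := t) fun a _ => ht a]
  refine Finset.sum_congr rfl fun b _ => ?_
  have h1 : ∀ a, t a = b ↔ T a b := fun a => ⟨fun h => h ▸ hT a, fun h => hu a _ _ (hT a) h⟩
  rw [Finset.sum_congr rfl fun a ha => h a b ((h1 a).1 (Finset.mem_filter.1 ha).2),
    Finset.sum_const, smul_eq_mul, Nat.card_eq_fintype_card, Fintype.card_subtype]
  simp only [h1]

/-- All fibres of a surjective homomorphism are translates of the kernel. -/
theorem card_subtype_comp_of_surjective {A B : Type*} [AddCommGroup A] [AddCommGroup B] [Finite A]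
    (f : A →+ B) (hf : Function.Surjective f) (P : B → Prop) :
    Nat.card {a // P (f a)} = Nat.card {b // P b} * Nat.card {a // f a = 0} := by
  have : Finite B := Finite.of_surjective f hf
  have := Fintype.ofFinite {b // P b}
  let e : {a // P (f a)} ≃ Σ b : {b // P b}, {a // f a = b.1} :=
    { toFun := fun a => ⟨⟨f a.1, a.2⟩, ⟨a.1, rfl⟩⟩
      invFun := fun x => ⟨x.2.1, by rw [x.2.2]; exact x.1.2⟩
      left_inv := fun _ => rfl
      right_inv := by rintro ⟨⟨y, h⟩, ⟨a, ha⟩⟩; dsimp only at ha; subst ha; rfl }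
  rw [Nat.card_congr e, Nat.card_sigma, Finset.sum_congr rfl (g := fun _ => Nat.card {a // f a = 0}),
    Finset.sum_const, smul_eq_mul, Nat.card_eq_fintype_card (α := {b // P b})]
  · rfl
  · intro b _
    obtain ⟨a₀, h₀⟩ := hf b.1
    exact Nat.card_congr
      { toFun := fun a => ⟨a.1 - a₀, by rw [map_sub, a.2, h₀, sub_self]⟩
        invFun := fun a => ⟨a.1 + a₀, by rw [map_add, a.2, h₀, zero_add]⟩
        left_inv := fun a => by simp
        right_inv := fun a => by simp }

end Counting

/-! ### Submodules with prescribed type and cotype, and flags with a cyclic bottom step -/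

section HallNumbers

variable {Q : Type} {R : Type w} [CommRing R] [IsDomain R] [IsPrincipalIdealRing R] {p : Q → R} {d : Q → ℕ} {q : ℕ}

instance {M : Type w} [AddCommGroup M] [Module R M] [Finite M] : Finite (Submodule R M) :=
  Finite.of_injective (fun S => (S : Set M)) SetLike.coe_injective

/-- A standard module of type `ν`. -/
abbrev StdModule (p : Q → R) (ν : Multiset (Q × ℕ)) : Type w :=
  CycPi p fun i : Fin ν.toList.length => ν.toList.get i

theorem hasTy_stdModule (ν : Multiset (Q × ℕ)) : HasTy p (StdModule p ν) ν :=
  ⟨_, inferInstance, _, by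
    rw [Fin.univ_val_map, List.ofFn_get, Multiset.coe_toList], ⟨LinearEquiv.refl _ _⟩⟩

/-- The number of submodules of `M` of type `ν` with quotient of type `σ`. -/
noncomputable def hallNum (p : Q → R) (M : Type w) [AddCommGroup M] [Module R M]
    (ν σ : Multiset (Q × ℕ)) : ℕ :=
  Nat.card {N : Submodule R M // HasTy p N ν ∧ HasTy p (M ⧸ N) σ}

/-- The number of elements of `M` of order `b` with quotient of type `σ`. -/
noncomputable def cycNum (p : Q → R) (M : Type w) [AddCommGroup M] [Module R M]
    (b : Q × ℕ) (σ : Multiset (Q × ℕ)) : ℕ :=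
  Nat.card {x : M // HasOrd p b x ∧ HasTy p (M ⧸ Submodule.span R {x}) σ}

variable {M M' : Type w} [AddCommGroup M] [Module R M] [AddCommGroup M'] [Module R M']

theorem hallNum_congr (e : M ≃ₗ[R] M') (ν σ : Multiset (Q × ℕ)) :
    hallNum p M ν σ = hallNum p M' ν σ :=
  Nat.card_congr ((Submodule.orderIsoMapComap e).toEquiv.subtypeEquiv fun N =>
    and_congr (hasTy_congr (e.submoduleMap N)) (hasTy_congr (Submodule.Quotient.equiv _ _ e rfl)))

theorem cycNum_congr (e : M ≃ₗ[R] M') (b : Q × ℕ) (σ : Multiset (Q × ℕ)) :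
    cycNum p M b σ = cycNum p M' b σ :=
  Nat.card_congr (e.toEquiv.subtypeEquiv fun x => by
    refine and_congr (forall_congr' fun r => ?_) (hasTy_congr (Submodule.Quotient.equiv _ _ e ?_))
    · change _ ↔ (r • e x = 0 ↔ _)
      rw [← map_smul, map_eq_zero_iff e e.injective]
    · change Submodule.map _ _ = Submodule.span R {e x}
      rw [Submodule.map_span, Set.image_singleton]
      rfl)

/-- A finite set of types that contains all those of weight at most `n`. -/
def typesLE (Q : Type) [Fintype Q] [DecidableEq Q] (n : ℕ) : Finset (Multiset (Q × ℕ)) :=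
  (n • (Finset.univ ×ˢ Finset.range n : Finset (Q × ℕ)).val).powerset.toFinset

/-- Each member (j, m) contributes at least m + 1 ≥ 1 to the weight, so n bounds both the second
coordinates and the multiplicities. -/
theorem mem_typesLE [Fintype Q] [DecidableEq Q] (hd : ∀ j, 0 < d j) {ν : Multiset (Q × ℕ)} {n : ℕ}
    (h : typeWt d ν ≤ n) : ν ∈ typesLE Q n := by
  rw [typesLE, Multiset.mem_toFinset, Multiset.mem_powerset, Multiset.le_iff_count]
  intro a
  by_cases ha : a ∈ ν
  · have h1 : ν.card ≤ typeWt d ν := by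
      rw [← Multiset.card_map (fun x => d x.1 * (x.2 + 1)), typeWt]
      have := Multiset.card_nsmul_le_sum (s := ν.map fun x => d x.1 * (x.2 + 1)) (a := 1)
        (by
          intro x hx
          obtain ⟨y, -, rfl⟩ := Multiset.mem_map.1 hx
          exact Nat.mul_pos (hd _) (Nat.succ_pos _))
      simpa using this
    have h2 : a.2 + 1 ≤ typeWt d ν := by
      refine (Nat.le_mul_of_pos_left _ (hd a.1)).trans ?_
      exact Multiset.single_le_sum (fun _ _ => Nat.zero_le _) _ (Multiset.mem_map_of_mem _ ha)
    rw [Multiset.count_nsmul, Multiset.count_eq_one_of_mem (Finset.nodup _)]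
    · have := Multiset.count_le_card a ν
      omega
    · simp only [Finset.mem_val, Finset.mem_product, Finset.mem_univ, Finset.mem_range, true_and]
      omega
  · rw [Multiset.count_eq_zero_of_notMem ha]
    exact Nat.zero_le _

/-- The submodule `N / Rx` of `M / Rx` is a quotient of `N`. -/
noncomputable def quotSpanEquivMap (N : Submodule R M) (x : N) :
    (N ⧸ Submodule.span R {x}) ≃ₗ[R] N.map (Submodule.span R {x.1}).mkQ := by
  let f : N →ₗ[R] M ⧸ Submodule.span R {x.1} := (Submodule.span R {x.1}).mkQ.comp N.subtype
  have h1 : LinearMap.ker f = Submodule.span R {x} := by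
    ext y
    rw [LinearMap.mem_ker, LinearMap.comp_apply, Submodule.mkQ_apply,
      Submodule.Quotient.mk_eq_zero, Submodule.mem_span_singleton, Submodule.mem_span_singleton]
    exact exists_congr fun r => ⟨fun h => Subtype.ext h, fun h => congrArg Subtype.val h⟩
  have h2 : LinearMap.range f = N.map (Submodule.span R {x.1}).mkQ := by
    rw [LinearMap.range_comp, Submodule.range_subtype]
  exact (Submodule.quotEquivOfEq _ _ h1.symm).trans
    (f.quotKerEquivRange.trans (LinearEquiv.ofEq _ _ h2))

variable (p) in
/-- A pair of a submodule and an element of it amounts to an element and a submodule of the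
quotient by it. -/
noncomputable def flagEquiv (M : Type w) [AddCommGroup M] [Module R M] (b : Q × ℕ)
    (ν σ : Multiset (Q × ℕ)) :
    (Σ N : {N : Submodule R M // HasTy p (M ⧸ N) σ},
      {x : N.1 // HasOrd p b x ∧ HasTy p (N.1 ⧸ Submodule.span R {x}) ν}) ≃
    Σ x : {x : M // HasOrd p b x}, {N : Submodule R (M ⧸ Submodule.span R {x.1}) //
      HasTy p N ν ∧ HasTy p ((M ⧸ Submodule.span R {x.1}) ⧸ N) σ} := by
  have hle : ∀ (N : Submodule R M) (x : N), Submodule.span R {x.1} ≤ N := fun N x => by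
    rw [Submodule.span_singleton_le_iff_mem]; exact x.2
  have hcm : ∀ (x : M) (N : Submodule R (M ⧸ Submodule.span R {x})),
      (N.comap (Submodule.span R {x}).mkQ).map (Submodule.span R {x}).mkQ = N := fun x N =>
    Submodule.map_comap_eq_of_surjective (Submodule.mkQ_surjective _) _
  have hx : ∀ (x : M) (N : Submodule R (M ⧸ Submodule.span R {x})),
      x ∈ N.comap (Submodule.span R {x}).mkQ := fun x N => by
    rw [Submodule.mem_comap, Submodule.mkQ_apply,
      (Submodule.Quotient.mk_eq_zero _).2 (Submodule.mem_span_singleton_self x)]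
    exact N.zero_mem
  have hA : ∀ (x : M) (N : Submodule R (M ⧸ Submodule.span R {x})),
      ((M ⧸ Submodule.span R {x}) ⧸ N) ≃ₗ[R] M ⧸ N.comap (Submodule.span R {x}).mkQ := fun x N =>
    (Submodule.quotEquivOfEq _ _ (hcm x N).symm).trans
      (Submodule.quotientQuotientEquivQuotient _ _ (hle _ ⟨x, hx x N⟩))
  have hB : ∀ (x : M) (N : Submodule R (M ⧸ Submodule.span R {x})),
      N ≃ₗ[R] (N.comap (Submodule.span R {x}).mkQ) ⧸ Submodule.span R
        {(⟨x, hx x N⟩ : N.comap (Submodule.span R {x}).mkQ)} := fun x N =>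
    (LinearEquiv.ofEq _ _ (hcm x N).symm).trans
      (quotSpanEquivMap (N.comap (Submodule.span R {x}).mkQ) ⟨x, hx x N⟩).symm
  have hord : ∀ (N : Submodule R M) (x : N), HasOrd p b x.1 ↔ HasOrd p b x := fun N x =>
    forall_congr' fun r => by
      rw [← Submodule.coe_smul, ZeroMemClass.coe_eq_zero]
  -- Equality of flags is reduced to equality of the submodule and of the element inside M, where
  -- the dependent components can be substituted away.
  have key : ∀ z z' : (Σ N : {N : Submodule R M // HasTy p (M ⧸ N) σ},
      {x : N.1 // HasOrd p b x ∧ HasTy p (N.1 ⧸ Submodule.span R {x}) ν}),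
      z.1.1 = z'.1.1 → z.2.1.1 = z'.2.1.1 → z = z' := by
    rintro ⟨⟨N, _⟩, ⟨⟨x, _⟩, _⟩⟩ ⟨⟨N', _⟩, ⟨⟨y, _⟩, _⟩⟩ h1 h2
    dsimp only at h1 h2
    subst h1
    subst h2
    rfl
  exact
  { toFun := fun z => ⟨⟨z.2.1.1, (hord _ _).2 z.2.2.1⟩,
      ⟨z.1.1.map (Submodule.span R {z.2.1.1}).mkQ,
        z.2.2.2.of_equiv (quotSpanEquivMap z.1.1 z.2.1),
        z.1.2.of_equiv (Submodule.quotientQuotientEquivQuotient _ _ (hle _ z.2.1)).symm⟩⟩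
    invFun := fun z => ⟨⟨z.2.1.comap (Submodule.span R {z.1.1}).mkQ, by
        exact (hasTy_congr (hA _ _)).1 z.2.2.2⟩,
      ⟨⟨z.1.1, hx z.1.1 z.2.1⟩, (hord _ _).1 z.1.2, by
        exact (hasTy_congr (hB _ _)).1 z.2.2.1⟩⟩
    left_inv := by
      rintro ⟨⟨N, hN⟩, ⟨⟨x, hxN⟩, hx1, hx2⟩⟩
      refine key _ _ ?_ rfl
      change (N.map (Submodule.span R {x}).mkQ).comap (Submodule.span R {x}).mkQ = N
      rw [Submodule.comap_map_mkQ, sup_eq_right]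
      exact hle N ⟨x, hxN⟩
    right_inv := by
      rintro ⟨⟨x, hx1⟩, ⟨N, hN1, hN2⟩⟩
      refine Sigma.ext rfl ?_
      exact heq_of_eq (Subtype.ext (hcm _ _)) }

end HallNumbers

/-! ### Associativity and triangularity of Hall numbers -/

section HallRelations

variable {Q : Type} [Fintype Q] [DecidableEq Q] {R : Type w} [CommRing R] [IsDomain R]
  [IsPrincipalIdealRing R] {p : Q → R} {d : Q → ℕ} {q : ℕ}
  {M M' N : Type w} [AddCommGroup M] [Module R M] [AddCommGroup M'] [Module R M']
  [AddCommGroup N] [Module R N]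

theorem HasTy.typeWt_le (hp : IsPrimeSystem p d q) {τ ν : Multiset (Q × ℕ)} (h : HasTy p M τ)
    (h' : HasTy p M' ν) (hc : Nat.card M' ≤ Nat.card M) : typeWt d ν ≤ typeWt d τ := by
  rw [h.card_eq hp, h'.card_eq hp] at hc
  exact (Nat.pow_le_pow_iff_right hp.one_lt).1 hc

theorem HasTy.exists_submodule (hp : IsPrimeSystem p d q) {τ : Multiset (Q × ℕ)}
    (h : HasTy p M τ) (S : Submodule R M) : ∃ ν, typeWt d ν ≤ typeWt d τ ∧ HasTy p S ν := by
  have := h.finite hp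
  obtain ⟨ν, hν⟩ := ((h.isSupported hp).submodule S).exists_hasTy hp
  exact ⟨ν, h.typeWt_le hp hν (Nat.card_le_card_of_injective _ Subtype.val_injective), hν⟩

theorem HasTy.exists_quotient (hp : IsPrimeSystem p d q) {τ : Multiset (Q × ℕ)}
    (h : HasTy p M τ) (S : Submodule R M) : ∃ ν, typeWt d ν ≤ typeWt d τ ∧ HasTy p (M ⧸ S) ν := by
  have := h.finite hp
  obtain ⟨ν, hν⟩ := ((h.isSupported hp).quotient S).exists_hasTy hp
  exact ⟨ν, h.typeWt_le hp hν (Nat.card_le_card_of_surjective _ S.mkQ_surjective), hν⟩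

/-- Submodules are grouped by their type ξ; the cyclic count inside one of them depends only on ξ.
-/
theorem sum_cycNum_submodule (hp : IsPrimeSystem p d q) {τ : Multiset (Q × ℕ)} (h : HasTy p M τ)
    {n : ℕ} (hn : typeWt d τ ≤ n) (b : Q × ℕ) (ν σ : Multiset (Q × ℕ))
    [Fintype {N : Submodule R M // HasTy p (M ⧸ N) σ}] :
    ∑ N : {N : Submodule R M // HasTy p (M ⧸ N) σ}, cycNum p N.1 b ν =
      ∑ ξ ∈ typesLE Q n, hallNum p M ξ σ * cycNum p (StdModule p ξ) b ν := by
  rw [sum_eq_sum_card_mul (α := {N : Submodule R M // HasTy p (M ⧸ N) σ}) (typesLE Q n)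
    (fun N ξ => HasTy p N.1 ξ) ?_ (fun N ξ ξ' h1 h2 => h1.eq hp h2) (fun N => cycNum p N.1 b ν)
    (fun ξ => cycNum p (StdModule p ξ) b ν) ?_]
  · refine Finset.sum_congr rfl fun ξ _ => congrArg (· * _) ?_
    exact Nat.card_congr ((Equiv.subtypeSubtypeEquivSubtypeInter
      (fun N : Submodule R M => HasTy p (M ⧸ N) σ) fun N : Submodule R M => HasTy p N ξ).trans
      (Equiv.subtypeEquivRight fun N => and_comm))
  · intro N
    obtain ⟨ξ, hξ, hN⟩ := h.exists_submodule hp N.1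
    exact ⟨ξ, mem_typesLE hp.deg_pos (hξ.trans hn), hN⟩
  · intro N ξ h1
    obtain ⟨e⟩ := h1.nonempty_equiv (hasTy_stdModule ξ)
    exact cycNum_congr e b ν

theorem sum_hallNum_quotient (hp : IsPrimeSystem p d q) {τ : Multiset (Q × ℕ)} (h : HasTy p M τ)
    {n : ℕ} (hn : typeWt d τ ≤ n) (b : Q × ℕ) (ν σ : Multiset (Q × ℕ))
    [Fintype {x : M // HasOrd p b x}] :
    ∑ x : {x : M // HasOrd p b x}, hallNum p (M ⧸ Submodule.span R {x.1}) ν σ =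
      ∑ ρ ∈ typesLE Q n, cycNum p M b ρ * hallNum p (StdModule p ρ) ν σ := by
  rw [sum_eq_sum_card_mul (α := {x : M // HasOrd p b x}) (typesLE Q n)
    (fun x ρ => HasTy p (M ⧸ Submodule.span R {x.1}) ρ) ?_ (fun N ξ ξ' h1 h2 => h1.eq hp h2)
    (fun x => hallNum p (M ⧸ Submodule.span R {x.1}) ν σ)
    (fun ρ => hallNum p (StdModule p ρ) ν σ) ?_]
  · refine Finset.sum_congr rfl fun ξ _ => congrArg (· * _) ?_
    exact Nat.card_congr (Equiv.subtypeSubtypeEquivSubtypeInter (HasOrd p b)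
      fun x : M => HasTy p (M ⧸ Submodule.span R {x}) ξ)
  · intro x
    obtain ⟨ξ, hξ, hN⟩ := h.exists_quotient hp (Submodule.span R {x.1})
    exact ⟨ξ, mem_typesLE hp.deg_pos (hξ.trans hn), hN⟩
  · intro x ρ h1
    obtain ⟨e⟩ := h1.nonempty_equiv (hasTy_stdModule ρ)
    exact hallNum_congr e ν σ

/-- Double count of the chains Rx ≤ N ≤ M with x of order b, N/Rx of type ν and M/N of type σ: the
left side chooses N first, the right side chooses x first. -/
theorem hallNum_assoc (hp : IsPrimeSystem p d q) {τ : Multiset (Q × ℕ)} (h : HasTy p M τ)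
    {n : ℕ} (hn : typeWt d τ ≤ n) (b : Q × ℕ) (ν σ : Multiset (Q × ℕ)) :
    ∑ ξ ∈ typesLE Q n, hallNum p M ξ σ * cycNum p (StdModule p ξ) b ν =
      ∑ ρ ∈ typesLE Q n, cycNum p M b ρ * hallNum p (StdModule p ρ) ν σ := by
  have hfin := h.finite hp
  have := Fintype.ofFinite {N : Submodule R M // HasTy p (M ⧸ N) σ}
  have := Fintype.ofFinite {x : M // HasOrd p b x}
  have hq : ∀ x : M, Finite (M ⧸ Submodule.span R {x}) := fun x =>
    Finite.of_surjective _ (Submodule.mkQ_surjective _)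
  rw [← sum_cycNum_submodule hp h hn, ← sum_hallNum_quotient hp h hn]
  refine Eq.trans ?_ ((Nat.card_congr (flagEquiv p M b ν σ)).trans ?_)
  · exact Nat.card_sigma.symm
  · exact Nat.card_sigma

theorem hallNum_zero (hp : IsPrimeSystem p d q) {τ : Multiset (Q × ℕ)} (h : HasTy p M τ)
    (σ : Multiset (Q × ℕ)) : hallNum p M 0 σ = if σ = τ then 1 else 0 := by
  have h0 : ∀ N : Submodule R M, HasTy p N (0 : Multiset (Q × ℕ)) ↔ N = ⊥ := by
    intro N
    constructor
    · intro hN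
      have h1 := hN.card_eq hp
      rw [typeWt, Multiset.map_zero, Multiset.sum_zero, pow_zero,
        Nat.card_eq_one_iff_unique] at h1
      have := h1.1
      exact Submodule.eq_bot_of_subsingleton
    · rintro rfl
      exact hasTy_of_subsingleton
  have h1 : ∀ N : Submodule R M, (HasTy p N (0 : Multiset (Q × ℕ)) ∧ HasTy p (M ⧸ N) σ) ↔
      N = ⊥ ∧ σ = τ := by
    intro N
    rw [h0]
    refine and_congr_right ?_
    rintro rfl
    rw [hasTy_congr (Submodule.quotEquivOfEqBot _ rfl)]
    exact ⟨fun h2 => h2.eq hp h, fun h2 => h2 ▸ h⟩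
  rw [hallNum, Nat.card_congr (Equiv.subtypeEquivRight h1)]
  split_ifs with hσ
  · rw [Nat.card_congr (Equiv.subtypeEquivRight fun N => and_iff_left hσ)]
    simp
  · rw [Nat.card_eq_zero]
    exact Or.inl ⟨fun x => hσ x.2.2⟩

/-- The span of an element of order `b` is cyclic. -/
theorem hasTy_span_singleton {b : Q × ℕ} {x : M} (hx : HasOrd p b x) :
    HasTy p (Submodule.span R {x}) {b} := by
  have h1 : LinearMap.ker (LinearMap.toSpanSingleton R M x) = Ideal.span {p b.1 ^ (b.2 + 1)} := by
    ext r
    rw [LinearMap.mem_ker, LinearMap.toSpanSingleton_apply, hx, Ideal.mem_span_singleton]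
  exact (hasTy_cyc b).of_equiv ((Submodule.quotEquivOfEq _ _ h1.symm).trans
    ((LinearMap.quotKerEquivRange _).trans
      (LinearEquiv.ofEq _ _ (LinearMap.range_toSpanSingleton x))))

/-- If M is an extension of M/Rx by Rx, then taking torsion is left exact, so M has at most as much
p_j^k-torsion as the split extension, which is of type b ::ₘ ν. The sizes agree. This makes the
system in `hallNum_assoc` triangular. -/
theorem typeInv_le_of_cycNum_ne_zero (hp : IsPrimeSystem p d q) {b : Q × ℕ}
    {ξ ν : Multiset (Q × ℕ)} (h : HasTy p M ξ) (hne : cycNum p M b ν ≠ 0) :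
    typeWt d ξ = typeWt d (b ::ₘ ν) ∧ ∀ j k, typeInv ξ j k ≤ typeInv (b ::ₘ ν) j k := by
  have hfin := h.finite hp
  rw [cycNum, Nat.card_ne_zero] at hne
  obtain ⟨⟨x, hx1, hx2⟩⟩ := hne.1
  set S := Submodule.span R {x} with hS
  have hfS : Finite (M ⧸ S) := Finite.of_surjective _ S.mkQ_surjective
  have hS1 := hasTy_span_singleton hx1
  have h1 := (hS1.prod hx2)
  rw [Multiset.singleton_add] at h1
  constructor
  · have h2 := Submodule.card_eq_card_quotient_mul_card S
    rw [← Nat.card_prod, h1.card_eq hp, h.card_eq hp] at h2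
    exact hp.pow_injective h2
  · intro j k
    have h2 : Nat.card {y : M // p j ^ k • y = 0} ≤
        Nat.card {y : S × (M ⧸ S) // p j ^ k • y = 0} := by
      classical
      let g : {y : M // p j ^ k • y = 0} → {y : M ⧸ S // p j ^ k • y = 0} := fun y =>
        ⟨S.mkQ y.1, by rw [← map_smul, y.2, map_zero]⟩
      -- A set-theoretic section of the map of torsion over its image; the value 0 off the image is
      -- never used. Subtracting it from y gives the component in S, so y ↦ (y - t(g y), g y) is
      -- injective.
      let t : {y : M ⧸ S // p j ^ k • y = 0} → {y : M // p j ^ k • y = 0} := fun z =>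
        if hz : ∃ y, g y = z then hz.choose else ⟨0, smul_zero _⟩
      have ht : ∀ y, g (t (g y)) = g y := fun y => by
        have hz : ∃ y', g y' = g y := ⟨y, rfl⟩
        simp only [t, dif_pos hz]
        exact hz.choose_spec
      refine Nat.card_le_card_of_injective (fun y => ⟨(⟨y.1 - (t (g y)).1, ?_⟩, (g y).1), ?_⟩) ?_
      · rw [← Submodule.Quotient.mk_eq_zero, ← Submodule.mkQ_apply, map_sub, sub_eq_zero]
        exact (congrArg Subtype.val (ht y)).symm
      · refine Prod.ext (Subtype.ext ?_) (g y).2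
        change p j ^ k • (y.1 - (t (g y)).1) = 0
        rw [smul_sub, y.2, (t (g y)).2, sub_zero]
      · intro y z hyz
        have h3 := congrArg (fun u => u.1.2) hyz
        have h4 : g y = g z := Subtype.ext h3
        have h5 := congrArg (fun u => (u.1.1 : M)) hyz
        simp only [h4] at h5
        exact Subtype.ext (sub_left_inj.1 h5)
    rw [h.card_tors hp, h1.card_tors hp] at h2
    exact Nat.le_of_mul_le_mul_left ((Nat.pow_le_pow_iff_right hp.one_lt).1 h2) (hp.deg_pos j)

/-- The generator of the split cyclic summand is a witness. Positivity here is what allows division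
by the diagonal coefficient. -/
theorem cycNum_cons_pos (hp : IsPrimeSystem p d q) {b : Q × ℕ} {ν : Multiset (Q × ℕ)}
    (h : HasTy p M (b ::ₘ ν)) : 0 < cycNum p M b ν := by
  have h1 : HasTy p ((R ⧸ Ideal.span {p b.1 ^ (b.2 + 1)}) × StdModule p ν) (b ::ₘ ν) := by
    rw [← Multiset.singleton_add]
    exact (hasTy_cyc b).prod (hasTy_stdModule ν)
  obtain ⟨e⟩ := h.nonempty_equiv h1
  rw [cycNum_congr e]
  have := h1.finite hp
  let x : (R ⧸ Ideal.span {p b.1 ^ (b.2 + 1)}) × StdModule p ν := (Ideal.Quotient.mk _ 1, 0)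
  have hx : HasOrd p b x := fun r => by
    rw [Prod.ext_iff]
    simp only [x, Prod.smul_mk, smul_zero, Prod.fst_zero, Prod.snd_zero, and_true]
    rw [smul_mk_eq_zero_iff, mul_one]
  have hs : Submodule.span R {x} = LinearMap.ker (LinearMap.snd R
      (R ⧸ Ideal.span {p b.1 ^ (b.2 + 1)}) (StdModule p ν)) := by
    ext ⟨y, z⟩
    rw [Submodule.mem_span_singleton, LinearMap.mem_ker, LinearMap.snd_apply]
    constructor
    · rintro ⟨r, hr⟩
      rw [← (congrArg Prod.snd hr)]
      exact smul_zero r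
    · rintro rfl
      obtain ⟨r, rfl⟩ := Ideal.Quotient.mk_surjective y
      refine ⟨r, Prod.ext ?_ (smul_zero r)⟩
      change r • (Ideal.Quotient.mk (Ideal.span {p b.1 ^ (b.2 + 1)}) 1) = _
      rw [Algebra.smul_def, map_one, mul_one]
      rfl
  rw [cycNum, Nat.card_pos_iff]
  refine ⟨⟨x, hx, (hasTy_stdModule ν).of_equiv ?_⟩, inferInstance⟩
  exact ((Submodule.quotEquivOfEq _ _ hs).trans
    (LinearMap.quotKerEquivOfSurjective _ LinearMap.snd_surjective)).symm

end HallRelations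

/-! ### Numbers of automorphisms -/

section Automorphisms

variable {Q : Type} [Fintype Q] [DecidableEq Q] {R : Type w} [CommRing R] [IsDomain R]
  [IsPrincipalIdealRing R] {p : Q → R} {d : Q → ℕ} {q : ℕ}
  {M M' N : Type w} [AddCommGroup M] [Module R M] [AddCommGroup M'] [Module R M']
  [AddCommGroup N] [Module R N]

instance finite_linearMap [Finite M] [Finite N] : Finite (N →ₗ[R] M) :=
  Finite.of_injective (fun f => (f : N → M)) DFunLike.coe_injective

/-- The number of automorphisms of `M`. -/
noncomputable def autNum (R : Type w) [CommRing R] (M : Type w) [AddCommGroup M] [Module R M] : ℕ :=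
  Nat.card (M ≃ₗ[R] M)

theorem card_linearEquiv (e : M ≃ₗ[R] M') : Nat.card (M ≃ₗ[R] M') = autNum R M :=
  Nat.card_congr
    { toFun := fun f => f.trans e.symm
      invFun := fun f => f.trans e
      left_inv := fun f => by ext; simp
      right_inv := fun f => by ext; simp }

theorem autNum_congr (e : M ≃ₗ[R] M') : autNum R M = autNum R M' := by
  rw [← card_linearEquiv e, ← card_linearEquiv e.symm]
  exact Nat.card_congr ⟨LinearEquiv.symm, LinearEquiv.symm, fun _ => rfl, fun _ => rfl⟩

theorem autNum_pos [Finite M] : 0 < autNum R M := by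
  have : Finite (M ≃ₗ[R] M) := Finite.of_injective (fun f => (f : M →ₗ[R] M))
    LinearEquiv.toLinearMap_injective
  exact Nat.card_pos

/-- The embedding of a cyclic module given by an element of order `b`. -/
noncomputable def HasOrd.cycMap {b : Q × ℕ} {x : M} (hx : HasOrd p b x) :
    (R ⧸ Ideal.span {p b.1 ^ (b.2 + 1)}) →ₗ[R] M :=
  Submodule.liftQ _ (LinearMap.toSpanSingleton R M x) (by
    intro r hr
    rw [Ideal.mem_span_singleton] at hr
    exact (hx r).2 hr)

theorem HasOrd.cycMap_mk {b : Q × ℕ} {x : M} (hx : HasOrd p b x) (r : R) :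
    hx.cycMap (Ideal.Quotient.mk _ r) = r • x := rfl

/-- The cyclic module embeds with image Rx, so this is the five lemma for C → C × N → N mapping to
Rx → M → M/Rx. -/
theorem HasOrd.bijective_coprod_iff {b : Q × ℕ} {x : M} (hx : HasOrd p b x) (s : N →ₗ[R] M) :
    Function.Bijective (hx.cycMap.coprod s) ↔
      Function.Bijective ((Submodule.span R {x}).mkQ.comp s) := by
  have hmk : ∀ m : M, (Submodule.span R {x}).mkQ m = 0 ↔ ∃ r : R, r • x = m := fun m => by
    rw [Submodule.mkQ_apply, Submodule.Quotient.mk_eq_zero, Submodule.mem_span_singleton]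
  constructor
  · rintro ⟨h1, h2⟩
    constructor
    · rw [injective_iff_map_eq_zero] at h1 ⊢
      intro n hn
      obtain ⟨r, hr⟩ := (hmk _).1 hn
      have h3 := h1 (Ideal.Quotient.mk _ (-r), n) (by
        rw [LinearMap.coprod_apply, hx.cycMap_mk, neg_smul, hr, neg_add_cancel])
      exact congrArg Prod.snd h3
    · intro y
      obtain ⟨m, rfl⟩ := Submodule.mkQ_surjective _ y
      obtain ⟨⟨c, n⟩, hm⟩ := h2 m
      obtain ⟨r, rfl⟩ := Ideal.Quotient.mk_surjective c
      refine ⟨n, ?_⟩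
      rw [LinearMap.coprod_apply, hx.cycMap_mk] at hm
      rw [← hm, map_add, (hmk _).2 ⟨r, rfl⟩, zero_add]
      rfl
  · rintro ⟨h1, h2⟩
    constructor
    · rw [injective_iff_map_eq_zero] at h1 ⊢
      rintro ⟨c, n⟩ hn
      obtain ⟨r, rfl⟩ := Ideal.Quotient.mk_surjective c
      rw [LinearMap.coprod_apply, hx.cycMap_mk] at hn
      have h3 : n = 0 := h1 n ((hmk _).2 ⟨-r, by rw [neg_smul]; exact neg_eq_of_add_eq_zero_right hn⟩)
      subst h3
      rw [map_zero, add_zero, hx] at hn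
      refine Prod.ext ?_ rfl
      exact Ideal.Quotient.eq_zero_iff_mem.2 (Ideal.mem_span_singleton.2 hn)
    · intro m
      obtain ⟨n, hn⟩ := h2 ((Submodule.span R {x}).mkQ m)
      obtain ⟨r, hr⟩ := (hmk (m - s n)).1 (by rw [map_sub, ← hn]; exact sub_self _)
      exact ⟨(Ideal.Quotient.mk _ r, n), by
        rw [LinearMap.coprod_apply, hx.cycMap_mk, hr, sub_add_cancel]⟩

/-- An isomorphism from `C × N`, with `C` cyclic, is given by an element and a map from `N`. -/
noncomputable def prodCycEquiv (p : Q → R) (b : Q × ℕ) (N M : Type w) [AddCommGroup M] [Module R M]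
    [AddCommGroup N] [Module R N] :
    (((R ⧸ Ideal.span {p b.1 ^ (b.2 + 1)}) × N) ≃ₗ[R] M) ≃
      Σ x : {x : M // HasOrd p b x}, {s : N →ₗ[R] M //
        Function.Bijective ((Submodule.span R {x.1}).mkQ.comp s)} := by
  have h1 : ∀ θ : ((R ⧸ Ideal.span {p b.1 ^ (b.2 + 1)}) × N) ≃ₗ[R] M,
      HasOrd p b (θ (Ideal.Quotient.mk _ 1, 0)) := fun θ r => by
    rw [← map_smul, map_eq_zero_iff θ θ.injective, Prod.smul_mk, smul_zero, Prod.mk_eq_zero,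
      smul_mk_eq_zero_iff, mul_one, and_iff_left rfl]
  have h2 : ∀ θ : ((R ⧸ Ideal.span {p b.1 ^ (b.2 + 1)}) × N) ≃ₗ[R] M,
      (h1 θ).cycMap.coprod (θ.toLinearMap.comp (LinearMap.inr R _ N)) = θ.toLinearMap := by
    intro θ
    refine LinearMap.ext fun ⟨c, n⟩ => ?_
    obtain ⟨r, rfl⟩ := Ideal.Quotient.mk_surjective c
    rw [LinearMap.coprod_apply, (h1 θ).cycMap_mk, ← map_smul]
    change θ _ + θ _ = θ _
    rw [← map_add]
    congr 1
    refine Prod.ext ?_ ?_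
    · change r • (Ideal.Quotient.mk (Ideal.span {p b.1 ^ (b.2 + 1)})) 1 + 0 = _
      rw [Algebra.smul_def, map_one, mul_one, add_zero]
      rfl
    · change r • (0 : N) + n = n
      rw [smul_zero, zero_add]
  exact
  { toFun := fun θ => ⟨⟨_, h1 θ⟩, ⟨θ.toLinearMap.comp (LinearMap.inr R _ N), by
      rw [← (h1 θ).bijective_coprod_iff, h2]
      exact θ.bijective⟩⟩
    invFun := fun z => LinearEquiv.ofBijective _ ((z.1.2.bijective_coprod_iff z.2.1).2 z.2.2)
    left_inv := fun θ => by
      apply LinearEquiv.toLinearMap_injective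
      exact h2 θ
    right_inv := by
      rintro ⟨⟨x, hx⟩, ⟨s, hs⟩⟩
      have key : ∀ z z' : (Σ x : {x : M // HasOrd p b x}, {s : N →ₗ[R] M //
        Function.Bijective ((Submodule.span R {x.1}).mkQ.comp s)}), z.1.1 = z'.1.1 →
          z.2.1 = z'.2.1 → z = z' := by
        rintro ⟨⟨x, _⟩, ⟨s, _⟩⟩ ⟨⟨y, _⟩, ⟨t, _⟩⟩ h1 h2
        dsimp only at h1 h2
        subst h1
        subst h2
        rfl
      refine key _ _ ?_ ?_
      · change hx.cycMap.coprod s (Ideal.Quotient.mk _ 1, 0) = x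
        rw [LinearMap.coprod_apply, hx.cycMap_mk, one_smul, map_zero, add_zero]
      · change (hx.cycMap.coprod s).comp (LinearMap.inr R _ N) = s
        rw [LinearMap.coprod_inr] }

/-- Composition with the projection maps Hom(N, M) onto Hom(N, M/Rx) with kernel Hom(N, Rx), so each
of the |Aut N| isomorphisms N → M/Rx has |Hom(N, C)| lifts, C being the cyclic module. -/
theorem card_bijective_mkQ_comp (hp : IsPrimeSystem p d q) {b : Q × ℕ} {ν : Multiset (Q × ℕ)}
    (h : HasTy p M (b ::ₘ ν)) (hN : HasTy p N ν) {x : M} (hx : HasOrd p b x)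
    (hq : HasTy p (M ⧸ Submodule.span R {x}) ν) :
    Nat.card {s : N →ₗ[R] M // Function.Bijective ((Submodule.span R {x}).mkQ.comp s)} =
      autNum R N * Nat.card (N →ₗ[R] R ⧸ Ideal.span {p b.1 ^ (b.2 + 1)}) := by
  have := h.finite hp
  have := hN.finite hp
  have := hp.finite_cyc b
  set S := Submodule.span R {x}
  have := hq.finite hp
  obtain ⟨eq⟩ := hN.nonempty_equiv hq
  obtain ⟨eS⟩ := (hasTy_cyc b).nonempty_equiv (hasTy_span_singleton hx)
  obtain ⟨eM⟩ := h.nonempty_equiv (by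
    rw [← Multiset.singleton_add]; exact (hasTy_cyc (p := p) b).prod hN)
  let f : (N →ₗ[R] M) →ₗ[R] (N →ₗ[R] M ⧸ S) := LinearMap.compRight R S.mkQ
  have hker : Nat.card {s : N →ₗ[R] M // f s = 0} =
      Nat.card (N →ₗ[R] R ⧸ Ideal.span {p b.1 ^ (b.2 + 1)}) := by
    have h1 : ∀ s : N →ₗ[R] M, f s = 0 ↔ ∀ n, s n ∈ S := fun s => by
      rw [LinearMap.ext_iff]
      exact forall_congr' fun n => Submodule.Quotient.mk_eq_zero S
    exact Nat.card_congr
      { toFun := fun s => eS.symm.toLinearMap.comp (s.1.codRestrict S ((h1 s.1).1 s.2))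
        invFun := fun g => ⟨S.subtype.comp (eS.toLinearMap.comp g), (h1 _).2 fun n => (eS (g n)).2⟩
        left_inv := fun s => by ext n; simp
        right_inv := fun g => by
          refine LinearMap.ext fun n => eS.injective (Subtype.ext ?_)
          simp }
  have hcard : Nat.card (N →ₗ[R] M) = Nat.card (N →ₗ[R] R ⧸ Ideal.span {p b.1 ^ (b.2 + 1)}) *
      Nat.card (N →ₗ[R] N) := by
    rw [← Nat.card_prod]
    exact Nat.card_congr
      { toFun := fun g => ((LinearMap.fst R _ _).comp (eM.toLinearMap.comp g),
          (LinearMap.snd R _ _).comp (eM.toLinearMap.comp g))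
        invFun := fun g => eM.symm.toLinearMap.comp (g.1.prod g.2)
        left_inv := fun g => by ext n; simp
        right_inv := fun g => by
          refine Prod.ext ?_ ?_ <;> refine LinearMap.ext fun n => ?_ <;> simp }
  -- Surjectivity comes from counting, without splitting off Rx: M ≅ C × N gives |Hom(N, M)| =
  -- |Hom(N, C)|·|End N|, the kernel has |Hom(N, C)| elements, and |End N| = |Hom(N, M/Rx)|.
  have hsurj : Function.Surjective f := by
    rw [← LinearMap.range_eq_top]
    have h1 := Submodule.card_eq_card_quotient_mul_card (LinearMap.ker f)
    rw [Nat.card_congr f.quotKerEquivRange.toEquiv, hcard] at h1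
    change _ = Nat.card {s : N →ₗ[R] M // f s = 0} * _ at h1
    rw [hker] at h1
    have h2 := Nat.eq_of_mul_eq_mul_left Nat.card_pos h1
    have h3 : Nat.card (N →ₗ[R] N) = Nat.card (N →ₗ[R] M ⧸ S) := Nat.card_congr
      { toFun := fun g => eq.toLinearMap.comp g
        invFun := fun g => eq.symm.toLinearMap.comp g
        left_inv := fun g => by ext n; simp
        right_inv := fun g => by refine LinearMap.ext fun n => by simp }
    rw [h3] at h2
    have h4 : (LinearMap.range f : Set (N →ₗ[R] M ⧸ S)) = Set.univ := by
      refine Set.eq_of_subset_of_ncard_le (Set.subset_univ _) ?_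
      rw [Set.ncard_univ]
      exact h2.le
    exact SetLike.coe_injective h4
  have h5 := card_subtype_comp_of_surjective f.toAddMonoidHom hsurj
    (fun g => Function.Bijective g)
  refine h5.trans ?_
  rw [← card_linearEquiv eq]
  congr 1
  exact Nat.card_congr
    { toFun := fun g => LinearEquiv.ofBijective g.1 g.2
      invFun := fun g => ⟨g.toLinearMap, g.bijective⟩
      left_inv := fun _ => rfl
      right_inv := fun _ => by ext; rfl }

theorem autNum_cons (hp : IsPrimeSystem p d q) {b : Q × ℕ} {ν : Multiset (Q × ℕ)}
    (h : HasTy p M (b ::ₘ ν)) (hN : HasTy p N ν) :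
    autNum R M = cycNum p M b ν *
      (autNum R N * Nat.card (N →ₗ[R] R ⧸ Ideal.span {p b.1 ^ (b.2 + 1)})) := by
  classical
  have := h.finite hp
  have := hN.finite hp
  have := Fintype.ofFinite {x : M // HasOrd p b x}
  obtain ⟨eM⟩ := h.nonempty_equiv (by
    rw [← Multiset.singleton_add]; exact (hasTy_cyc (p := p) b).prod hN)
  rw [autNum_congr eM, ← card_linearEquiv eM.symm, Nat.card_congr (prodCycEquiv p b N M),
    Nat.card_sigma]
  have h1 : ∀ x : {x : M // HasOrd p b x}, Nat.card {s : N →ₗ[R] M //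
      Function.Bijective ((Submodule.span R {x.1}).mkQ.comp s)} =
      if HasTy p (M ⧸ Submodule.span R {x.1}) ν then
        autNum R N * Nat.card (N →ₗ[R] R ⧸ Ideal.span {p b.1 ^ (b.2 + 1)}) else 0 := by
    intro x
    split_ifs with hx
    · exact card_bijective_mkQ_comp hp h hN x.2 hx
    · rw [Nat.card_eq_zero]
      exact Or.inl ⟨fun s => hx (hN.of_equiv (LinearEquiv.ofBijective _ s.2))⟩
  rw [Finset.sum_congr rfl fun x _ => h1 x, ← Finset.sum_filter, Finset.sum_const, smul_eq_mul,
    ← Fintype.card_subtype, ← Nat.card_eq_fintype_card]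
  congr 1
  exact Nat.card_congr (Equiv.subtypeSubtypeEquivSubtypeInter (HasOrd p b)
    fun x : M => HasTy p (M ⧸ Submodule.span R {x}) ν)

theorem autNum_of_subsingleton [Subsingleton M] : autNum R M = 1 := by
  rw [autNum, Nat.card_eq_one_iff_unique]
  exact ⟨⟨fun _ _ => LinearEquiv.ext fun _ => Subsingleton.elim _ _⟩, ⟨LinearEquiv.refl _ _⟩⟩

/-- A map out of R/(p^(m+1)) is the choice of an element killed by p^(m+1), so maps out of a direct
sum are counted by torsion in the target. -/
theorem card_linearMap_cyc (hp : IsPrimeSystem p d q) {b : Q × ℕ} {ν : Multiset (Q × ℕ)}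
    (hM : HasTy p M {b}) (hN : HasTy p N ν) :
    Nat.card (N →ₗ[R] M) = q ^ (ν.map fun a => d a.1 * typeInv {b} a.1 (a.2 + 1)).sum := by
  classical
  obtain ⟨ι, hι, c, rfl, ⟨f⟩⟩ := hN
  have e1 : (N →ₗ[R] M) ≃ (CycPi p c →ₗ[R] M) :=
    { toFun := fun g => g.comp f.symm.toLinearMap
      invFun := fun g => g.comp f.toLinearMap
      left_inv := fun g => by ext n; simp
      right_inv := fun g => LinearMap.ext fun n => by simp }
  have e2 : ∀ a : Q × ℕ, ((R ⧸ Ideal.span {p a.1 ^ (a.2 + 1)}) →ₗ[R] M) ≃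
      {y : M // p a.1 ^ (a.2 + 1) • y = 0} := fun a =>
    { toFun := fun g => ⟨g (Ideal.Quotient.mk _ 1), by
        rw [← map_smul, (smul_mk_eq_zero_iff _ _ _).2 (by rw [mul_one]), map_zero]⟩
      invFun := fun y => Submodule.liftQ _ (LinearMap.toSpanSingleton R M y.1) (by
        intro r hr
        obtain ⟨s, rfl⟩ := Ideal.mem_span_singleton.1 hr
        rw [LinearMap.mem_ker, LinearMap.toSpanSingleton_apply, mul_comm, mul_smul, y.2, smul_zero])
      left_inv := fun g => by
        refine LinearMap.ext fun y => ?_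
        obtain ⟨r, rfl⟩ := Ideal.Quotient.mk_surjective y
        change r • g (Ideal.Quotient.mk _ 1) = _
        rw [← map_smul, Algebra.smul_def, map_one, mul_one]
        rfl
      right_inv := fun y => Subtype.ext (one_smul R y.1) }
  rw [Nat.card_congr e1, ← Nat.card_congr (LinearMap.lsum R
    (fun i => R ⧸ Ideal.span {p (c i).1 ^ ((c i).2 + 1)}) R (M := M)).toEquiv, Nat.card_pi,
    Multiset.map_map]
  change _ = q ^ ∑ i, d (c i).1 * typeInv {b} (c i).1 ((c i).2 + 1)
  rw [← Finset.prod_pow_eq_pow_sum]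
  exact Finset.prod_congr rfl fun i _ => by rw [Nat.card_congr (e2 (c i)), hM.card_tors hp]

end Automorphisms

/-! ### Rational functions of the number of elements of the field -/

section Rational

/-- A finite field `K` with distinct monic irreducible polynomials of the given degrees. -/
structure PolySystem {Q : Type} (d : Q → ℕ) where
  K : Type w
  [field : Field K]
  [finite : Finite K]
  F : Q → K[X]
  injective : Function.Injective F
  monic : ∀ j, (F j).Monic
  irreducible : ∀ j, Irreducible (F j)
  natDegree_eq : ∀ j, (F j).natDegree = d j

attribute [instance] PolySystem.field PolySystem.finite

variable {Q : Type} {d : Q → ℕ}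

/-- The number of elements of the field. -/
noncomputable def PolySystem.q (ω : PolySystem.{w} d) : ℕ := Nat.card ω.K

theorem card_quotient_span_of_monic {K : Type w} [Field K] [Finite K] {f : K[X]} (hf : f.Monic) :
    Nat.card (K[X] ⧸ Ideal.span {f}) = Nat.card K ^ f.natDegree := by
  have : Module.Finite K (K[X] ⧸ Ideal.span {f}) :=
    (AdjoinRoot.powerBasis hf.ne_zero).finite
  rw [Module.natCard_eq_pow_finrank (K := K), finrank_quotient_span_eq_natDegree]

theorem PolySystem.isPrimeSystem (ω : PolySystem.{w} d) : IsPrimeSystem ω.F d ω.q where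
  one_lt := Finite.one_lt_card
  deg_pos j := by
    rw [← ω.natDegree_eq]
    exact (ω.irreducible j).natDegree_pos
  prime j := (ω.irreducible j).prime
  coprime i j hij := by
    rw [(ω.irreducible i).coprime_iff_not_dvd]
    intro h
    have h1 := (ω.irreducible i).associated_of_dvd (ω.irreducible j) h
    exact hij (ω.injective (eq_of_monic_of_associated (ω.monic i) (ω.monic j) h1))
  card_quot j := by rw [card_quotient_span_of_monic (ω.monic j), ω.natDegree_eq]; rfl

/-- A function that is given by a rational function of the number of elements of the field. -/
def IsRationalIn {Ω : Type*} (q : Ω → ℕ) (φ : Ω → ℚ) : Prop :=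
  ∃ N D : ℚ[X], ∀ ω, D.eval (q ω : ℚ) ≠ 0 ∧ φ ω * D.eval (q ω : ℚ) = N.eval (q ω : ℚ)

namespace IsRationalIn

variable {Ω : Type*} {q : Ω → ℕ} {φ ψ : Ω → ℚ}

theorem of_eval (P : ℚ[X]) : IsRationalIn q fun ω => P.eval (q ω : ℚ) :=
  ⟨P, 1, fun ω => by simp⟩

theorem const (c : ℚ) : IsRationalIn q fun _ => c := by
  simpa using of_eval (q := q) (C c)

theorem pow_card (n : ℕ) : IsRationalIn q fun ω => (q ω : ℚ) ^ n := by
  simpa using of_eval (q := q) (X ^ n)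

theorem add (h : IsRationalIn q φ) (h' : IsRationalIn q ψ) :
    IsRationalIn q fun ω => φ ω + ψ ω := by
  obtain ⟨N, D, h⟩ := h
  obtain ⟨N', D', h'⟩ := h'
  refine ⟨N * D' + N' * D, D * D', fun ω => ⟨?_, ?_⟩⟩
  · rw [eval_mul]
    exact mul_ne_zero (h ω).1 (h' ω).1
  · rw [eval_mul, eval_add, eval_mul, eval_mul, ← (h ω).2, ← (h' ω).2]
    ring

theorem mul (h : IsRationalIn q φ) (h' : IsRationalIn q ψ) :
    IsRationalIn q fun ω => φ ω * ψ ω := by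
  obtain ⟨N, D, h⟩ := h
  obtain ⟨N', D', h'⟩ := h'
  refine ⟨N * N', D * D', fun ω => ⟨?_, ?_⟩⟩
  · rw [eval_mul]
    exact mul_ne_zero (h ω).1 (h' ω).1
  · rw [eval_mul, eval_mul, ← (h ω).2, ← (h' ω).2]
    ring

theorem sub (h : IsRationalIn q φ) (h' : IsRationalIn q ψ) :
    IsRationalIn q fun ω => φ ω - ψ ω := by
  have := h.add ((const (-1)).mul h')
  simpa [sub_eq_add_neg] using this

theorem div (h : IsRationalIn q φ) (h' : IsRationalIn q ψ) (hψ : ∀ ω, ψ ω ≠ 0) :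
    IsRationalIn q fun ω => φ ω / ψ ω := by
  obtain ⟨N, D, h⟩ := h
  obtain ⟨N', D', h'⟩ := h'
  refine ⟨N * D', D * N', fun ω => ⟨?_, ?_⟩⟩
  · rw [eval_mul, ← (h' ω).2]
    exact mul_ne_zero (h ω).1 (mul_ne_zero (hψ ω) (h' ω).1)
  · rw [eval_mul, eval_mul, ← (h ω).2, ← (h' ω).2]
    have := hψ ω
    field_simp

theorem sum {ι : Type*} (s : Finset ι) {f : ι → Ω → ℚ} (h : ∀ i ∈ s, IsRationalIn q (f i)) :
    IsRationalIn q fun ω => ∑ i ∈ s, f i ω := by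
  classical
  induction s using Finset.induction with
  | empty => simpa using const 0
  | insert i s hi ih =>
    simp only [Finset.sum_insert hi]
    exact (h i (Finset.mem_insert_self _ _)).add
      (ih fun j hj => h j (Finset.mem_insert_of_mem hj))

theorem prod {ι : Type*} (s : Finset ι) {f : ι → Ω → ℚ} (h : ∀ i ∈ s, IsRationalIn q (f i)) :
    IsRationalIn q fun ω => ∏ i ∈ s, f i ω := by
  classical
  induction s using Finset.induction with
  | empty => simpa using const 1
  | insert i s hi ih =>
    simp only [Finset.prod_insert hi]
    exact (h i (Finset.mem_insert_self _ _)).mul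
      (ih fun j hj => h j (Finset.mem_insert_of_mem hj))

end IsRationalIn

variable [Fintype Q] [DecidableEq Q]

theorem isRationalIn_cycNum (d : Q → ℕ) (τ σ : Multiset (Q × ℕ)) (b : Q × ℕ) :
    IsRationalIn PolySystem.q fun ω : PolySystem.{w} d =>
      (cycNum ω.F (StdModule ω.F τ) b σ : ℚ) := by
  classical
  have h1 : ∀ ω : PolySystem.{w} d, (cycNum ω.F (StdModule ω.F τ) b σ : ℚ) = _ := fun ω =>
    congrArg (Int.cast (R := ℚ)) (card_hasOrd_hasTy_quotient ω.isPrimeSystem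
      (c := fun i : Fin τ.toList.length => τ.toList.get i) b σ)
  simp only [h1]
  push_cast
  refine IsRationalIn.sum _ fun a _ => IsRationalIn.prod _ fun i _ => ?_
  by_cases ha : a i = 0
  · simpa only [ha, if_true] using IsRationalIn.const 1
  · simpa only [ha, if_false] using (IsRationalIn.pow_card _).sub (IsRationalIn.pow_card _)

/-- The number of types of the same weight with smaller torsion. -/
def typeRank (d : Q → ℕ) (ν : Multiset (Q × ℕ)) : Set (Multiset (Q × ℕ)) :=
  {ξ | ξ ∈ typesLE Q (typeWt d ν) ∧ ∀ j k, typeInv ξ j k ≤ typeInv ν j k}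

/-- The set below ξ lies in the set below ν and misses ν itself, because dominance in both
directions forces equality. -/
theorem ncard_typeRank_lt (hd : ∀ j, 0 < d j) {ξ ν : Multiset (Q × ℕ)}
    (h1 : typeWt d ξ = typeWt d ν) (h2 : ∀ j k, typeInv ξ j k ≤ typeInv ν j k) (h3 : ξ ≠ ν) :
    (typeRank d ξ).ncard < (typeRank d ν).ncard := by
  refine Set.ncard_lt_ncard ⟨?_, ?_⟩ ((Finset.finite_toSet (typesLE Q (typeWt d ν))).subset
    fun ξ h => h.1)
  · rintro ρ ⟨h4, h5⟩
    exact ⟨h1 ▸ h4, fun j k => (h5 j k).trans (h2 j k)⟩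
  · intro h4
    have h5 := h4 (a := ν) ⟨mem_typesLE hd le_rfl, fun _ _ => le_rfl⟩
    exact h3 (typeInv_injective fun j k => le_antisymm (h2 j k) (h5.2 j k))

theorem hallNum_eq_zero {R : Type w} [CommRing R] [IsDomain R] [IsPrincipalIdealRing R]
    {p : Q → R} {q : ℕ} (hp : IsPrimeSystem p d q) {M : Type w} [AddCommGroup M] [Module R M]
    {τ ν : Multiset (Q × ℕ)} (h : HasTy p M τ) (hν : ν ∉ typesLE Q (typeWt d τ))
    (σ : Multiset (Q × ℕ)) : hallNum p M ν σ = 0 := by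
  rw [hallNum, Nat.card_eq_zero]
  refine Or.inl ⟨fun N => hν ?_⟩
  obtain ⟨ξ, h1, h2⟩ := h.exists_submodule hp N.1
  rw [N.2.1.eq hp h2]
  exact mem_typesLE hp.deg_pos h1

/-- Induction on the weight of the submodule type and then on the number of types below it. The
relation `hallNum_assoc` is solved for the term of b ::ₘ ν: its right side involves ν, of smaller
weight, and the other terms on the left involve types strictly below b ::ₘ ν. -/
theorem isRationalIn_hallNum_aux (d : Q → ℕ) (n m : ℕ) : ∀ ν : Multiset (Q × ℕ),
    typeWt d ν = n → (typeRank d ν).ncard = m → ∀ τ σ : Multiset (Q × ℕ),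
    IsRationalIn PolySystem.q fun ω : PolySystem.{w} d =>
      (hallNum ω.F (StdModule ω.F τ) ν σ : ℚ) := by
  induction n using Nat.strong_induction_on generalizing m with
  | _ n ihn =>
  induction m using Nat.strong_induction_on with
  | _ m ihm =>
  intro ν hn hm τ σ
  -- If no field carries such polynomials the claim is vacuous; otherwise one system supplies the
  -- positivity of the degrees.
  by_cases hω : Nonempty (PolySystem.{w} d)
  swap
  · exact ⟨0, 1, fun ω => (hω ⟨ω⟩).elim⟩
  obtain ⟨ω₀⟩ := hω
  have hd := ω₀.isPrimeSystem.deg_pos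
  induction ν using Multiset.induction with
  | empty =>
    have h1 : ∀ ω : PolySystem.{w} d, hallNum ω.F (StdModule ω.F τ) 0 σ = if σ = τ then 1 else 0 :=
      fun ω => hallNum_zero ω.isPrimeSystem (hasTy_stdModule τ) σ
    simp only [h1]
    exact IsRationalIn.const _
  | cons b ν _ =>
    by_cases hT : b ::ₘ ν ∈ typesLE Q (typeWt d τ)
    swap
    · have h1 : ∀ ω : PolySystem.{w} d, hallNum ω.F (StdModule ω.F τ) (b ::ₘ ν) σ = 0 :=
        fun ω => hallNum_eq_zero ω.isPrimeSystem (hasTy_stdModule τ) hT σ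
      simp only [h1]
      exact IsRationalIn.const _
    have hpos : ∀ ω : PolySystem.{w} d,
        (cycNum ω.F (StdModule ω.F (b ::ₘ ν)) b ν : ℚ) ≠ 0 := fun ω =>
      Nat.cast_ne_zero.2 (cycNum_cons_pos ω.isPrimeSystem (hasTy_stdModule _)).ne'
    have key : ∀ ω : PolySystem.{w} d, (hallNum ω.F (StdModule ω.F τ) (b ::ₘ ν) σ : ℚ) =
        (∑ ρ ∈ typesLE Q (typeWt d τ), (cycNum ω.F (StdModule ω.F τ) b ρ : ℚ) *
          (hallNum ω.F (StdModule ω.F ρ) ν σ : ℚ) -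
        ∑ ξ ∈ (typesLE Q (typeWt d τ)).erase (b ::ₘ ν), (hallNum ω.F (StdModule ω.F τ) ξ σ : ℚ) *
          (cycNum ω.F (StdModule ω.F ξ) b ν : ℚ)) /
          (cycNum ω.F (StdModule ω.F (b ::ₘ ν)) b ν : ℚ) := by
      intro ω
      rw [eq_div_iff (hpos ω), eq_sub_iff_add_eq, Finset.add_sum_erase _
        (fun ξ => (hallNum ω.F (StdModule ω.F τ) ξ σ : ℚ) *
          (cycNum ω.F (StdModule ω.F ξ) b ν : ℚ)) hT]
      exact_mod_cast hallNum_assoc ω.isPrimeSystem (hasTy_stdModule τ) le_rfl b ν σ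
    simp only [key]
    refine IsRationalIn.div (IsRationalIn.sub (IsRationalIn.sum _ fun ρ _ => ?_)
      (IsRationalIn.sum _ fun ξ hξ => ?_)) (isRationalIn_cycNum d _ _ _) hpos
    · refine (isRationalIn_cycNum d _ _ _).mul (ihn _ ?_ _ ν rfl rfl ρ σ)
      rw [← hn, typeWt_cons]
      exact Nat.lt_add_of_pos_left (Nat.mul_pos (hd _) (Nat.succ_pos _))
    -- A coefficient that is nonzero for a single system already forces ξ to lie below b ::ₘ ν, a
    -- condition that no longer mentions the system.
    · by_cases h0 : ∀ ω : PolySystem.{w} d, cycNum ω.F (StdModule ω.F ξ) b ν = 0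
      · simp only [h0, Nat.cast_zero, mul_zero]
        exact IsRationalIn.const 0
      · push Not at h0
        obtain ⟨ω, h0⟩ := h0
        obtain ⟨h1, h2⟩ := typeInv_le_of_cycNum_ne_zero ω.isPrimeSystem (hasTy_stdModule ξ) h0
        refine IsRationalIn.mul (ihm _ ?_ ξ (h1.trans hn) rfl τ σ) (isRationalIn_cycNum d _ _ _)
        rw [← hm]
        exact ncard_typeRank_lt hd h1 h2 (Finset.ne_of_mem_erase hξ)

theorem isRationalIn_hallNum (d : Q → ℕ) (τ ν σ : Multiset (Q × ℕ)) :
    IsRationalIn PolySystem.q fun ω : PolySystem.{w} d =>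
      (hallNum ω.F (StdModule ω.F τ) ν σ : ℚ) :=
  isRationalIn_hallNum_aux d _ _ ν rfl rfl τ σ

theorem isRationalIn_autNum (d : Q → ℕ) (ν : Multiset (Q × ℕ)) :
    IsRationalIn PolySystem.q fun ω : PolySystem.{w} d =>
      (autNum ω.K[X] (StdModule ω.F ν) : ℚ) := by
  induction ν using Multiset.induction with
  | empty =>
    have h1 : ∀ ω : PolySystem.{w} d, autNum ω.K[X] (StdModule ω.F (0 : Multiset (Q × ℕ))) = 1 :=
      fun ω => by
        have : IsEmpty (Fin (0 : Multiset (Q × ℕ)).toList.length) := by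
          rw [Multiset.toList_zero]; exact Fin.isEmpty
        exact autNum_of_subsingleton
    simp only [h1]
    exact IsRationalIn.const _
  | cons b ν ih =>
    have h1 : ∀ ω : PolySystem.{w} d, (autNum ω.K[X] (StdModule ω.F (b ::ₘ ν)) : ℚ) = _ :=
      fun ω => congrArg (Nat.cast (R := ℚ)) (autNum_cons ω.isPrimeSystem
        (hasTy_stdModule (b ::ₘ ν)) (hasTy_stdModule ν))
    have h2 := fun ω : PolySystem.{w} d => card_linearMap_cyc ω.isPrimeSystem (hasTy_cyc b)
      (hasTy_stdModule (p := ω.F) ν)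
    simp only [h1, h2]
    push_cast
    exact (isRationalIn_cycNum d _ _ _).mul (ih.mul (IsRationalIn.pow_card _))

end Rational

/-! ### Block triangular endomorphisms -/

section BlockEnd

variable {K : Type w} [Field K] {V U M M' : Type w} [AddCommGroup V] [Module K V] [AddCommGroup U]
  [Module K U] [AddCommGroup M] [Module K M] [Module K[X] M] [IsScalarTower K K[X] M]
  [AddCommGroup M'] [Module K M'] [Module K[X] M'] [IsScalarTower K K[X] M']

/-- Isomorphisms of `K[X]`-modules in terms of `K`-linear maps. -/
noncomputable def aevalEquivEquiv (a : V →ₗ[K] V) :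
    {g : V →ₗ[K] M // (∀ v, g (a v) = (X : K[X]) • g v) ∧ Function.Bijective g} ≃
      (Module.AEval' a ≃ₗ[K[X]] M) where
  toFun g := LinearEquiv.ofAEval a (LinearEquiv.ofBijective g.1 g.2.2) g.2.1
  invFun f := ⟨(f.toLinearMap.restrictScalars K).comp (Module.AEval'.of a).toLinearMap, by
    refine ⟨fun v => ?_, f.bijective.comp (Module.AEval'.of a).bijective⟩
    change f (Module.AEval'.of a (a v)) = (X : K[X]) • f (Module.AEval'.of a v)
    rw [← map_smul, Module.AEval'.X_smul_of]⟩
  left_inv g := by ext; rfl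
  right_inv f := by ext; rfl

theorem nonempty_aeval_equiv_iff {V' : Type w} [AddCommGroup V'] [Module K V'] (e : V ≃ₗ[K] V')
    (a : V →ₗ[K] V) (a' : V' →ₗ[K] V') (h : ∀ v, e (a v) = a' (e v)) :
    Nonempty (Module.AEval' a ≃ₗ[K[X]] Module.AEval' a') :=
  ⟨LinearEquiv.ofAEval a (e.trans (Module.AEval'.of a')) fun v => by
    change Module.AEval'.of a' (e (a v)) = (X : K[X]) • Module.AEval'.of a' (e v)
    rw [h, Module.AEval'.X_smul_of]⟩

/-- The endomorphism of `V × U` with diagonal blocks `a`, `b` and lower block `W`. -/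
noncomputable def blockEnd (a : V →ₗ[K] V) (b : U →ₗ[K] U) (W : V →ₗ[K] U) :
    (V × U) →ₗ[K] (V × U) :=
  (a.comp (LinearMap.fst K V U)).prod
    (W.comp (LinearMap.fst K V U) + b.comp (LinearMap.snd K V U))

@[simp] theorem blockEnd_apply (a : V →ₗ[K] V) (b : U →ₗ[K] U) (W : V →ₗ[K] U) (z : V × U) :
    blockEnd a b W z = (a z.1, W z.1 + b z.2) := rfl

/-- The pairs of a map from `U` and a map from `V` that give an isomorphism between a block
triangular endomorphism and `M`. -/
def IsBlockIso (a : V →ₗ[K] V) (b : U →ₗ[K] U) (j : Module.AEval' b →ₗ[K[X]] M)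
    (s : V →ₗ[K] M) : Prop :=
  (∀ v, ∃ u, (X : K[X]) • s v - s (a v) = j u) ∧
    Function.Bijective (s.coprod ((j.restrictScalars K).comp (Module.AEval'.of b).toLinearMap))

/-- An isomorphism θ from V × U is the same as its restrictions j to U and s to V. The block W need
not be remembered: compatibility with X says j(W v) = X·s(v) - s(a v), which determines W as j is
injective. -/
theorem card_sigma_blockEnd (M : Type w) [AddCommGroup M] [Module K M] [Module K[X] M]
    [IsScalarTower K K[X] M] (a : V →ₗ[K] V) (b : U →ₗ[K] U) :
    Nat.card (Σ W : V →ₗ[K] U, Module.AEval' (blockEnd a b W) ≃ₗ[K[X]] M) =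
      Nat.card (Σ j : Module.AEval' b →ₗ[K[X]] M, {s : V →ₗ[K] M // IsBlockIso a b j s}) := by
  let Z := {z : (V →ₗ[K] U) × ((V × U) →ₗ[K] M) //
    (∀ x, z.2 (blockEnd a b z.1 x) = (X : K[X]) • z.2 x) ∧ Function.Bijective z.2}
  have e1 : (Σ W : V →ₗ[K] U, Module.AEval' (blockEnd a b W) ≃ₗ[K[X]] M) ≃ Z :=
    (Equiv.sigmaCongrRight fun W => (aevalEquivEquiv (M := M) (blockEnd a b W)).symm).trans
      { toFun := fun z => ⟨(z.1, z.2.1), z.2.2⟩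
        invFun := fun z => ⟨z.1.1, ⟨z.1.2, z.2⟩⟩
        left_inv := fun _ => rfl
        right_inv := fun _ => rfl }
  have hj : ∀ z : Z, ∀ u, (z.1.2.comp (LinearMap.inr K V U)) (b u) =
      (X : K[X]) • (z.1.2.comp (LinearMap.inr K V U)) u := by
    rintro z u
    have h1 := z.2.1 (0, u)
    simpa using h1
  let f : Z → Σ j : Module.AEval' b →ₗ[K[X]] M, {s : V →ₗ[K] M // IsBlockIso a b j s} := fun z =>
    ⟨LinearMap.ofAEval b (z.1.2.comp (LinearMap.inr K V U)) (hj z),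
      ⟨z.1.2.comp (LinearMap.inl K V U), by
        constructor
        · intro v
          refine ⟨Module.AEval'.of b (z.1.1 v), ?_⟩
          have h1 := z.2.1 (v, 0)
          rw [blockEnd_apply] at h1
          change (X : K[X]) • z.1.2 (v, 0) - z.1.2 (a v, 0) = z.1.2 (0, z.1.1 v)
          rw [← h1, ← map_sub]
          congr 1
          simp
        · convert z.2.2 using 1
          refine funext fun x => ?_
          change z.1.2 (x.1, 0) + z.1.2 (0, x.2) = z.1.2 x
          rw [← map_add]
          congr 1
          simp⟩⟩
  have hf : Function.Bijective f := by
    constructor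
    · rintro ⟨⟨W, θ⟩, h1, h2⟩ ⟨⟨W', θ'⟩, h1', h2'⟩ h
      have h3 : ∀ v, θ (v, 0) = θ' (v, 0) := fun v =>
        congrArg (fun t : (Σ j : Module.AEval' b →ₗ[K[X]] M, {s : V →ₗ[K] M // IsBlockIso a b j s})
          => t.2.1 v) h
      have h4 : ∀ u, θ (0, u) = θ' (0, u) := fun u =>
        congrArg (fun t : (Σ j : Module.AEval' b →ₗ[K[X]] M, {s : V →ₗ[K] M // IsBlockIso a b j s})
          => t.1 (Module.AEval'.of b u)) h
      have h5 : θ = θ' := by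
        refine LinearMap.prod_ext (LinearMap.ext h3) (LinearMap.ext h4)
      subst h5
      have h6 : W = W' := by
        refine LinearMap.ext fun v => ?_
        have h7 := h2.1 ((h1 (v, 0)).trans (h1' (v, 0)).symm)
        simpa using congrArg Prod.snd h7
      subst h6
      rfl
    · rintro ⟨j, s, h1, h2⟩
      let j' : U →ₗ[K] M := (j.restrictScalars K).comp (Module.AEval'.of b).toLinearMap
      have hinj : Function.Injective j' := fun u u' h => by
        have h3 := @h2.1 (0, u) (0, u') (by
          rw [LinearMap.coprod_apply, LinearMap.coprod_apply]
          exact congrArg (s 0 + ·) h)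
        exact congrArg Prod.snd h3
      -- The failure of s to commute with X; pulling it back through j recovers W.
      let t : V →ₗ[K] M := (Algebra.lsmul K K M (X : K[X])).comp s - s.comp a
      have ht : ∀ v, t v ∈ LinearMap.range j' := fun v => by
        obtain ⟨u, hu⟩ := h1 v
        exact ⟨(Module.AEval'.of b).symm u, hu.symm⟩
      let W : V →ₗ[K] U := (LinearEquiv.ofInjective j' hinj).symm.toLinearMap.comp
        (t.codRestrict _ ht)
      have hW : ∀ v, j' (W v) = t v := fun v => by
        have := congrArg Subtype.val
          ((LinearEquiv.ofInjective j' hinj).apply_symm_apply (t.codRestrict _ ht v))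
        exact this
      have hjX : ∀ u, j' (b u) = (X : K[X]) • j' u := fun u => by
        change j (Module.AEval'.of b (b u)) = (X : K[X]) • j (Module.AEval'.of b u)
        rw [← map_smul, Module.AEval'.X_smul_of]
      have key : ∀ x, s.coprod j' (blockEnd a b W x) = (X : K[X]) • s.coprod j' x := by
        intro x
        rw [blockEnd_apply, LinearMap.coprod_apply, LinearMap.coprod_apply, map_add, hW, hjX,
          smul_add]
        change s (a x.1) + (((X : K[X]) • s x.1 - s (a x.1)) + _) = _
        abel
      refine ⟨⟨(W, s.coprod j'), key, h2⟩, ?_⟩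
      have h8 : ∀ z z' : (Σ j : Module.AEval' b →ₗ[K[X]] M, {s : V →ₗ[K] M // IsBlockIso a b j s}),
          z.1 = z'.1 → z.2.1 = z'.2.1 → z = z' := by
        rintro ⟨j, s, _⟩ ⟨j', s', _⟩ h1 h2
        dsimp only at h1 h2
        subst h1
        subst h2
        rfl
      refine h8 _ _ (LinearMap.ext fun u => ?_) (LinearMap.ext fun v => ?_)
      · change s 0 + j' ((Module.AEval'.of b).symm u) = j u
        rw [map_zero, zero_add]
        rfl
      · change s v + j' 0 = s v
        rw [map_zero, add_zero]
  exact Nat.card_congr (e1.trans (Equiv.ofBijective f hf))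

/-- Again the five lemma: j must be an embedding, and s modulo the image of j must be a
K[X]-isomorphism from (V, a) to the cokernel. -/
theorem isBlockIso_iff (a : V →ₗ[K] V) (b : U →ₗ[K] U) (j : Module.AEval' b →ₗ[K[X]] M)
    (s : V →ₗ[K] M) : IsBlockIso a b j s ↔ Function.Injective j ∧
      ((∀ v, ((LinearMap.range j).mkQ.restrictScalars K).comp s (a v) =
        (X : K[X]) • ((LinearMap.range j).mkQ.restrictScalars K).comp s v) ∧
        Function.Bijective (((LinearMap.range j).mkQ.restrictScalars K).comp s)) := by
  have hmk : ∀ m : M, (LinearMap.range j).mkQ m = 0 ↔ ∃ u, j u = m := fun m => by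
    rw [Submodule.mkQ_apply, Submodule.Quotient.mk_eq_zero, LinearMap.mem_range]
  have h0 : (∀ v, ∃ u, (X : K[X]) • s v - s (a v) = j u) ↔
      ∀ v, ((LinearMap.range j).mkQ.restrictScalars K).comp s (a v) =
        (X : K[X]) • ((LinearMap.range j).mkQ.restrictScalars K).comp s v := by
    refine forall_congr' fun v => ?_
    change _ ↔ (LinearMap.range j).mkQ (s (a v)) = (X : K[X]) • (LinearMap.range j).mkQ (s v)
    rw [← map_smul (LinearMap.range j).mkQ, eq_comm, ← sub_eq_zero,
      ← map_sub (LinearMap.range j).mkQ, hmk]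
    exact exists_congr fun u => eq_comm
  rw [IsBlockIso, h0, and_left_comm]
  refine and_congr_right fun _ => ?_
  constructor
  · rintro ⟨h1, h2⟩
    refine ⟨fun u u' h => ?_, ?_, ?_⟩
    · have h3 := @h1 (0, u) (0, u') (congrArg (s 0 + ·) h)
      exact congrArg Prod.snd h3
    · rw [injective_iff_map_eq_zero]
      intro v hv
      obtain ⟨u, hu⟩ := (hmk _).1 hv
      have h3 := @h1 (v, 0) (0, u) (by
        change s v + j 0 = s 0 + j u
        rw [hu, map_zero, map_zero, add_zero, zero_add])
      exact congrArg Prod.fst h3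
    · intro y
      obtain ⟨m, rfl⟩ := Submodule.mkQ_surjective _ y
      obtain ⟨⟨v, u⟩, hm⟩ := h2 m
      refine ⟨v, ?_⟩
      change (LinearMap.range j).mkQ (s v) = _
      rw [← hm]
      change _ = (LinearMap.range j).mkQ (s v + j u)
      rw [map_add, (hmk (j u)).2 ⟨u, rfl⟩, add_zero]
  · rintro ⟨h1, h2, h3⟩
    constructor
    · rw [injective_iff_map_eq_zero]
      rintro ⟨v, u⟩ h
      change s v + j u = 0 at h
      have hv : v = 0 := (injective_iff_map_eq_zero _).1 h2 v ((hmk _).2 ⟨-(Module.AEval'.of b u), by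
        rw [map_neg]
        exact neg_eq_of_add_eq_zero_left h⟩)
      subst hv
      rw [map_zero, zero_add] at h
      exact Prod.ext rfl ((injective_iff_map_eq_zero _).1 h1 u h)
    · intro m
      obtain ⟨v, hv⟩ := h3 ((LinearMap.range j).mkQ m)
      obtain ⟨u, hu⟩ := (hmk (m - s v)).1 (by rw [map_sub, ← hv]; exact sub_self _)
      exact ⟨(v, u), by
        change s v + j u = m
        rw [hu, add_sub_cancel]⟩

end BlockEnd

/-! ### Embeddings with prescribed cokernel -/

section Embeddings

variable {Q : Type} [Fintype Q] {R : Type w} [CommRing R] [IsDomain R]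
  [IsPrincipalIdealRing R] {p : Q → R} {d : Q → ℕ} {q : ℕ}
  {M N : Type w} [AddCommGroup M] [Module R M] [AddCommGroup N] [Module R N]

/-- An embedding is its image together with an isomorphism onto it. -/
theorem card_embeddings [Finite M] [Finite N] {ν : Multiset (Q × ℕ)} (hN : HasTy p N ν)
    (σ : Multiset (Q × ℕ)) :
    Nat.card {j : N →ₗ[R] M // Function.Injective j ∧ HasTy p (M ⧸ LinearMap.range j) σ} =
      hallNum p M ν σ * autNum R N := by
  have := Fintype.ofFinite {S : Submodule R M // HasTy p S ν ∧ HasTy p (M ⧸ S) σ}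
  have hr : ∀ (S : Submodule R M) (e : N ≃ₗ[R] S),
      LinearMap.range (S.subtype.comp e.toLinearMap) = S := fun S e => by
    rw [LinearMap.range_comp, LinearEquiv.range, Submodule.map_top, Submodule.range_subtype]
  let f : (Σ S : {S : Submodule R M // HasTy p S ν ∧ HasTy p (M ⧸ S) σ}, N ≃ₗ[R] S.1) →
      {j : N →ₗ[R] M // Function.Injective j ∧ HasTy p (M ⧸ LinearMap.range j) σ} := fun z =>
    ⟨z.1.1.subtype.comp z.2.toLinearMap, Subtype.val_injective.comp z.2.injective,
      (hasTy_congr (Submodule.quotEquivOfEq _ _ (hr _ _))).2 z.1.2.2⟩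
  have hf : Function.Bijective f := by
    constructor
    · rintro ⟨⟨S, h1, h2⟩, e⟩ ⟨⟨S', h1', h2'⟩, e'⟩ h
      have h3 := congrArg Subtype.val h
      change S.subtype.comp e.toLinearMap = S'.subtype.comp e'.toLinearMap at h3
      have h4 : S = S' := by rw [← hr S e, ← hr S' e', h3]
      subst h4
      have h5 : e = e' := LinearEquiv.ext fun n => Subtype.ext (LinearMap.congr_fun h3 n)
      rw [h5]
    · rintro ⟨j, h1, h2⟩
      exact ⟨⟨⟨LinearMap.range j, hN.of_equiv (LinearEquiv.ofInjective j h1), h2⟩,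
        LinearEquiv.ofInjective j h1⟩, Subtype.ext (LinearMap.ext fun _ => rfl)⟩
  rw [← Nat.card_congr (Equiv.ofBijective f hf)]
  have hfin : ∀ S : {S : Submodule R M // HasTy p S ν ∧ HasTy p (M ⧸ S) σ},
      Finite (N ≃ₗ[R] S.1) := fun S =>
    Finite.of_injective (fun f => (f : N →ₗ[R] S.1)) LinearEquiv.toLinearMap_injective
  rw [Nat.card_sigma, Finset.sum_congr rfl (g := fun _ => autNum R N) fun S _ => ?_,
    Finset.sum_const, smul_eq_mul, Finset.card_univ, ← Nat.card_eq_fintype_card]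
  · rfl
  · obtain ⟨e⟩ := hN.nonempty_equiv S.2.1
    exact card_linearEquiv e

end Embeddings

/-! ### Extension blocks that produce a given type -/

section BlockCount

variable {Q : Type} [Fintype Q] {K : Type w} [Field K] [Finite K] {p : Q → K[X]} {d : Q → ℕ} {q : ℕ}
  {V U M : Type w} [AddCommGroup V] [Module K V] [AddCommGroup U]
  [Module K U] [AddCommGroup M] [Module K M] [Module K[X] M] [IsScalarTower K K[X] M]

instance [Finite V] (a : V →ₗ[K] V) : Finite (Module.AEval' a) := inferInstanceAs (Finite V)

/-- Since s is only K-linear and M → M/j(U) splits over K, each K[X]-isomorphism from (V, a) to the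
cokernel lifts, and its lifts form a torsor under Hom_K(V, U). -/
theorem card_isBlockIso [Finite V] [Finite U] [Finite M] {α : Multiset (Q × ℕ)} {a : V →ₗ[K] V}
    (ha : HasTy p (Module.AEval' a) α) (b : U →ₗ[K] U) (j : Module.AEval' b →ₗ[K[X]] M)
    (hj : Function.Injective j) (hα : HasTy p (M ⧸ LinearMap.range j) α) :
    Nat.card {s : V →ₗ[K] M // IsBlockIso a b j s} =
      autNum K[X] (Module.AEval' a) * Nat.card (V →ₗ[K] U) := by
  set S := LinearMap.range j
  have : Finite (M ⧸ S) := Finite.of_surjective _ S.mkQ_surjective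
  let π : M →ₗ[K] M ⧸ S := S.mkQ.restrictScalars K
  have hπ : Function.Surjective π := S.mkQ_surjective
  obtain ⟨σ, hσ⟩ := π.exists_rightInverse_of_surjective (LinearMap.range_eq_top.2 hπ)
  let f : (V →ₗ[K] M) →ₗ[K] (V →ₗ[K] M ⧸ S) := LinearMap.compRight K π
  have hf : Function.Surjective f := fun g => ⟨σ.comp g, by
    change π.comp (σ.comp g) = g
    rw [← LinearMap.comp_assoc, hσ, LinearMap.id_comp]⟩
  have h1 : ∀ s, IsBlockIso a b j s ↔ (fun g : V →ₗ[K] M ⧸ S =>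
      (∀ v, g (a v) = (X : K[X]) • g v) ∧ Function.Bijective g) (f.toAddMonoidHom s) := fun s => by
    rw [isBlockIso_iff]
    exact and_iff_right hj
  rw [Nat.card_congr (Equiv.subtypeEquivRight h1)]
  refine (card_subtype_comp_of_surjective f.toAddMonoidHom hf (fun g =>
    (∀ v, g (a v) = (X : K[X]) • g v) ∧ Function.Bijective g)).trans ?_
  congr 1
  · rw [Nat.card_congr (aevalEquivEquiv (M := M ⧸ S) a)]
    obtain ⟨e⟩ := ha.nonempty_equiv hα
    exact card_linearEquiv e
  · let j' : U →ₗ[K] M := (j.restrictScalars K).comp (Module.AEval'.of b).toLinearMap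
    have hj' : Function.Injective j' := hj
    have h2 : ∀ s : V →ₗ[K] M, f.toAddMonoidHom s = 0 ↔ ∀ v, s v ∈ LinearMap.range j' := fun s => by
      have h3 : f.toAddMonoidHom s = 0 ↔ ∀ v, S.mkQ (s v) = 0 := LinearMap.ext_iff
      rw [h3]
      exact forall_congr' fun v => Submodule.Quotient.mk_eq_zero S
    let e := LinearEquiv.ofInjective j' hj'
    exact Nat.card_congr
      { toFun := fun s => e.symm.toLinearMap.comp (s.1.codRestrict _ ((h2 s.1).1 s.2))
        invFun := fun g => ⟨j'.comp g, (h2 _).2 fun v => ⟨g v, rfl⟩⟩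
        left_inv := fun s => Subtype.ext (LinearMap.ext fun v =>
          congrArg Subtype.val (e.apply_symm_apply (s.1.codRestrict _ ((h2 s.1).1 s.2) v)))
        right_inv := fun g => LinearMap.ext fun v => e.injective
          ((e.apply_symm_apply _).trans (Subtype.ext rfl)) }

/-- Pairs of a block W and an isomorphism of the block module with M are counted twice: each W of
type τ carries |Aut M| isomorphisms, and by `card_sigma_blockEnd` such a pair is also an embedding
of (U, b) with cokernel of type α together with a lift s. -/
theorem card_blockEnd_mul_autNum [Finite V] [Finite U] [Finite M] {τ α β : Multiset (Q × ℕ)}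
    (hM : HasTy p M τ) {a : V →ₗ[K] V} {b : U →ₗ[K] U} (ha : HasTy p (Module.AEval' a) α)
    (hb : HasTy p (Module.AEval' b) β) :
    Nat.card {W : V →ₗ[K] U // HasTy p (Module.AEval' (blockEnd a b W)) τ} * autNum K[X] M =
      hallNum p M β α * autNum K[X] (Module.AEval' b) *
        (autNum K[X] (Module.AEval' a) * Nat.card (V →ₗ[K] U)) := by
  classical
  have := Fintype.ofFinite (V →ₗ[K] U)
  have := Fintype.ofFinite (Module.AEval' b →ₗ[K[X]] M)
  have hfin : ∀ W : V →ₗ[K] U, Finite (Module.AEval' (blockEnd a b W) ≃ₗ[K[X]] M) := fun W =>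
    Finite.of_injective (fun f => (f : Module.AEval' (blockEnd a b W) →ₗ[K[X]] M))
      LinearEquiv.toLinearMap_injective
  have h1 := card_sigma_blockEnd M a b
  rw [Nat.card_sigma, Nat.card_sigma] at h1
  have h2 : ∀ W : V →ₗ[K] U, Nat.card (Module.AEval' (blockEnd a b W) ≃ₗ[K[X]] M) =
      if HasTy p (Module.AEval' (blockEnd a b W)) τ then autNum K[X] M else 0 := by
    intro W
    split_ifs with hW
    · obtain ⟨e⟩ := hW.nonempty_equiv hM
      rw [card_linearEquiv e, autNum_congr e]
    · rw [Nat.card_eq_zero]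
      exact Or.inl ⟨fun e => hW (hM.of_equiv e.symm)⟩
  have h3 : ∀ j : Module.AEval' b →ₗ[K[X]] M, Nat.card {s : V →ₗ[K] M // IsBlockIso a b j s} =
      if Function.Injective j ∧ HasTy p (M ⧸ LinearMap.range j) α then
        autNum K[X] (Module.AEval' a) * Nat.card (V →ₗ[K] U) else 0 := by
    intro j
    split_ifs with hj
    · exact card_isBlockIso ha b j hj.1 hj.2
    · rw [Nat.card_eq_zero]
      refine Or.inl ⟨fun s => hj ?_⟩
      obtain ⟨h4, h5⟩ := (isBlockIso_iff a b j s.1).1 s.2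
      exact ⟨h4, ha.of_equiv (aevalEquivEquiv a ⟨_, h5⟩)⟩
  rw [Finset.sum_congr rfl fun W _ => h2 W, Finset.sum_congr rfl fun j _ => h3 j,
    ← Finset.sum_filter, ← Finset.sum_filter, Finset.sum_const, Finset.sum_const, smul_eq_mul,
    smul_eq_mul, ← Fintype.card_subtype, ← Fintype.card_subtype, ← Nat.card_eq_fintype_card,
    ← Nat.card_eq_fintype_card, card_embeddings hb] at h1
  exact h1

/-- (V, a) is a quotient and (U, b) a submodule of the block module. So in nonzero terms of the
recursion the diagonal blocks have types, from a finite list independent of the field. -/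
theorem HasTy.exists_blocks (hp : IsPrimeSystem p d q) [Finite V] [Finite U] {a : V →ₗ[K] V}
    {b : U →ₗ[K] U} {W : V →ₗ[K] U} {τ : Multiset (Q × ℕ)}
    (h : HasTy p (Module.AEval' (blockEnd a b W)) τ) :
    (∃ α, typeWt d α ≤ typeWt d τ ∧ HasTy p (Module.AEval' a) α) ∧
      ∃ β, typeWt d β ≤ typeWt d τ ∧ HasTy p (Module.AEval' b) β := by
  classical
  constructor
  · let f : Module.AEval' (blockEnd a b W) →ₗ[K[X]] Module.AEval' a :=
      LinearMap.ofAEval (blockEnd a b W) ((Module.AEval'.of a).toLinearMap.comp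
        (LinearMap.fst K V U)) fun z => (Module.AEval'.X_smul_of a z.1).symm
    have hf : Function.Surjective f := fun v => ⟨Module.AEval'.of _ ((Module.AEval'.of a).symm v, 0),
      rfl⟩
    obtain ⟨α, h1, h2⟩ := h.exists_quotient hp (LinearMap.ker f)
    exact ⟨α, h1, h2.of_equiv (f.quotKerEquivOfSurjective hf)⟩
  · let f : Module.AEval' b →ₗ[K[X]] Module.AEval' (blockEnd a b W) :=
      LinearMap.ofAEval b ((Module.AEval'.of (blockEnd a b W)).toLinearMap.comp
        (LinearMap.inr K V U)) fun u => by
          change Module.AEval'.of (blockEnd a b W) (0, b u) =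
            (X : K[X]) • Module.AEval'.of (blockEnd a b W) (0, u)
          rw [Module.AEval'.X_smul_of, blockEnd_apply, map_zero, map_zero, zero_add]
    have hf : Function.Injective f := fun u u' h =>
      congrArg Prod.snd ((Module.AEval'.of (blockEnd a b W)).injective h)
    obtain ⟨β, h1, h2⟩ := h.exists_submodule hp (LinearMap.range f)
    exact ⟨β, h1, h2.of_equiv (LinearEquiv.ofInjective f hf).symm⟩

/-- Transport of structure: a K-isomorphism θ : V → M is the same as the endomorphism θ⁻¹Xθ of V
together with a K[X]-isomorphism to M. -/
theorem card_end_mul_autNum [Finite V] [Finite M] {τ : Multiset (Q × ℕ)}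
    (hM : HasTy p M τ) :
    Nat.card {a : V →ₗ[K] V // HasTy p (Module.AEval' a) τ} * autNum K[X] M =
      Nat.card (V ≃ₗ[K] M) := by
  classical
  have := Fintype.ofFinite (V →ₗ[K] V)
  have hfin : ∀ a : V →ₗ[K] V, Finite (Module.AEval' a ≃ₗ[K[X]] M) := fun a =>
    Finite.of_injective (fun f => (f : Module.AEval' a →ₗ[K[X]] M))
      LinearEquiv.toLinearMap_injective
  have h2 : ∀ a : V →ₗ[K] V, Nat.card (Module.AEval' a ≃ₗ[K[X]] M) =
      if HasTy p (Module.AEval' a) τ then autNum K[X] M else 0 := by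
    intro a
    split_ifs with ha
    · obtain ⟨e⟩ := ha.nonempty_equiv hM
      rw [card_linearEquiv e, autNum_congr e]
    · rw [Nat.card_eq_zero]
      exact Or.inl ⟨fun e => ha (hM.of_equiv e.symm)⟩
  let f : (Σ a : V →ₗ[K] V, Module.AEval' a ≃ₗ[K[X]] M) → (V ≃ₗ[K] M) := fun z =>
    LinearEquiv.ofBijective _ ((aevalEquivEquiv z.1).symm z.2).2.2
  have hf : Function.Bijective f := by
    constructor
    · rintro ⟨a, e⟩ ⟨a', e'⟩ h
      have h3 : ∀ v, e (Module.AEval'.of a v) = e' (Module.AEval'.of a' v) := fun v =>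
        LinearEquiv.congr_fun h v
      have h4 : a = a' := by
        refine LinearMap.ext fun v => ?_
        have h5 := ((aevalEquivEquiv a).symm e).2.1 v
        have h6 := ((aevalEquivEquiv a').symm e').2.1 v
        change e (Module.AEval'.of a (a v)) = (X : K[X]) • e (Module.AEval'.of a v) at h5
        change e' (Module.AEval'.of a' (a' v)) = (X : K[X]) • e' (Module.AEval'.of a' v) at h6
        rw [← h3, ← h3, ← h5] at h6
        exact (e.injective h6).symm
      subst h4
      have h5 : e = e' := LinearEquiv.ext h3
      rw [h5]
    · intro θ
      let a : V →ₗ[K] V := θ.symm.toLinearMap.comp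
        ((Algebra.lsmul K K M (X : K[X])).comp θ.toLinearMap)
      exact ⟨⟨a, aevalEquivEquiv a ⟨θ.toLinearMap, fun v => θ.apply_symm_apply _, θ.bijective⟩⟩,
        LinearEquiv.ext fun _ => rfl⟩
  rw [← Nat.card_congr (Equiv.ofBijective f hf), Nat.card_sigma,
    Finset.sum_congr rfl fun a _ => h2 a, ← Finset.sum_filter, Finset.sum_const, smul_eq_mul,
    ← Fintype.card_subtype, ← Nat.card_eq_fintype_card]

end BlockCount

/-! ### Counting block triangular matrices -/

section MatrixTypes

variable {Q : Type} {K : Type w} [Field K] {p : Q → K[X]} {n m : Type} [Fintype n] [DecidableEq n]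
  [Fintype m] [DecidableEq m]

/-- The `K[X]`-module defined by the matrix `A` is of type `ν`. -/
def MatTy (p : Q → K[X]) (A : Matrix n n K) (ν : Multiset (Q × ℕ)) : Prop :=
  HasTy p (Module.AEval' (Matrix.toLin' A)) ν

theorem matTy_submatrix (e : m ≃ n) (A : Matrix n n K) (ν : Multiset (Q × ℕ)) :
    MatTy p (A.submatrix e e) ν ↔ MatTy p A ν := by
  obtain ⟨f⟩ := nonempty_aeval_equiv_iff (LinearEquiv.funCongrLeft K K e.symm)
    (Matrix.toLin' (A.submatrix e e)) (Matrix.toLin' A) (fun v => by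
      ext i
      simp only [LinearEquiv.funCongrLeft_apply, LinearMap.funLeft_apply, Matrix.toLin'_apply,
        Matrix.mulVec, dotProduct, Matrix.submatrix_apply, Equiv.apply_symm_apply]
      exact Fintype.sum_equiv e _ _ fun x => by rw [Equiv.symm_apply_apply])
  exact hasTy_congr f

theorem matTy_fromBlocks_lower (A : Matrix n n K) (B : Matrix m m K) (W : Matrix m n K)
    (ν : Multiset (Q × ℕ)) : MatTy p (Matrix.fromBlocks A 0 W B) ν ↔
      HasTy p (Module.AEval' (blockEnd (Matrix.toLin' A) (Matrix.toLin' B) (Matrix.toLin' W))) ν := by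
  obtain ⟨f⟩ := nonempty_aeval_equiv_iff (LinearEquiv.sumArrowLequivProdArrow n m K K)
    (Matrix.toLin' (Matrix.fromBlocks A 0 W B))
    (blockEnd (Matrix.toLin' A) (Matrix.toLin' B) (Matrix.toLin' W)) (fun v => by
      refine Prod.ext (funext fun i => ?_) (funext fun i => ?_)
      · simp [Matrix.fromBlocks_mulVec, Function.comp_def]
        rfl
      · simp [Matrix.fromBlocks_mulVec, Function.comp_def]
        rfl)
  exact hasTy_congr f

/-- Exchanging the two summands makes the matrix lower triangular; the roles of submodule and
quotient are exchanged with them. -/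
theorem matTy_fromBlocks_upper (A : Matrix n n K) (B : Matrix m m K) (W : Matrix n m K)
    (ν : Multiset (Q × ℕ)) : MatTy p (Matrix.fromBlocks A W 0 B) ν ↔
      HasTy p (Module.AEval' (blockEnd (Matrix.toLin' B) (Matrix.toLin' A) (Matrix.toLin' W))) ν := by
  rw [← matTy_fromBlocks_lower, ← matTy_submatrix (Equiv.sumComm m n)]
  simp

end MatrixTypes

/-! ### Numbers of matrices of a given type -/

section MatrixCounts

variable {Q : Type} [Fintype Q] [DecidableEq Q] {K : Type w} [Field K] [Finite K] {p : Q → K[X]}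
  {d : Q → ℕ} {q : ℕ} {n m : Type} [Fintype n] [DecidableEq n] [Fintype m] [DecidableEq m]

theorem card_matrix_blockEnd_mul (hp : IsPrimeSystem p d q) {τ α β : Multiset (Q × ℕ)}
    {A : Matrix n n K} {B : Matrix m m K} (hA : MatTy p A α) (hB : MatTy p B β) :
    Nat.card {W : Matrix m n K // HasTy p (Module.AEval'
      (blockEnd (Matrix.toLin' A) (Matrix.toLin' B) (Matrix.toLin' W))) τ} *
        autNum K[X] (StdModule p τ) =
      hallNum p (StdModule p τ) β α * autNum K[X] (StdModule p β) *
        (autNum K[X] (StdModule p α) * Nat.card K ^ (Fintype.card m * Fintype.card n)) := by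
  have := (hasTy_stdModule (p := p) τ).finite hp
  obtain ⟨eA⟩ := (hasTy_stdModule α).nonempty_equiv hA
  obtain ⟨eB⟩ := (hasTy_stdModule β).nonempty_equiv hB
  have h1 := card_blockEnd_mul_autNum (hasTy_stdModule (p := p) τ) hA hB
  rw [← autNum_congr eA, ← autNum_congr eB,
    ← Nat.card_congr (Matrix.toLin' (R := K) (m := m) (n := n)).toEquiv] at h1
  have h2 : Nat.card (Matrix m n K) = Nat.card K ^ (Fintype.card m * Fintype.card n) := by
    rw [Matrix, Nat.card_fun, Nat.card_fun, ← pow_mul, mul_comm, Nat.card_eq_fintype_card (α := m),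
      Nat.card_eq_fintype_card (α := n)]
  rw [h2] at h1
  rw [← h1]
  congr 1
  exact Nat.card_congr ((Matrix.toLin' (R := K) (m := m) (n := n)).toEquiv.subtypeEquiv
    fun _ => Iff.rfl)

theorem card_linearEquiv_of_card_eq {V M : Type w} [AddCommGroup V] [Module K V] [AddCommGroup M]
    [Module K M] [Finite V] [Finite M] (h : Nat.card V = Nat.card M) :
    Nat.card (V ≃ₗ[K] M) = Nat.card (V ≃ₗ[K] V) := by
  have h1 : Module.finrank K V = Module.finrank K M := by
    rw [Module.natCard_eq_pow_finrank (K := K), Module.natCard_eq_pow_finrank (K := K) (V := M)] at h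
    exact Nat.pow_right_injective Finite.one_lt_card h
  exact card_linearEquiv (LinearEquiv.ofFinrankEq V M h1)

/-- By `card_end_mul_autNum` this counts K-isomorphisms from K^n to the standard module: |GL_n(K)|
of them if the dimensions agree, none otherwise. -/
theorem card_matrix_matTy_mul (hp : IsPrimeSystem p d (Nat.card K)) (n : ℕ)
    (α : Multiset (Q × ℕ)) :
    Nat.card {A : Matrix (Fin n) (Fin n) K // MatTy p A α} * autNum K[X] (StdModule p α) =
      if typeWt d α = n then ∏ i : Fin n, (Nat.card K ^ n - Nat.card K ^ (i : ℕ)) else 0 := by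
  classical
  have := Fintype.ofFinite K
  have hα := hasTy_stdModule (p := p) α
  have := hα.finite hp
  have h1 := card_end_mul_autNum (V := Fin n → K) hα
  have h0 : Nat.card {A : Matrix (Fin n) (Fin n) K // MatTy p A α} =
      Nat.card {a : (Fin n → K) →ₗ[K] (Fin n → K) // HasTy p (Module.AEval' a) α} :=
    Nat.card_congr ((Matrix.toLin' (R := K) (m := Fin n) (n := Fin n)).toEquiv.subtypeEquiv
      fun _ => Iff.rfl)
  rw [h0, h1]
  have hV : Nat.card (Fin n → K) = Nat.card K ^ n := by
    rw [Nat.card_fun, Nat.card_eq_fintype_card (α := Fin n), Fintype.card_fin]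
  split_ifs with hn
  · rw [card_linearEquiv_of_card_eq (by rw [hV, hα.card_eq hp, hn])]
    have h2 := Matrix.card_GL_field (𝔽 := K) n
    rw [← Nat.card_eq_fintype_card] at h2
    rw [← h2]
    exact Nat.card_congr ((LinearMap.GeneralLinearGroup.generalLinearEquiv K _).symm.trans
      Matrix.GeneralLinearGroup.toLin.symm).toEquiv
  · rw [Nat.card_eq_zero]
    refine Or.inl ⟨fun e => hn ?_⟩
    have h2 := Nat.card_congr e.toEquiv
    rw [hV, hα.card_eq hp] at h2
    exact (hp.pow_injective h2).symm

end MatrixCounts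

/-! ### Splitting off the first diagonal block -/

section Split

variable {r : ℕ} {K : Type w} [Field K]

theorem isBlockPair_iff {u : Fin r → ℕ} {Y Z : Matrix (BlockIdx u) (BlockIdx u) K} :
    IsBlockPair Y Z ↔ (∀ x y, x.1 < y.1 → Y x y = 0) ∧ (∀ x y, y.1 < x.1 → Z x y = 0) ∧
      ∀ i a b, Y ⟨i, a⟩ ⟨i, b⟩ = Z ⟨i, a⟩ ⟨i, b⟩ := by
  refine and_congr ?_ (and_congr ?_ ?_)
  · exact ⟨fun h x y hxy => congrFun (congrFun (h x.1 y.1 hxy) x.2) y.2,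
      fun h i j hij => Matrix.ext fun a b => h ⟨i, a⟩ ⟨j, b⟩ hij⟩
  · exact ⟨fun h x y hxy => congrFun (congrFun (h x.1 y.1 hxy) x.2) y.2,
      fun h i j hij => Matrix.ext fun a b => h ⟨i, a⟩ ⟨j, b⟩ hij⟩
  · exact ⟨fun h i a b => congrFun (congrFun (h i) a) b, fun h i => Matrix.ext fun a b => h i a b⟩

/-- The index set with the first block split off. -/
def blockIdxEquiv (u : Fin (r + 1) → ℕ) :
    BlockIdx u ≃ Fin (u 0) ⊕ BlockIdx fun i : Fin r => u i.succ where
  toFun x := Fin.cases (motive := fun i => Fin (u i) → Fin (u 0) ⊕ BlockIdx fun i : Fin r => u i.succ)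
    (fun a => Sum.inl a) (fun i a => Sum.inr ⟨i, a⟩) x.1 x.2
  invFun := Sum.elim (fun a => ⟨0, a⟩) fun x => ⟨x.1.succ, x.2⟩
  left_inv := by
    rintro ⟨i, a⟩
    refine Fin.cases (fun a => rfl) (fun i a => rfl) i a
  right_inv := by rintro (a | ⟨i, a⟩) <;> rfl

theorem isBlockPair_fromBlocks_iff (u : Fin (r + 1) → ℕ) {A A' : Matrix (Fin (u 0)) (Fin (u 0)) K}
    {W₁ W₁' : Matrix (BlockIdx fun i : Fin r => u i.succ) (Fin (u 0)) K}
    {W₂ W₂' : Matrix (Fin (u 0)) (BlockIdx fun i : Fin r => u i.succ) K}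
    {Y Z : Matrix (BlockIdx fun i : Fin r => u i.succ) (BlockIdx fun i : Fin r => u i.succ) K} :
    IsBlockPair ((Matrix.fromBlocks A W₂' W₁ Y).submatrix (blockIdxEquiv u) (blockIdxEquiv u))
      ((Matrix.fromBlocks A' W₂ W₁' Z).submatrix (blockIdxEquiv u) (blockIdxEquiv u)) ↔
      W₂' = 0 ∧ W₁' = 0 ∧ A = A' ∧ IsBlockPair Y Z := by
  rw [isBlockPair_iff, isBlockPair_iff]
  constructor
  · rintro ⟨h1, h2, h3⟩
    refine ⟨?_, ?_, ?_, ?_, ?_, ?_⟩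
    · ext a ⟨i, b⟩
      exact h1 ⟨0, a⟩ ⟨i.succ, b⟩ (Fin.succ_pos i)
    · ext ⟨i, b⟩ a
      exact h2 ⟨i.succ, b⟩ ⟨0, a⟩ (Fin.succ_pos i)
    · ext a b
      exact h3 0 a b
    · rintro ⟨i, a⟩ ⟨j, b⟩ hij
      exact h1 ⟨i.succ, a⟩ ⟨j.succ, b⟩ (Fin.succ_lt_succ_iff.2 hij)
    · rintro ⟨i, a⟩ ⟨j, b⟩ hij
      exact h2 ⟨i.succ, a⟩ ⟨j.succ, b⟩ (Fin.succ_lt_succ_iff.2 hij)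
    · intro i a b
      exact h3 i.succ a b
  · rintro ⟨rfl, rfl, rfl, h1, h2, h3⟩
    refine ⟨?_, ?_, ?_⟩
    · rintro ⟨i, a⟩ ⟨j, b⟩ hij
      dsimp only at hij
      induction i using Fin.cases with
      | zero =>
        induction j using Fin.cases with
        | zero => exact absurd hij (lt_irrefl _)
        | succ j => rfl
      | succ i =>
        induction j using Fin.cases with
        | zero => exact absurd hij (Fin.not_lt_zero _)
        | succ j => exact h1 ⟨i, a⟩ ⟨j, b⟩ (Fin.succ_lt_succ_iff.1 hij)
    · rintro ⟨i, a⟩ ⟨j, b⟩ hij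
      dsimp only at hij
      induction i using Fin.cases with
      | zero => exact absurd hij (Fin.not_lt_zero _)
      | succ i =>
        induction j using Fin.cases with
        | zero => rfl
        | succ j => exact h2 ⟨i, a⟩ ⟨j, b⟩ (Fin.succ_lt_succ_iff.1 hij)
    · intro i
      induction i using Fin.cases with
      | zero => exact fun a b => rfl
      | succ i => exact fun a b => h3 i a b

/-- The pairs of block triangular matrices with a given diagonal block and a given remaining
part. -/
noncomputable def blockPairEquiv (u : Fin (r + 1) → ℕ)
    (T₁ T₂ : Matrix (BlockIdx u) (BlockIdx u) K → Prop) :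
    {g : Matrix (BlockIdx u) (BlockIdx u) K × Matrix (BlockIdx u) (BlockIdx u) K //
      IsBlockPair g.1 g.2 ∧ T₁ g.1 ∧ T₂ g.2} ≃
    Σ x : Matrix (Fin (u 0)) (Fin (u 0)) K ×
        {g : Matrix (BlockIdx fun i : Fin r => u i.succ) (BlockIdx fun i : Fin r => u i.succ) K ×
          Matrix (BlockIdx fun i : Fin r => u i.succ) (BlockIdx fun i : Fin r => u i.succ) K //
          IsBlockPair g.1 g.2},
      {W : Matrix (BlockIdx fun i : Fin r => u i.succ) (Fin (u 0)) K //
        T₁ ((Matrix.fromBlocks x.1 0 W x.2.1.1).submatrix (blockIdxEquiv u) (blockIdxEquiv u))} ×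
      {W : Matrix (Fin (u 0)) (BlockIdx fun i : Fin r => u i.succ) K //
        T₂ ((Matrix.fromBlocks x.1 W 0 x.2.1.2).submatrix (blockIdxEquiv u) (blockIdxEquiv u))} := by
  let e := blockIdxEquiv u
  refine (Equiv.ofBijective (fun z => ⟨((Matrix.fromBlocks z.1.1 0 z.2.1.1 z.1.2.1.1).submatrix e e,
    (Matrix.fromBlocks z.1.1 z.2.2.1 0 z.1.2.1.2).submatrix e e),
    (isBlockPair_fromBlocks_iff u).2 ⟨rfl, rfl, rfl, z.1.2.2⟩, z.2.1.2, z.2.2.2⟩) ⟨?_, ?_⟩).symm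
  · rintro ⟨⟨A, ⟨Y, Z⟩, h1⟩, ⟨W, h2⟩, ⟨W', h3⟩⟩ ⟨⟨A', ⟨Y', Z'⟩, h1'⟩, ⟨V, h2'⟩, ⟨V', h3'⟩⟩ h
    have h4 := congrArg (fun t => (t.1.1.submatrix e.symm e.symm, t.1.2.submatrix e.symm e.symm)) h
    simp only [Matrix.submatrix_submatrix, Equiv.self_comp_symm, Matrix.submatrix_id_id,
      Prod.mk.injEq, Matrix.fromBlocks_inj] at h4
    obtain ⟨⟨rfl, -, rfl, rfl⟩, -, rfl, -, rfl⟩ := h4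
    rfl
  · rintro ⟨⟨Y, Z⟩, h1, h2, h3⟩
    dsimp only at h1 h2 h3
    have key : ∀ N : Matrix (BlockIdx u) (BlockIdx u) K, ∃ A B C D,
        N = (Matrix.fromBlocks A B C D).submatrix e e := fun N => ⟨_, _, _, _, by
      rw [Matrix.fromBlocks_toBlocks (N.submatrix e.symm e.symm), Matrix.submatrix_submatrix,
        Equiv.symm_comp_self, Matrix.submatrix_id_id]⟩
    obtain ⟨A, B, C, D, rfl⟩ := key Y
    obtain ⟨A', B', C', D', rfl⟩ := key Z
    obtain ⟨rfl, rfl, rfl, h4⟩ := (isBlockPair_fromBlocks_iff u).1 h1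
    exact ⟨⟨⟨A, ⟨(D, D'), h4⟩⟩, ⟨C, h2⟩, ⟨B', h3⟩⟩, rfl⟩

end Split

/-! ### The recursion for pairs of block triangular matrices -/

section PairCount

variable {Q : Type} [Fintype Q] [DecidableEq Q] {d : Q → ℕ}

/-- The number of pairs of block triangular matrices with equal diagonal blocks and given types. -/
noncomputable def pairCount {K : Type w} [Field K] (p : Q → K[X]) {r : ℕ} (u : Fin r → ℕ)
    (τ₁ τ₂ : Multiset (Q × ℕ)) : ℕ :=
  Nat.card {g : Matrix (BlockIdx u) (BlockIdx u) K × Matrix (BlockIdx u) (BlockIdx u) K //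
    IsBlockPair g.1 g.2 ∧ MatTy p g.1 τ₁ ∧ MatTy p g.2 τ₂}

/-- A variant of `sum_eq_sum_card_mul` for matrices that may have no type over the given
polynomials; the summand vanishes there. -/
theorem sum_eq_sum_card_mul_of_partial {α β : Type*} [Fintype α] (S : Finset β) (T : α → β → Prop)
    (hu : ∀ a b b', T a b → T a b' → b = b') (f : α → ℚ) (g : β → ℚ)
    (h : ∀ a, ∀ b ∈ S, T a b → f a = g b) (h0 : ∀ a, f a ≠ 0 → ∃ b ∈ S, T a b) :
    ∑ a, f a = ∑ b ∈ S, (Nat.card {a // T a b} : ℚ) * g b := by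
  classical
  have h1 : ∀ b, (Nat.card {a // T a b} : ℚ) * g b = ∑ a, if T a b then g b else 0 := fun b => by
    rw [← Finset.sum_filter, Finset.sum_const, nsmul_eq_mul, Nat.card_eq_fintype_card,
      Fintype.card_subtype]
  rw [Finset.sum_congr rfl fun b _ => h1 b, Finset.sum_comm]
  refine Finset.sum_congr rfl fun a _ => ?_
  by_cases ha : ∃ b ∈ S, T a b
  · obtain ⟨b, hb, hab⟩ := ha
    rw [Finset.sum_eq_single b, if_pos hab, h a b hb hab]
    · intro b' _ hb'
      rw [if_neg fun h' => hb' (hu a _ _ h' hab)]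
    · exact fun h' => (h' hb).elim
  · rw [Finset.sum_eq_zero]
    · by_contra hf
      exact ha (h0 a hf)
    · intro b hb
      rw [if_neg fun h' => ha ⟨b, hb, h'⟩]

/-- The number of block triangular matrices of type `τ` with diagonal blocks of types `α`, `β` and
`k` entries in the lower block. -/
noncomputable def blockNum (ω : PolySystem.{w} d) (k : ℕ) (α β τ : Multiset (Q × ℕ)) : ℚ :=
  (hallNum ω.F (StdModule ω.F τ) β α : ℚ) * autNum ω.K[X] (StdModule ω.F β) *
    (autNum ω.K[X] (StdModule ω.F α) * (ω.q : ℚ) ^ k) / autNum ω.K[X] (StdModule ω.F τ)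

theorem PolySystem.autNum_ne_zero (ω : PolySystem.{w} d) (ν : Multiset (Q × ℕ)) :
    (autNum ω.K[X] (StdModule ω.F ν) : ℚ) ≠ 0 := by
  have := (hasTy_stdModule (p := ω.F) ν).finite ω.isPrimeSystem
  exact Nat.cast_ne_zero.2 autNum_pos.ne'

theorem isRationalIn_blockNum (k : ℕ) (α β τ : Multiset (Q × ℕ)) :
    IsRationalIn PolySystem.q fun ω : PolySystem.{w} d => blockNum ω k α β τ :=
  (((isRationalIn_hallNum d _ _ _).mul (isRationalIn_autNum d _)).mul
    ((isRationalIn_autNum d _).mul (IsRationalIn.pow_card k))).div (isRationalIn_autNum d _)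
    fun ω => ω.autNum_ne_zero τ

theorem card_blockEnd_eq_blockNum (ω : PolySystem.{w} d) {n m : Type} [Fintype n] [DecidableEq n]
    [Fintype m] [DecidableEq m] {τ α β : Multiset (Q × ℕ)}
    {A : Matrix n n ω.K} {B : Matrix m m ω.K} (hA : MatTy ω.F A α) (hB : MatTy ω.F B β) :
    (Nat.card {W : Matrix m n ω.K // HasTy ω.F (Module.AEval'
      (blockEnd (Matrix.toLin' A) (Matrix.toLin' B) (Matrix.toLin' W))) τ} : ℚ) =
      blockNum ω (Fintype.card m * Fintype.card n) α β τ := by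
  rw [blockNum, eq_div_iff (ω.autNum_ne_zero τ)]
  exact_mod_cast card_matrix_blockEnd_mul (τ := τ) ω.isPrimeSystem hA hB

theorem isRationalIn_card_matTy (n : ℕ) (α : Multiset (Q × ℕ)) :
    IsRationalIn PolySystem.q fun ω : PolySystem.{w} d =>
      (Nat.card {A : Matrix (Fin n) (Fin n) ω.K // MatTy ω.F A α} : ℚ) := by
  have h1 : ∀ ω : PolySystem.{w} d,
      (Nat.card {A : Matrix (Fin n) (Fin n) ω.K // MatTy ω.F A α} : ℚ) =
      (if typeWt d α = n then ∏ i : Fin n, ((ω.q : ℚ) ^ n - (ω.q : ℚ) ^ (i : ℕ)) else 0) /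
        autNum ω.K[X] (StdModule ω.F α) := fun ω => by
    rw [eq_div_iff (ω.autNum_ne_zero α)]
    have h2 := congrArg (Nat.cast (R := ℚ)) (card_matrix_matTy_mul ω.isPrimeSystem n α)
    rw [Nat.cast_mul] at h2
    rw [h2]
    split_ifs with hn
    · rw [Nat.cast_prod]
      refine Finset.prod_congr rfl fun i _ => ?_
      rw [Nat.cast_sub (Nat.pow_le_pow_right Nat.card_pos i.2.le), Nat.cast_pow, Nat.cast_pow]
      rfl
    · rfl
  simp only [h1]
  refine IsRationalIn.div ?_ (isRationalIn_autNum d α) fun ω => ω.autNum_ne_zero α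
  split_ifs with hn
  · exact IsRationalIn.prod _ fun i _ => (IsRationalIn.pow_card _).sub (IsRationalIn.pow_card _)
  · exact IsRationalIn.const 0

/-- The triple t lists the types of the common first block A and of the remaining parts of Y and Z.
In Y the block A gives the quotient, in Z the submodule, which explains the different order of
arguments in the two `blockNum` factors. -/
theorem pairCount_succ (ω : PolySystem.{w} d) {r : ℕ} (u : Fin (r + 1) → ℕ)
    (τ₁ τ₂ : Multiset (Q × ℕ)) :
    (pairCount ω.F u τ₁ τ₂ : ℚ) =
      ∑ t ∈ typesLE Q (typeWt d τ₁ + typeWt d τ₂) ×ˢ typesLE Q (typeWt d τ₁ + typeWt d τ₂) ×ˢ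
          typesLE Q (typeWt d τ₁ + typeWt d τ₂),
        ((Nat.card {A : Matrix (Fin (u 0)) (Fin (u 0)) ω.K // MatTy ω.F A t.1} : ℚ) *
          pairCount ω.F (fun i : Fin r => u i.succ) t.2.1 t.2.2) *
        (blockNum ω (Fintype.card (BlockIdx fun i : Fin r => u i.succ) * u 0) t.1 t.2.1 τ₁ *
          blockNum ω (u 0 * Fintype.card (BlockIdx fun i : Fin r => u i.succ)) t.2.2 t.1 τ₂) := by
  classical
  have hp := ω.isPrimeSystem
  have := Fintype.ofFinite ω.K
  rw [pairCount, Nat.card_congr (blockPairEquiv u (fun Y => MatTy ω.F Y τ₁)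
    fun Z => MatTy ω.F Z τ₂), Nat.card_sigma, Nat.cast_sum]
  simp only [Nat.card_prod, matTy_submatrix, matTy_fromBlocks_lower, matTy_fromBlocks_upper]
  rw [sum_eq_sum_card_mul_of_partial (typesLE Q (typeWt d τ₁ + typeWt d τ₂) ×ˢ
      typesLE Q (typeWt d τ₁ + typeWt d τ₂) ×ˢ typesLE Q (typeWt d τ₁ + typeWt d τ₂))
    (fun x t => MatTy ω.F x.1 t.1 ∧ MatTy ω.F x.2.1.1 t.2.1 ∧ MatTy ω.F x.2.1.2 t.2.2)
    ?_ _ (fun t => blockNum ω (Fintype.card (BlockIdx fun i : Fin r => u i.succ) * u 0)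
      t.1 t.2.1 τ₁ * blockNum ω (u 0 * Fintype.card (BlockIdx fun i : Fin r => u i.succ))
        t.2.2 t.1 τ₂)]
  · refine Finset.sum_congr rfl fun t _ => congrArg (· * _) ?_
    rw [← Nat.cast_mul, pairCount, ← Nat.card_prod]
    refine congrArg Nat.cast (Nat.card_congr ?_)
    exact
      { toFun := fun x => (⟨x.1.1, x.2.1⟩, ⟨x.1.2.1, x.1.2.2, x.2.2⟩)
        invFun := fun y => ⟨(y.1.1, ⟨y.2.1, y.2.2.1⟩), y.1.2, y.2.2.2⟩
        left_inv := fun _ => rfl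
        right_inv := fun _ => rfl }
  · rintro ⟨A, ⟨Y, Z⟩, h⟩ ⟨α, β, γ⟩ - ⟨h1, h2, h3⟩
    rw [Nat.cast_mul, card_blockEnd_eq_blockNum ω h1 h2, card_blockEnd_eq_blockNum ω h3 h1,
      Fintype.card_fin]
  · rintro ⟨A, ⟨Y, Z⟩, h⟩ h1
    rw [Nat.cast_ne_zero, mul_ne_zero_iff, Nat.card_ne_zero, Nat.card_ne_zero] at h1
    obtain ⟨⟨⟨W, hW⟩, -⟩, ⟨W', hW'⟩, -⟩ := h1
    obtain ⟨⟨α, h2, h3⟩, β, h4, h5⟩ := hW.exists_blocks hp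
    obtain ⟨⟨γ, h6, h7⟩, -⟩ := hW'.exists_blocks hp
    refine ⟨(α, β, γ), ?_, h3, h5, h7⟩
    simp only [Finset.mem_product]
    exact ⟨mem_typesLE hp.deg_pos (by omega), mem_typesLE hp.deg_pos (by omega),
      mem_typesLE hp.deg_pos (by omega)⟩
  · rintro x ⟨α, β, γ⟩ ⟨α', β', γ'⟩ ⟨h1, h2, h3⟩ ⟨h1', h2', h3'⟩
    exact Prod.ext (HasTy.eq hp h1 h1') (Prod.ext (HasTy.eq hp h2 h2') (HasTy.eq hp h3 h3'))

theorem isRationalIn_pairCount {r : ℕ} (u : Fin r → ℕ) (τ₁ τ₂ : Multiset (Q × ℕ)) :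
    IsRationalIn PolySystem.q fun ω : PolySystem.{w} d => (pairCount ω.F u τ₁ τ₂ : ℚ) := by
  induction r generalizing τ₁ τ₂ with
  | zero =>
    have h0 : ∀ (ω : PolySystem.{w} d) (A : Matrix (BlockIdx u) (BlockIdx u) ω.K)
        (τ : Multiset (Q × ℕ)), MatTy ω.F A τ ↔ τ = 0 := by
      intro ω A τ
      have : Subsingleton (Module.AEval' (Matrix.toLin' A)) :=
        inferInstanceAs (Subsingleton (BlockIdx u → ω.K))
      have h1 : HasTy ω.F (Module.AEval' (Matrix.toLin' A)) (0 : Multiset (Q × ℕ)) :=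
        hasTy_of_subsingleton
      exact ⟨fun h => HasTy.eq ω.isPrimeSystem h h1, fun h => h ▸ h1⟩
    by_cases h : τ₁ = 0 ∧ τ₂ = 0
    · have h1 : ∀ ω : PolySystem.{w} d, pairCount ω.F u τ₁ τ₂ = 1 := fun ω => by
        rw [pairCount, Nat.card_eq_one_iff_unique]
        refine ⟨inferInstance, ⟨⟨(0, 0), ?_, (h0 _ _ _).2 h.1, (h0 _ _ _).2 h.2⟩⟩⟩
        exact ⟨fun i => i.elim0, fun i => i.elim0, fun i => i.elim0⟩
      simp only [h1]
      exact IsRationalIn.const _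
    · have h1 : ∀ ω : PolySystem.{w} d, pairCount ω.F u τ₁ τ₂ = 0 := fun ω => by
        rw [pairCount, Nat.card_eq_zero]
        exact Or.inl ⟨fun g => h ⟨(h0 _ _ _).1 g.2.2.1, (h0 _ _ _).1 g.2.2.2⟩⟩
      simp only [h1]
      exact IsRationalIn.const _
  | succ r ih =>
    simp only [pairCount_succ]
    exact IsRationalIn.sum _ fun t _ => ((isRationalIn_card_matTy _ _).mul (ih _ _ _)).mul
      ((isRationalIn_blockNum _ _ _ _).mul (isRationalIn_blockNum _ _ _ _))

end PairCount

/-! ### Integer-valued rational functions -/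

section IntegerValued

theorem exists_eval_eq_of_finite {S : Set ℕ} (hS : S.Finite) (f : ℕ → ℚ) :
    ∃ P : ℚ[X], ∀ x ∈ S, P.eval (x : ℚ) = f x :=
  ⟨Lagrange.interpolate hS.toFinset (fun x : ℕ => (x : ℚ)) f, fun _ hx =>
    Lagrange.eval_interpolate_at_node f (Nat.cast_injective.injOn) (hS.mem_toFinset.2 hx)⟩

/-- Clear the denominators of the polynomial quotient N / D with an integer c. On S the number c·(N
% D)/D is then an integer, and it tends to 0 by degree, so N % D vanishes at all large elements of S
and hence identically. -/
theorem mod_eq_zero_of_integer_valued {N D : ℚ[X]} {S : Set ℕ} (hS : S.Infinite)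
    (h : ∀ x ∈ S, D.eval (x : ℚ) ≠ 0 ∧ ∃ z : ℤ, (z : ℚ) * D.eval (x : ℚ) = N.eval (x : ℚ)) :
    N % D = 0 := by
  obtain ⟨x₀, hx₀⟩ := hS.nonempty
  have hD : D ≠ 0 := by
    rintro rfl
    exact (h x₀ hx₀).1 eval_zero
  obtain ⟨c, hcm, hc⟩ := IsLocalization.integerNormalization_spec (nonZeroDivisors ℤ) (N / D)
  set G := IsLocalization.integerNormalization (nonZeroDivisors ℤ) (N / D)
  have hc0 : ((c : ℤ) : ℚ) ≠ 0 := by exact_mod_cast nonZeroDivisors.ne_zero hcm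
  have hG : ∀ x : ℕ, ((c : ℤ) : ℚ) * (N / D).eval (x : ℚ) = ((G.eval (x : ℤ) : ℤ) : ℚ) := fun x => by
    have h1 := congrArg (eval (x : ℚ)) hc
    have h2 : eval (x : ℚ) (G.map (algebraMap ℤ ℚ)) = ((G.eval (x : ℤ) : ℤ) : ℚ) := by
      simp
    rw [h2] at h1
    rw [h1, eval_smul, zsmul_eq_mul]
  have hdeg : (N % D).degree < D.degree := EuclideanDomain.mod_lt N hD
  have ht := (Polynomial.div_tendsto_atTop_zero_of_degree_lt (N % D) D hdeg).comp
    (tendsto_natCast_atTop_atTop (R := ℚ))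
  have ht2 := ht.const_mul ((c : ℤ) : ℚ)
  rw [mul_zero] at ht2
  have hev := ht2.eventually (eventually_abs_sub_lt (0 : ℚ) one_pos)
  obtain ⟨B, hB⟩ := Filter.eventually_atTop.1 hev
  refine Polynomial.eq_zero_of_infinite_isRoot _ (((hS.sdiff (Set.finite_lt_nat B)).image
    (Nat.cast_injective (R := ℚ)).injOn).mono ?_)
  rintro _ ⟨x, ⟨hx, hxB⟩, rfl⟩
  obtain ⟨h1, z, hz⟩ := h x hx
  have h2 := hB x (not_lt.1 hxB)
  have h3 : N.eval (x : ℚ) = D.eval (x : ℚ) * (N / D).eval (x : ℚ) + (N % D).eval (x : ℚ) := by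
    rw [← eval_mul, ← eval_add, EuclideanDomain.div_add_mod]
  have h4 : ((c : ℤ) : ℚ) * ((N % D).eval (x : ℚ) / D.eval (x : ℚ)) =
      (((c : ℤ) * z - G.eval (x : ℤ) : ℤ) : ℚ) := by
    push_cast
    rw [← hG]
    field_simp
    linear_combination -h3 - hz
  change |((c : ℤ) : ℚ) * ((N % D).eval (x : ℚ) / D.eval (x : ℚ)) - 0| < 1 at h2
  rw [sub_zero, h4, ← Int.cast_abs, ← Int.cast_one, Int.cast_lt, Int.abs_lt_one_iff] at h2
  rw [h2, Int.cast_zero, mul_eq_zero, div_eq_zero_iff] at h4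
  exact (h4.resolve_left hc0).resolve_right h1

/-- Polynomials of the required degrees need not exist over every field, so the set of q that occur
is arbitrary; if it is finite the divisibility argument fails and interpolation replaces it. -/
theorem IsRationalIn.exists_polynomial {Ω : Type*} {q : Ω → ℕ} {n : Ω → ℕ}
    (h : IsRationalIn q fun ω => (n ω : ℚ)) : ∃ P : ℚ[X], ∀ ω, (n ω : ℚ) = P.eval (q ω : ℚ) := by
  obtain ⟨N, D, h⟩ := h
  by_cases hS : (Set.range q).Finite
  · obtain ⟨P, hP⟩ := exists_eval_eq_of_finite hS fun x => N.eval (x : ℚ) / D.eval (x : ℚ)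
    exact ⟨P, fun ω => by rw [hP _ ⟨ω, rfl⟩, eq_div_iff (h ω).1, (h ω).2]⟩
  · have h1 : N % D = 0 := mod_eq_zero_of_integer_valued hS (by
      rintro _ ⟨ω, rfl⟩
      exact ⟨(h ω).1, (n ω : ℤ), by exact_mod_cast (h ω).2⟩)
    refine ⟨N / D, fun ω => ?_⟩
    have h2 := (h ω).2
    conv_rhs at h2 => rw [← EuclideanDomain.div_add_mod N D, h1, add_zero, eval_mul, mul_comm]
    exact mul_right_cancel₀ (h ω).1 h2

end IntegerValued

/-! ### The uniform family -/

section Uniform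

/-- A K[X]-isomorphism between the two modules is an invertible matrix that intertwines A and B. -/
theorem nonempty_aeval_equiv_iff_conj {K : Type w} [Field K] {n : Type} [Fintype n] [DecidableEq n]
    (A : GL n K) (B : Matrix n n K) :
    Nonempty (Module.AEval' (Matrix.toLin' (A : Matrix n n K)) ≃ₗ[K[X]]
      Module.AEval' (Matrix.toLin' B)) ↔ ∃ c : GL n K, B = (c * A * c⁻¹ : GL n K) := by
  constructor
  · rintro ⟨e⟩
    obtain ⟨g, hg1, hg2⟩ := (aevalEquivEquiv (M := Module.AEval' (Matrix.toLin' B))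
      (Matrix.toLin' (A : Matrix n n K))).symm e
    let f : (n → K) ≃ₗ[K] (n → K) := (LinearEquiv.ofBijective g hg2).trans
      (Module.AEval'.of (Matrix.toLin' B)).symm
    have hf : ∀ v, f (Matrix.toLin' (A : Matrix n n K) v) = Matrix.toLin' B (f v) := fun v => by
      change (Module.AEval'.of (Matrix.toLin' B)).symm (g _) = _
      rw [hg1, Module.AEval'.of_symm_X_smul]
      rfl
    let c : GL n K := Matrix.GeneralLinearGroup.toLin.symm
      ((LinearMap.GeneralLinearGroup.generalLinearEquiv K _).symm f)
    have hc : Matrix.toLin' (c : Matrix n n K) = f.toLinearMap := by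
      change ((Matrix.GeneralLinearGroup.toLin c : LinearMap.GeneralLinearGroup K (n → K)) :
        (n → K) →ₗ[K] (n → K)) = _
      rw [MulEquiv.apply_symm_apply]
      rfl
    refine ⟨c, ?_⟩
    have h1 : (c : Matrix n n K) * A = B * c := by
      apply Matrix.toLin'.injective
      rw [Matrix.toLin'_mul, Matrix.toLin'_mul, hc]
      exact LinearMap.ext hf
    rw [Units.val_mul, Units.val_mul, h1, Matrix.mul_assoc, ← Units.val_mul, mul_inv_cancel,
      Units.val_one, Matrix.mul_one]
  · rintro ⟨c, rfl⟩
    refine nonempty_aeval_equiv_iff (LinearMap.GeneralLinearGroup.generalLinearEquiv K _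
      (Matrix.GeneralLinearGroup.toLin c)) _ _ fun v => ?_
    change Matrix.toLin' (c : Matrix n n K) (Matrix.toLin' (A : Matrix n n K) v) =
      Matrix.toLin' ((c * A * c⁻¹ : GL n K) : Matrix n n K) (Matrix.toLin' (c : Matrix n n K) v)
    rw [← LinearMap.comp_apply, ← LinearMap.comp_apply, ← Matrix.toLin'_mul, ← Matrix.toLin'_mul,
      ← Units.val_mul, ← Units.val_mul, inv_mul_cancel_right]

/-- The multiset that describes the `i`-th module of a pretype. -/
def Pretype.toTy {κ : Type} {n : κ → ℕ} (P : Pretype n) (i : κ) : Multiset (P.Q × ℕ) :=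
  ∑ j, ((P.part i j).parts.map fun m => (j, m - 1) : List (P.Q × ℕ))

theorem sum_singleton_eq_map {ι α : Type*} [Fintype ι] (c : ι → α) :
    ∑ x, ({c x} : Multiset α) = Finset.univ.val.map c := by
  rw [← Multiset.sum_map_singleton (Finset.univ.val.map c), Multiset.map_map]
  rfl

theorem hasTy_pi_partition {Q Q' : Type} [Fintype Q] {K : Type w} [Field K] (F : Q → K[X])
    (f : Q → Q') (F' : Q' → K[X]) (hF : ∀ j, F' (f j) = F j) (l : Q → IntPartition) :
    HasTy F' (∀ j, PolyPartitionModule K (l j) (F j))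
      (∑ j, (((l j).parts.map fun m => (f j, m - 1) : List (Q' × ℕ)) : Multiset (Q' × ℕ))) := by
  let c : (Σ j : Q, Fin (l j).parts.length) → Q' × ℕ := fun x =>
    (f x.1, (l x.1).parts.get x.2 - 1)
  have hc : Finset.univ.val.map c =
      ∑ j, (((l j).parts.map fun m => (f j, m - 1) : List (Q' × ℕ)) : Multiset (Q' × ℕ)) := by
    rw [← sum_singleton_eq_map, Fintype.sum_sigma]
    refine Finset.sum_congr rfl fun j _ => ?_
    rw [sum_singleton_eq_map, Fin.univ_val_map]
    conv_rhs => rw [← List.ofFn_get (l j).parts, List.map_ofFn]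
    rfl
  refine ⟨_, inferInstance, c, hc, ⟨(LinearEquiv.piCongrRight fun j =>
    LinearEquiv.piCongrRight fun k => Submodule.quotEquivOfEq _ _ ?_).trans
      (LinearEquiv.piCurry K[X] fun j (k : Fin (l j).parts.length) =>
        K[X] ⧸ Ideal.span {F' (c ⟨j, k⟩).1 ^ ((c ⟨j, k⟩).2 + 1)}).symm⟩⟩
  change _ = Ideal.span {F' (f j) ^ ((l j).parts.get k - 1 + 1)}
  rw [hF, Nat.sub_add_cancel ((l j).pos _ (List.get_mem _ _))]

theorem Pretype.toTy_eq_of_equiv {κ : Type} {n : κ → ℕ} {P P₀ : Pretype n} (f : P.Q ≃ P₀.Q)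
    (hf : ∀ i j, P₀.part i (f j) = P.part i j) (i : κ) :
    P₀.toTy i = ∑ j, (((P.part i j).parts.map fun m => (f j, m - 1) : List (P₀.Q × ℕ)) :
      Multiset (P₀.Q × ℕ)) := by
  rw [Pretype.toTy, ← Equiv.sum_comp f]
  simp only [hf]

theorem mem_conjClass_iff_matTy {κ : Type} {m : κ → Type} [∀ i, Fintype (m i)]
    [∀ i, DecidableEq (m i)] {K : Type w} [Field K] {Q : Type} {p : Q → K[X]}
    {τ : κ → Multiset (Q × ℕ)} {g : GLTuple m K}
    (hg : ∀ i, MatTy p (g i : Matrix (m i) (m i) K) (τ i)) (h : ∀ i, Matrix (m i) (m i) K) :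
    (∃ c : GLTuple m K, ∀ i, h i = ((c * g * c⁻¹ : GLTuple m K) i : Matrix (m i) (m i) K)) ↔
      ∀ i, MatTy p (h i) (τ i) := by
  have h1 : ∀ i, MatTy p (h i) (τ i) ↔ ∃ c : GL (m i) K, h i = (c * g i * c⁻¹ : GL (m i) K) := by
    intro i
    rw [← nonempty_aeval_equiv_iff_conj]
    exact ⟨fun h' => (hg i).nonempty_equiv h', fun ⟨e⟩ => (hg i).of_equiv e⟩
  simp only [h1]
  exact ⟨fun ⟨c, hc⟩ i => ⟨c i, hc i⟩, fun h' => ⟨fun i => (h' i).choose, fun i => (h' i).choose_spec⟩⟩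

theorem ncard_carrier_inter_blockSubgroup {r : ℕ} (u : Fin r → ℕ) {K : Type w} [Field K]
    {Q : Type} {p : Q → K[X]}
    {τ : Fin 2 → Multiset (Q × ℕ)} {C : ConjClasses (GLTuple (fun _ : Fin 2 => BlockIdx u) K)}
    {g : GLTuple (fun _ : Fin 2 => BlockIdx u) K} (hC : g ∈ C.carrier)
    (hg : ∀ i, MatTy p (g i : Matrix (BlockIdx u) (BlockIdx u) K) (τ i)) :
    (C.carrier ∩ (blockSubgroup u K : Set (GLTuple (fun _ : Fin 2 => BlockIdx u) K))).ncard =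
      pairCount p u (τ 0) (τ 1) := by
  have hmem : ∀ h : GLTuple (fun _ : Fin 2 => BlockIdx u) K, h ∈ C.carrier ↔
      ∀ i, MatTy p (h i : Matrix (BlockIdx u) (BlockIdx u) K) (τ i) := fun h => by
    rw [← mem_conjClass_iff_matTy hg, ConjClasses.mem_carrier_iff_mk_eq,
      ← ConjClasses.mem_carrier_iff_mk_eq.1 hC, ConjClasses.mk_eq_mk_iff_isConj, isConj_comm,
      isConj_iff]
    refine exists_congr fun c => ⟨fun hc i => by rw [hc], fun hc => ?_⟩
    exact funext fun i => Units.ext (hc i).symm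
  refine Nat.card_eq_of_bijective (fun x => ⟨((x.1 0 : Matrix (BlockIdx u) (BlockIdx u) K),
    (x.1 1 : Matrix (BlockIdx u) (BlockIdx u) K)), x.2.2, (hmem _).1 x.2.1 0, (hmem _).1 x.2.1 1⟩)
    ⟨?_, ?_⟩
  · rintro ⟨x, hx⟩ ⟨y, hy⟩ hxy
    obtain ⟨h0, h1⟩ := Prod.ext_iff.1 (Subtype.ext_iff.1 hxy)
    refine Subtype.ext (funext fun i => Units.ext ?_)
    fin_cases i
    · exact h0
    · exact h1
  · rintro ⟨⟨Y, Z⟩, hYZ, hY, hZ⟩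
    obtain ⟨c, hc⟩ := (mem_conjClass_iff_matTy (m := fun _ : Fin 2 => BlockIdx u) hg ![Y, Z]).2
      (fun i => by fin_cases i <;> assumption)
    have h0 : Y = ((c * g * c⁻¹) 0 : Matrix (BlockIdx u) (BlockIdx u) K) := hc 0
    have h1 : Z = ((c * g * c⁻¹) 1 : Matrix (BlockIdx u) (BlockIdx u) K) := hc 1
    refine ⟨⟨c * g * c⁻¹, (hmem _).2 fun i => ?_, ?_⟩, ?_⟩
    · rw [← hc i]
      fin_cases i <;> assumption
    · change IsBlockPair _ _
      rw [← h0, ← h1]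
      exact hYZ
    · exact Subtype.ext (Prod.ext h0.symm h1.symm)

theorem isUniformFamily_blockSubgroup {r : ℕ} (u : Fin r → ℕ) :
    IsUniformFamily.{w} (fun _ : Fin 2 => BlockIdx u) (fun F _ _ => blockSubgroup u F) := by
  classical
  intro T
  obtain ⟨P₀, rfl⟩ := Quotient.exists_rep T
  obtain ⟨p, hp⟩ := (isRationalIn_pairCount.{w} (d := P₀.deg) u (P₀.toTy 0)
    (P₀.toTy 1)).exists_polynomial
  refine ⟨p, fun K _ _ C hC => ?_⟩
  obtain ⟨g, hgC, P, hP, F, hF, hF', hg⟩ := hC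
  obtain ⟨f, hf, hf'⟩ := Quotient.exact hP
  -- The class realises a pretype that is only isomorphic to the representative of T. Reindexing its
  -- polynomials along f places all fields and classes over the same index set, so that one
  -- polynomial serves them all.
  let ω : PolySystem.{w} P₀.deg :=
    { K := K
      F := F ∘ f.symm
      injective := hF.comp f.symm.injective
      monic := fun j => (hF' _).1
      irreducible := fun j => (hF' _).2.1
      natDegree_eq := fun j => by rw [Function.comp_apply, (hF' _).2.2, ← hf, f.apply_symm_apply] }
  have hτ : ∀ i, MatTy ω.F (g i : Matrix (BlockIdx u) (BlockIdx u) K) (P₀.toTy i) := fun i => by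
    rw [Pretype.toTy_eq_of_equiv f hf']
    obtain ⟨e⟩ := hg i
    exact (hasTy_pi_partition F f ω.F (fun j => congrArg F (f.symm_apply_apply j)) _).of_equiv e.symm
  rw [ncard_carrier_inter_blockSubgroup u hgC hτ]
  exact hp ω

end Uniform

/-! ### The image of `β` -/

section BetaImage

variable {r : ℕ} {μ u : Fin r → ℕ} {o : Type v} [CommRing o] [IsDomain o]
  [IsDiscreteValuationRing o]

theorem pow_dvd_of_map_genE {t : o} (ht : Irreducible t) {h : DVRModule μ u o →ₗ[o] DVRModule μ u o}
    {a : BlockIdx u → BlockIdx u → o}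
    (ha : ∀ y, h (genE μ u o y) = ∑ x, a x y • genE μ u o x) (x y : BlockIdx u) :
    t ^ μ x.1 ∣ t ^ μ y.1 * a x y := by
  have h0 : t ^ μ y.1 • genE μ u o y = 0 := by
    funext z
    by_cases hz : z = y
    · subst hz
      simp only [genE, Pi.smul_apply, Pi.single_eq_same, Pi.zero_apply, Algebra.smul_def, mul_one]
      exact (mk_pow_eq_zero_iff ht _ _).2 dvd_rfl
    · simp [genE, Pi.single_eq_of_ne hz]
  have h1 : ∑ x, (t ^ μ y.1 * a x y) • genE μ u o x = 0 := by
    rw [← map_zero h, ← h0, map_smul, ha, Finset.smul_sum]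
    simp only [mul_smul]
  rw [sum_smul_genE] at h1
  exact (mk_pow_eq_zero_iff ht _ _).1 (congrFun h1 x)

/-- The only relation on e_y is t^(μ_y) e_y = 0, and the divisibility says that the proposed image
of e_y satisfies it. -/
theorem exists_map_genE {t : o} (ht : Irreducible t) {a : BlockIdx u → BlockIdx u → o}
    (ha : ∀ x y, t ^ μ x.1 ∣ t ^ μ y.1 * a x y) :
    ∃ h : DVRModule μ u o →ₗ[o] DVRModule μ u o,
      ∀ y, h (genE μ u o y) = ∑ x, a x y • genE μ u o x := by
  let v : BlockIdx u → DVRModule μ u o := fun y => ∑ x, a x y • genE μ u o x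
  let φ : ∀ y : BlockIdx u, (o ⧸ maximalIdeal o ^ μ y.1) →ₗ[o] DVRModule μ u o := fun y =>
    Submodule.liftQ (maximalIdeal o ^ μ y.1) (LinearMap.toSpanSingleton o _ (v y)) (by
      intro c hc
      obtain ⟨c, rfl⟩ := (pow_mem_iff_dvd ht _ _).1 hc
      rw [LinearMap.mem_ker, LinearMap.toSpanSingleton_apply, Finset.smul_sum]
      simp only [smul_smul]
      rw [sum_smul_genE]
      funext x
      refine (mk_pow_eq_zero_iff ht _ _).2 ?_
      rw [mul_right_comm]
      exact (ha x y).mul_right c)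
  refine ⟨∑ y, φ y ∘ₗ LinearMap.proj y, fun y => ?_⟩
  rw [LinearMap.sum_apply, Finset.sum_eq_single y]
  · rw [LinearMap.comp_apply, LinearMap.proj_apply, genE, Pi.single_eq_same]
    exact one_smul o (v y)
  · intro z _ hz
    rw [LinearMap.comp_apply, LinearMap.proj_apply, genE, Pi.single_eq_of_ne hz, map_zero]
  · simp

theorem toMatrix_modPMap (hμ : ∀ i, 0 < μ i) {h : DVRModule μ u o →ₗ[o] DVRModule μ u o}
    {a : BlockIdx u → BlockIdx u → o}
    (ha : ∀ y, h (genE μ u o y) = ∑ x, a x y • genE μ u o x) :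
    LinearMap.toMatrixAlgEquiv (basisE u hμ) (modPMap o h) =
      Matrix.of fun x y => residue o (a x y) := by
  ext x y
  have h1 : modPMap o h (basisE u hμ y) = ∑ x, residue o (a x y) • basisE u hμ x := by
    rw [basisE_apply, modPMap_mk, ha, map_sum]
    refine Finset.sum_congr rfl fun x _ => ?_
    rw [map_smul, basisE_apply, ← algebraMap_smul (ResidueField o) (a x y)]
    rfl
  rw [LinearMap.toMatrixAlgEquiv_apply, h1, Module.Basis.repr_sum_self, Matrix.of_apply]

/-- The map sends t^(μ_y - 1) e_y to the sum of t^(μ_y - 1) a_xy e_x, and `hb` rewrites each term as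
b_xy times the basis vector t^(μ_x - 1) e_x. -/
theorem toMatrix_torsPMap (hμ : ∀ i, 0 < μ i) {t : o} (ht : Irreducible t)
    {h : DVRModule μ u o →ₗ[o] DVRModule μ u o} {a b : BlockIdx u → BlockIdx u → o}
    (ha : ∀ y, h (genE μ u o y) = ∑ x, a x y • genE μ u o x)
    (hb : ∀ x y, t ^ (μ y.1 - 1) * a x y = t ^ (μ x.1 - 1) * b x y) :
    LinearMap.toMatrixAlgEquiv (basisF u hμ ht) (torsPMap o h) =
      Matrix.of fun x y => residue o (b x y) := by
  ext x y
  have h1 : torsPMap o h (basisF u hμ ht y) = ∑ x, residue o (b x y) • basisF u hμ ht x := by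
    apply TorsPB.incl_injective o
    rw [incl_torsPMap, incl_basisF_apply, map_smul, ha, map_sum, Finset.smul_sum]
    refine Finset.sum_congr rfl fun x _ => ?_
    rw [smul_smul, hb, mul_comm, mul_smul, ← incl_basisF_apply u hμ ht, ← map_smul,
      ← algebraMap_smul (ResidueField o) (b x y)]
    rfl
  rw [LinearMap.toMatrixAlgEquiv_apply, h1, Module.Basis.repr_sum_self, Matrix.of_apply]

theorem isBlockPair_of_pow_mul_eq (hμa : StrictAnti μ) (hμ : ∀ i, 0 < μ i) {t : o}
    (ht : Irreducible t) {a b : BlockIdx u → BlockIdx u → o}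
    (hb : ∀ x y, t ^ (μ y.1 - 1) * a x y = t ^ (μ x.1 - 1) * b x y) :
    IsBlockPair (Matrix.of fun x y => residue o (a x y))
      (Matrix.of fun x y => residue o (b x y)) := by
  rw [isBlockPair_iff]
  refine ⟨fun x y hxy => ?_, fun x y hxy => ?_, fun i c d => ?_⟩
  · rw [Matrix.of_apply, residue_eq_zero_iff_dvd ht]
    have h1 := hμa hxy
    have h2 := hμ y.1
    have h3 := hb x y
    rw [show μ x.1 - 1 = (μ y.1 - 1) + (μ x.1 - μ y.1) by omega, pow_add, mul_assoc] at h3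
    rw [mul_left_cancel₀ (pow_ne_zero _ ht.ne_zero) h3]
    exact (dvd_pow_self t (by omega)).mul_right _
  · rw [Matrix.of_apply, residue_eq_zero_iff_dvd ht]
    have h1 := hμa hxy
    have h2 := hμ x.1
    have h3 := hb x y
    rw [show μ y.1 - 1 = (μ x.1 - 1) + (μ y.1 - μ x.1) by omega, pow_add, mul_assoc] at h3
    rw [← mul_left_cancel₀ (pow_ne_zero _ ht.ne_zero) h3]
    exact (dvd_pow_self t (by omega)).mul_right _
  · exact congrArg (residue o) (mul_left_cancel₀ (pow_ne_zero _ ht.ne_zero) (hb ⟨i, c⟩ ⟨i, d⟩))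

/-- The entry not forced to vanish is lifted freely, and the other is its multiple by the positive
power of t that balances the exponents; on diagonal blocks one lift serves both matrices. -/
theorem exists_lift_of_isBlockPair (hμa : StrictAnti μ) (hμ : ∀ i, 0 < μ i) {t : o}
    (ht : Irreducible t) {Y Z : Matrix (BlockIdx u) (BlockIdx u) (ResidueField o)}
    (hYZ : IsBlockPair Y Z) : ∃ a b : BlockIdx u → BlockIdx u → o,
      (∀ x y, t ^ (μ y.1 - 1) * a x y = t ^ (μ x.1 - 1) * b x y) ∧
        (Matrix.of fun x y => residue o (a x y)) = Y ∧
        (Matrix.of fun x y => residue o (b x y)) = Z := by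
  obtain ⟨h1, h2, h3⟩ := isBlockPair_iff.1 hYZ
  have key : ∀ x y, ∃ a b : o, t ^ (μ y.1 - 1) * a = t ^ (μ x.1 - 1) * b ∧
      residue o a = Y x y ∧ residue o b = Z x y := by
    intro x y
    rcases lt_trichotomy x.1 y.1 with hxy | hxy | hxy
    · obtain ⟨b, hb⟩ := residue_surjective (Z x y)
      have h4 := hμa hxy
      have h5 := hμ y.1
      refine ⟨t ^ (μ x.1 - μ y.1) * b, b, ?_, ?_, hb⟩
      · rw [← mul_assoc, ← pow_add]
        congr 2
        omega
      · rw [h1 x y hxy, residue_eq_zero_iff_dvd ht]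
        exact (dvd_pow_self t (by omega)).mul_right _
    · obtain ⟨i, c⟩ := x
      obtain ⟨j, d⟩ := y
      obtain rfl : i = j := hxy
      obtain ⟨a, ha⟩ := residue_surjective (Y ⟨i, c⟩ ⟨i, d⟩)
      exact ⟨a, a, rfl, ha, ha.trans (h3 i c d)⟩
    · obtain ⟨a, ha⟩ := residue_surjective (Y x y)
      have h4 := hμa hxy
      have h5 := hμ x.1
      refine ⟨a, t ^ (μ y.1 - μ x.1) * a, ?_, ha, ?_⟩
      · rw [← mul_assoc, ← pow_add]
        congr 2
        omega
      · rw [h2 x y hxy, residue_eq_zero_iff_dvd ht]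
        exact (dvd_pow_self t (by omega)).mul_right _
  choose a b h using key
  exact ⟨a, b, fun x y => (h x y).1, Matrix.ext fun x y => (h x y).2.1,
    Matrix.ext fun x y => (h x y).2.2⟩

/-- Nakayama's lemma gives surjectivity, and a surjective endomorphism of a finitely generated
module is injective. -/
theorem bijective_of_modPMap_surjective {B : Type v} [AddCommGroup B] [Module o B]
    [Module.Finite o B] {h : B →ₗ[o] B} (hh : Function.Surjective (modPMap o h)) :
    Function.Bijective h := by
  have h1 : (⊤ : Submodule o B) ≤ LinearMap.range h := by
    refine Submodule.le_of_le_smul_of_le_jacobson_bot (I := maximalIdeal o) Module.Finite.fg_top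
      (IsLocalRing.jacobson_eq_maximalIdeal ⊥ bot_ne_top).ge ?_
    intro b _
    obtain ⟨c, hc⟩ := hh (ModPB.mk o b)
    obtain ⟨c, rfl⟩ := ModPB.mk_surjective o c
    rw [modPMap_mk] at hc
    have h2 : b - h c ∈ maximalIdeal o • (⊤ : Submodule o B) :=
      (Submodule.Quotient.eq _).1 hc.symm
    rw [← sub_add_cancel b (h c), add_comm]
    exact Submodule.add_mem_sup ⟨c, rfl⟩ h2
  have h3 : Function.Surjective h := LinearMap.range_eq_top.1 (top_le_iff.1 h1)
  exact ⟨OrzechProperty.injective_of_surjective_endomorphism h h3, h3⟩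

theorem betaImage_eq_blockSubgroup (hμa : StrictAnti μ) (hμ : ∀ i, 0 < μ i) {t : o}
    (ht : Irreducible t) :
    betaImage (o := o) u hμ ht = blockSubgroup u (ResidueField o) := by
  ext g
  constructor
  · rintro ⟨_, ⟨h, rfl⟩, rfl⟩
    -- Here the index of the argument e_y comes first in `a`, hence the swapped `fun x y => a y x`
    -- below.
    choose a ha using fun y => exists_sum_smul_genE u (h.1 (genE μ u o y))
    have hb : ∀ x y, ∃ b, t ^ (μ y.1 - 1) * a y x = t ^ (μ x.1 - 1) * b := fun x y => by
      have h1 := pow_dvd_of_map_genE (a := fun x y => a y x) ht ha x y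
      rw [← mul_pow_sub_one (hμ x.1).ne', ← mul_pow_sub_one (hμ y.1).ne', mul_assoc] at h1
      exact (mul_dvd_mul_iff_left ht.ne_zero).1 h1
    choose b hb using hb
    have h1 := isBlockPair_of_pow_mul_eq (a := fun x y => a y x) hμa hμ ht hb
    rw [← toMatrix_modPMap hμ ha, ← toMatrix_torsPMap (a := fun x y => a y x) hμ ht ha hb] at h1
    exact h1
  · intro hg
    obtain ⟨a, b, hab, hY, hZ⟩ := exists_lift_of_isBlockPair hμa hμ ht hg
    obtain ⟨h, hh⟩ := exists_map_genE (a := a) ht fun x y => by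
      rw [← mul_pow_sub_one (hμ x.1).ne', ← mul_pow_sub_one (hμ y.1).ne', mul_assoc, hab]
      exact mul_dvd_mul_left t (dvd_mul_right _ _)
    have hY' := (toMatrix_modPMap hμ hh).trans hY
    have hZ' := (toMatrix_torsPMap hμ ht hh hab).trans hZ
    have hs : Function.Surjective (modPMap o h) := by
      have h1 : IsUnit (modPMap o h) := by
        rw [← MulEquiv.isUnit_map (LinearMap.toMatrixAlgEquiv (basisE u hμ)), hY']
        exact (g 0).isUnit
      exact ((Module.End.isUnit_iff _).1 h1).2
    have hbij := bijective_of_modPMap_surjective hs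
    let h' : LinearMap.GeneralLinearGroup o (DVRModule μ u o) :=
      (LinearMap.GeneralLinearGroup.generalLinearEquiv o _).symm (LinearEquiv.ofBijective h hbij)
    refine ⟨_, ⟨h', rfl⟩, funext fun i => Units.ext ?_⟩
    fin_cases i
    · exact hY'
    · exact hZ'

end BetaImage

theorem mainTheorem7 {r : ℕ} (u : Fin r → ℕ) (hu : ∀ i, 0 < u i) :
    (∀ (o : Type w) [CommRing o] [IsDomain o] [IsDiscreteValuationRing o]
        [Finite (ResidueField o)] (t : o) (ht : Irreducible t)
        (μ : Fin r → ℕ) (_ : StrictAnti μ) (hμ : ∀ i, 0 < μ i),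
        betaImage (o := o) u hμ ht = blockSubgroup u (ResidueField o)) ∧
      IsUniformFamily.{w} (fun _ : Fin 2 => BlockIdx u) (fun F _ _ => blockSubgroup u F) := by
  exact ⟨fun o _ _ _ _ t ht μ hμa hμ => betaImage_eq_blockSubgroup hμa hμ ht,
    isUniformFamily_blockSubgroup u⟩
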